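/- **Theorem (Regular Extension).** Work in the formal theory $\mathsf{HA}+\mathsf{ECT}_V$ + (V1)–(V2) + (Ξ1)–(Ξ2) + (Ω1)–(Ω3) described below. The theory defines extensional equality $\simeq$ of v-sets, and it proves: every v-set $x$ is an element of a regular v-set. Moreover, there are primitive recursive functions $h$ and $V$ such that the theory proves the following. 1. For every v-set $x$, $\tau=h(x)$ is a sequence of Meaningful conditions, not all of them True, that contains the conditions of $x$; and $x\in V(\tau)$. 2. For every sequence $\tau$ of Meaningful conditions, not all of them True (some $\tau F$ is not True), $V(\tau)$ is a regular v-set, and it consists of all and only the v-sets that can be built from $\tau$: every v-set $y$ whose conditions are all in $\tau$ and whose elements are all in $V(\tau)$ is in $V(\tau)$, and all the elements of $V(\tau)$ are inductively generated by this rule (an induction schema for all formulas of the theory). *Language and logic.* The theory is first-order arithmetic with intuitionistic logic, with symbols for all primitive recursive functions and three unary predicates $\mathcal V$ ("is a v-set"), $\mathcal M$ ("is a Meaningful condition"), $\mathcal T$ ("is a True condition"); induction is for all formulas of this language. $\langle\cdot,\cdot\rangle$ is the Cantor pairing function, with projections $(\cdot)_L,(\cdot)_R$. $ei$ is the value of the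 $e$th partial recursive function at $i$; a statement about $ei$ includes that $ei$ is defined, written $ei\!\downarrow$. $\Lambda n.t(n)$ is an index for the function $n\mapsto t(n)$. $\langle\rangle$ is the code of the empty sequence, $\langle n\rangle\star x$ is the sequence $x$ with $n$ put in front of it, and $f^{(n)}=\Lambda x.f(\langle n\rangle\star x)$. Write $x_n=(xn)_L$ for the $n$th conditional element and $c_n(x)=(xn)_R$ for the $n$th condition of $x$. Put $\Xi(f,g)=2\langle f,g\rangle+1$ and $\Omega(f)=4f+2$. *Extended Church's Thesis* $\mathsf{ECT}_V$: for $\psi$ arbitrary and $\varphi$ almost-negative (the class generated from $\Sigma_1$ formulas of arithmetic and the atoms $\mathcal V(t),\mathcal M(t),\mathcal T(t)$ by $\wedge,\to,\forall$), $$(\forall n.\,\varphi(n)\to\exists m.\,\psi(n,m))\to\exists e.\forall n.\,\varphi(n)\to en\!\downarrow\wedge\,\psi(n,en).$$ *Axioms for $\mathcal V,\mathcal M,\mathcal T$* ($\varphi$ is any formula): - (V1) $\forall x.\,(\forall n.\,xn\!\downarrow\wedge\,\mathcal M(c_n(x))\wedge(\mathcal T(c_n(x))\to\mathcal V(x_n)))\to\mathcal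 V(x)$. - (V2) $(\forall x.\,(\forall n.\,xn\!\downarrow\wedge\,\mathcal M(c_n(x))\wedge(\mathcal T(c_n(x))\to\varphi(x_n)))\to\varphi(x))\to\forall x.\,\mathcal V(x)\to\varphi(x)$. - (Ξ1) $\forall f,g.\,\mathcal M(\Xi(f,g))\to(\mathcal T(\Xi(f,g))\leftrightarrow\forall n.\,fn\!\downarrow\wedge\,\mathcal T(fn)\to gn\!\downarrow\wedge\,\mathcal T(gn))$. - (Ξ2) $\forall f,g.\,(\forall n.\,fn\!\downarrow\to\mathcal M(fn))\wedge(\forall n.\,fn\!\downarrow\wedge\,gn\!\downarrow\wedge\,\mathcal T(fn)\to\mathcal M(gn))\to\mathcal M(\Xi(f,g))$. - (Ω1) $\forall f.\,(\forall n.\,fn\!\downarrow\wedge\,\mathcal M(fn))\to\mathcal M(\Omega(f))$. - (Ω2) $\forall f.\,\mathcal M(\Omega(f))\wedge(\mathcal T(f\langle\rangle)\to\forall n.\,\mathcal T(\Omega(f^{(n)})))\to\mathcal T(\Omega(f))$. - (Ω3) $(\forall f.\,\mathcal M(\Omega(f))\wedge(\mathcal T(f\langle\rangle)\to\forall n.\,\varphi(f^{(n)}))\to\varphi(f))\to\forall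 f.\,\mathcal T(\Omega(f))\to\varphi(f)$. *Set theory.* The bounded quantifiers $\forall a\in x$, $\exists a\in x$ range over the $x_n$ with $c_n(x)$ True, and unbounded ones over all v-sets. Extensional equality $\simeq$ is a formula for which the theory proves, for all v-sets $x,y$: $x\simeq y\leftrightarrow(\forall a\in x.\exists b\in y.\,a\simeq b)\wedge(\forall b\in y.\exists a\in x.\,b\simeq a)$. Membership $s\in y$ means $\exists a\in y.\,s\simeq a$. A v-set $A$ is *regular* if it is inhabited, transitive ($b\in a\in A$ implies $b\in A$) and closed under Strong Collection: for every $a\in A$ and every v-set $R$, if for every $u\in a$ there is $w\in A$ with $(u,w)\in R$ (Kuratowski pair), then there is $b\in A$ such that for every $w\in b$ there is $u\in a$ with $(u,w)\in R$, and for every $u\in a$ there is $w\in b$ with $(u,w)\in R$. A number $\tau$ is a *sequence of Meaningful conditions* if $\tau n\!\downarrow\wedge\,\mathcal M(\tau n)$ for all $n$. The conditions of $y$ are *in* $\tau$ if for every $n$ there is $m$ such that $\mathcal T(\tau m)\leftrightarrow\mathcal T(c_n(y))$. -/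

import Mathlib

/-! The formal theory `HA + ECT_V` together with the defining assumptions for the predicates
`𝒱` (being a v-set), `ℳ` (being a Meaningful condition) and `𝒯` (being a True condition).

Extended Church's Thesis contradicts classical logic, so it cannot be a hypothesis of a theorem of
Lean.  The theory is an object: formulas of first-order arithmetic with three additional unary
predicates, derivability in intuitionistic predicate logic with equality, and sets of axioms. -/

namespace VSets

/-! ### Primitive recursive function symbols -/

/-- Symbols for the primitive recursive functions, indexed by their arity.  In `prec f g` the
recursion variable is the first argument: `h(0, x) = f(x)`, `h(n + 1, x) = g(n, h(n, x), x)`. -/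
inductive PR : ℕ → Type
  | zero : PR 0
  | succ : PR 1
  | proj {n : ℕ} (i : Fin n) : PR n
  | comp {m n : ℕ} (f : PR m) (g : Fin m → PR n) : PR n
  | prec {n : ℕ} (f : PR n) (g : PR (n + 2)) : PR (n + 1)

namespace PR

/-- Composition of a unary symbol with a symbol. -/
def c1 {n : ℕ} (f : PR 1) (a : PR n) : PR n := comp f ![a]
/-- Composition of a binary symbol with symbols. -/
def c2 {n : ℕ} (f : PR 2) (a b : PR n) : PR n := comp f ![a, b]
/-- Composition of a ternary symbol with symbols. -/
def c3 {n : ℕ} (f : PR 3) (a b c : PR n) : PR n := comp f ![a, b, c]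

/-- The constant function with value `k`. -/
def const {n : ℕ} : ℕ → PR n
  | 0 => comp zero ![]
  | k + 1 => c1 succ (const k)

/-- `pred 0 = 0`, `pred (n + 1) = n`. -/
def pred : PR 1 := prec zero (proj 0)
/-- Addition. -/
def add : PR 2 := prec (proj 0) (c1 succ (proj 1))
/-- `(b, a) ↦ a ∸ b`. -/
def rsub : PR 2 := prec (proj 0) (c1 pred (proj 1))
/-- Truncated subtraction `(a, b) ↦ a ∸ b`. -/
def sub : PR 2 := c2 rsub (proj 1) (proj 0)
/-- `(n, a, b) ↦ a` if `n = 0`, and `b` otherwise. -/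
def ifz : PR 3 := prec (proj 0) (proj 3)
/-- The triangular numbers `0 + 1 + ⋯ + n`. -/
def tri : PR 1 := prec zero (c2 add (proj 1) (c1 succ (proj 0)))
/-- The Cantor pairing function `⟨x, y⟩ = (x + y)(x + y + 1)/2 + y`. -/
def pair : PR 2 := c2 add (c1 tri (c2 add (proj 0) (proj 1))) (proj 1)
/-- The largest `w` with `tri w ≤ n`. -/
def root : PR 1 :=
  prec zero (c3 ifz (c2 sub (c1 tri (c1 succ (proj 1))) (c1 succ (proj 0)))
    (c1 succ (proj 1)) (proj 1))
/-- The right projection `⟨x, y⟩ ↦ y` of the Cantor pairing. -/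
def right : PR 1 := c2 sub (proj 0) (c1 tri root)
/-- The left projection `⟨x, y⟩ ↦ x` of the Cantor pairing. -/
def left : PR 1 := c2 sub root right

/-- `switch t [b₀, …, bₖ] d` is `bᵢ` if `t = i ≤ k`, and `d` if `t > k`. -/
def switch {n : ℕ} (t : PR n) : List (PR n) → PR n → PR n
  | [], d => d
  | b :: bs, d => c3 ifz t b (switch (c1 pred t) bs d)

/-- The state `⟨k, ⟨e, i⟩⟩` of the evaluator: apply the program `e` to the input `i`, then apply
the programs on the stack `k` one after another. -/
def state {n : ℕ} (e i k : PR n) : PR n := c2 pair k (c2 pair e i)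

/-- The program `⟨tag, p⟩`. -/
def prog {n : ℕ} (tag : ℕ) (p : PR n) : PR n := c2 pair (const tag) p

/-- One step of the evaluator.  Programs are numbers `e = ⟨t, p⟩`.  They are Kleene's schemata for
the partial recursive functions, with one argument because there is pairing: identity, constants,
successor, projections, composition, pairing, primitive recursion, and the enumeration scheme
(application of the first component of the argument to the second).  What they compute:
* `t = 0`: `i ↦ i` (the next program is popped off the stack);
* `t = 1`: `i ↦ p`;
* `t = 2`: `i ↦ i + 1`;
* `t = 3`, `t = 4`: the left and the right projection;
* `t = 5`, `p = ⟨f, g⟩`: `i ↦ f (g i)`;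
* `t = 6`, `p = ⟨f, g⟩`: `i ↦ ⟨f i, g i⟩`;
* `t = 7`, `p = ⟨g, j⟩`: `i ↦ ⟨i, g j⟩`;
* `t = 8`: `i ↦ ⟨p, i⟩`;
* `t = 9`, `p = ⟨f, g⟩`: `⟨a, 0⟩ ↦ f a`, `⟨a, m + 1⟩ ↦ g ⟨⟨a, m⟩, e ⟨a, m⟩⟩`;
* `t ≥ 10`: `⟨d, j⟩ ↦ d j`.
The empty stack is `0 = ⟨0, 0⟩`; popping it gives the identity and the empty stack. -/
def step : PR 1 :=
  let k : PR 1 := c1 left (proj 0)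
  let e : PR 1 := c1 left (c1 right (proj 0))
  let i : PR 1 := c1 right (c1 right (proj 0))
  let p : PR 1 := c1 right e
  let f : PR 1 := c1 left p
  let g : PR 1 := c1 right p
  let iL : PR 1 := c1 left i
  let iR : PR 1 := c1 right i
  let smaller : PR 1 := c2 pair iL (c1 pred iR)
  switch (c1 left e)
    [ state (c1 left k) i (c1 right k),
      state (const 0) p k,
      state (const 0) (c1 succ i) k,
      state (const 0) iL k,
      state (const 0) iR k,
      state g i (c2 pair f k),
      state f i (c2 pair (prog 7 (c2 pair g i)) k),
      state f g (c2 pair (prog 8 i) k),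
      state (const 0) (c2 pair p i) k,
      c3 ifz iR (state f iL k) (state e smaller (c2 pair (prog 8 smaller) (c2 pair g k))) ]
    (state iL iR k)

/-- `run (n, s)` is the state after `n` steps from the state `s`. -/
def run : PR 2 := prec (proj 0) (c1 step (proj 1))

end PR

/-! ### Terms and formulas -/

/-- Terms, with de Bruijn indices for the variables. -/
inductive Tm : Type
  | var (n : ℕ) : Tm
  | fn {k : ℕ} (f : PR k) (ts : Fin k → Tm) : Tm

/-- Formulas; `isV`, `isM`, `isT` are the predicates `𝒱`, `ℳ`, `𝒯`. -/
inductive Fm : Type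
  | eq (s t : Tm) : Fm
  | isV (t : Tm) : Fm
  | isM (t : Tm) : Fm
  | isT (t : Tm) : Fm
  | bot : Fm
  | and (φ ψ : Fm) : Fm
  | or (φ ψ : Fm) : Fm
  | imp (φ ψ : Fm) : Fm
  | all (φ : Fm) : Fm
  | ex (φ : Fm) : Fm

/-- Simultaneous substitution in a term. -/
def Tm.subst (σ : ℕ → Tm) : Tm → Tm
  | .var n => σ n
  | .fn f ts => .fn f (fun i => (ts i).subst σ)

/-- The term `t` read under one more quantifier. -/
def Tm.lift (t : Tm) : Tm := t.subst (fun n => .var (n + 1))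

/-- A substitution taken under a quantifier. -/
def up (σ : ℕ → Tm) : ℕ → Tm
  | 0 => .var 0
  | n + 1 => (σ n).lift

namespace Fm

/-- Simultaneous capture-free substitution in a formula. -/
def subst (σ : ℕ → Tm) : Fm → Fm
  | eq s t => eq (s.subst σ) (t.subst σ)
  | isV t => isV (t.subst σ)
  | isM t => isM (t.subst σ)
  | isT t => isT (t.subst σ)
  | bot => bot
  | and φ ψ => and (φ.subst σ) (ψ.subst σ)
  | or φ ψ => or (φ.subst σ) (ψ.subst σ)
  | imp φ ψ => imp (φ.subst σ) (ψ.subst σ)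
  | all φ => all (φ.subst (up σ))
  | ex φ => ex (φ.subst (up σ))

/-- The formula `φ` read under one more quantifier. -/
def lift (φ : Fm) : Fm := φ.subst (fun n => .var (n + 1))

/-- For `φ = φ(x)` with `x` the variable of index `0`: the formula `φ(t)`, read `k` quantifiers
further inside than the parameters of `φ` (the variables of index `j + 1` in `φ`). -/
def inst (k : ℕ) (t : Tm) (φ : Fm) : Fm :=
  φ.subst (fun | 0 => t | j + 1 => .var (j + k))

/-- The same for `ψ = ψ(x, y)`, where `x` has index `1` and `y` has index `0`: `ψ(s, t)`. -/
def inst2 (k : ℕ) (s t : Tm) (ψ : Fm) : Fm :=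
  ψ.subst (fun | 0 => t | 1 => s | j + 2 => .var (j + k))

/-- Truth. -/
def top : Fm := bot.imp bot
/-- Negation. -/
def not (φ : Fm) : Fm := φ.imp bot
/-- Equivalence. -/
def iff (φ ψ : Fm) : Fm := (φ.imp ψ).and (ψ.imp φ)

end Fm

open Fm

/-- Variables. -/
abbrev v (n : ℕ) : Tm := .var n

namespace Tm

/-- The term `0`. -/
def zero : Tm := .fn .zero ![]
/-- The successor of a term. -/
def succ (t : Tm) : Tm := .fn .succ ![t]
/-- Numerals. -/
def num : ℕ → Tm
  | 0 => zero
  | n + 1 => succ (num n)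
/-- The pair `⟨s, t⟩`. -/
def pair (s t : Tm) : Tm := .fn .pair ![s, t]
/-- The projection `t_L`. -/
def L (t : Tm) : Tm := .fn .left ![t]
/-- The projection `t_R`. -/
def R (t : Tm) : Tm := .fn .right ![t]
/-- Sums. -/
def add (s t : Tm) : Tm := .fn .add ![s, t]
/-- `2t`. -/
def double (t : Tm) : Tm := t.add t

/-- The code `Ξ(f, g) = 2⟨f, g⟩ + 1`. -/
def Xi (f g : Tm) : Tm := (double (pair f g)).succ
/-- The code `Ω(f) = 4f + 2`. -/
def Om (f : Tm) : Tm := (double (double f)).succ.succ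

/-- The finite sequence `⟨⟩`. -/
def nil : Tm := zero

/-- `f⁽ⁿ⁾ = Λx. f(⟨n⟩ ⋆ x)`, where `⟨n⟩ ⋆ x = ⟨n, x⟩ + 1`. Together with `⟨⟩ = 0` this codes finite
sequences bijectively. The program is the composition of `f` with the composition of the successor
with `x ↦ ⟨n, x⟩`. -/
def shift (f n : Tm) : Tm :=
  pair (num 5) (pair f
    (pair (num 5) (pair (pair (num 2) zero) (pair (num 8) n))))

/-- The output `U(o)` of a computation. -/
def U (o : Tm) : Tm := o.R

end Tm

open Tm

/-! ### Intuitionistic predicate logic with equality -/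

/-- `Derives Th Γ φ`: natural deduction of `φ` from the assumptions `Γ` and the axioms `Th`.  Free
variables of axioms are understood to be universally quantified. -/
inductive Derives (Th : Set Fm) : List Fm → Fm → Prop
  | ax {Γ} {φ : Fm} : φ ∈ Th → Derives Th Γ φ
  | hyp {Γ} {φ : Fm} : φ ∈ Γ → Derives Th Γ φ
  | botE {Γ} {φ : Fm} : Derives Th Γ bot → Derives Th Γ φ
  | andI {Γ} {φ ψ : Fm} : Derives Th Γ φ → Derives Th Γ ψ → Derives Th Γ (φ.and ψ)
  | andL {Γ} {φ ψ : Fm} : Derives Th Γ (φ.and ψ) → Derives Th Γ φ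
  | andR {Γ} {φ ψ : Fm} : Derives Th Γ (φ.and ψ) → Derives Th Γ ψ
  | orL {Γ} {φ ψ : Fm} : Derives Th Γ φ → Derives Th Γ (φ.or ψ)
  | orR {Γ} {φ ψ : Fm} : Derives Th Γ ψ → Derives Th Γ (φ.or ψ)
  | orE {Γ} {φ ψ χ : Fm} : Derives Th Γ (φ.or ψ) → Derives Th (φ :: Γ) χ → Derives Th (ψ :: Γ) χ →
      Derives Th Γ χ
  | impI {Γ} {φ ψ : Fm} : Derives Th (φ :: Γ) ψ → Derives Th Γ (φ.imp ψ)
  | impE {Γ} {φ ψ : Fm} : Derives Th Γ (φ.imp ψ) → Derives Th Γ φ → Derives Th Γ ψ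
  | allI {Γ} {φ : Fm} : Derives Th (Γ.map Fm.lift) φ → Derives Th Γ (all φ)
  | allE {Γ} {φ : Fm} (t : Tm) : Derives Th Γ (all φ) → Derives Th Γ (φ.inst 0 t)
  | exI {Γ} {φ : Fm} (t : Tm) : Derives Th Γ (φ.inst 0 t) → Derives Th Γ (ex φ)
  | exE {Γ} {φ χ : Fm} : Derives Th Γ (ex φ) → Derives Th (φ :: Γ.map Fm.lift) χ.lift → Derives Th Γ χ
  | eqRefl {Γ} (t : Tm) : Derives Th Γ (eq t t)
  | eqE {Γ} {s t : Tm} (φ : Fm) : Derives Th Γ (eq s t) → Derives Th Γ (φ.inst 0 s) →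
      Derives Th Γ (φ.inst 0 t)

/-! ### Heyting arithmetic -/

/-- Axioms of Heyting arithmetic with symbols for all primitive recursive functions.  Induction is
for all formulas of the language, including those with `𝒱`, `ℳ`, `𝒯`. -/
inductive HA : Set Fm
  | succ_ne (t : Tm) : HA (not (eq t.succ zero))
  | succ_inj (s t : Tm) : HA ((eq s.succ t.succ).imp (eq s t))
  | proj {n : ℕ} (i : Fin n) (ts : Fin n → Tm) : HA (eq (.fn (.proj i) ts) (ts i))
  | comp {m n : ℕ} (f : PR m) (g : Fin m → PR n) (ts : Fin n → Tm) :
      HA (eq (.fn (.comp f g) ts) (.fn f (fun i => .fn (g i) ts)))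
  | prec_zero {n : ℕ} (f : PR n) (g : PR (n + 2)) (ts : Fin n → Tm) :
      HA (eq (.fn (.prec f g) (Fin.cons zero ts)) (.fn f ts))
  | prec_succ {n : ℕ} (f : PR n) (g : PR (n + 2)) (t : Tm) (ts : Fin n → Tm) :
      HA (eq (.fn (.prec f g) (Fin.cons t.succ ts))
        (.fn g (Fin.cons t (Fin.cons (.fn (.prec f g) (Fin.cons t ts)) ts))))
  | induction (φ : Fm) :
      HA ((φ.inst 0 zero).imp ((all (φ.imp (φ.inst 1 (v 0).succ))).imp (all φ)))

/-! ### Application of partial recursive functions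

In the definitions below, an argument that is a formula `φ` stands for `φ(x)` with `x` the variable
of index `0`; the defined formula binds that variable (and counts as one quantifier). -/

/-- Kleene's predicate `T(e, i, o)`: the number `o = ⟨n, y⟩` is such that the evaluation of the
program `e` on the input `i` has stopped with the output `y` after `n` steps. -/
def kleeneT (e i o : Tm) : Fm :=
  eq (.fn .run ![o.L, pair zero (pair e i)]) (pair zero (pair zero o.R))

/-- `e i` is defined. -/
def defd (e i : Tm) : Fm := ex (kleeneT e.lift i.lift (v 0))

/-- `φ(e i)`: the value `e i` is defined and satisfies `φ`. -/
def atApp (e i : Tm) (φ : Fm) : Fm :=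
  ex ((kleeneT e.lift i.lift (v 0)).and (φ.inst 1 (v 0).U))

/-! ### Extended Church's Thesis -/

/-- Quantifier-free formulas of primitive recursive arithmetic. -/
inductive QuantifierFree : Fm → Prop
  | eq (s t : Tm) : QuantifierFree (eq s t)
  | bot : QuantifierFree bot
  | and {φ ψ : Fm} : QuantifierFree φ → QuantifierFree ψ → QuantifierFree (φ.and ψ)
  | or {φ ψ : Fm} : QuantifierFree φ → QuantifierFree ψ → QuantifierFree (φ.or ψ)
  | imp {φ ψ : Fm} : QuantifierFree φ → QuantifierFree ψ → QuantifierFree (φ.imp ψ)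

/-- Existential quantifiers in front of a quantifier-free formula. -/
inductive Sigma1 : Fm → Prop
  | qf {φ : Fm} : QuantifierFree φ → Sigma1 φ
  | ex {φ : Fm} : Sigma1 φ → Sigma1 (ex φ)

/-- The almost-negative formulas, including `𝒱`, `ℳ` and `𝒯`. -/
inductive AlmostNegative : Fm → Prop
  | sigma1 {φ : Fm} : Sigma1 φ → AlmostNegative φ
  | isV (t : Tm) : AlmostNegative (isV t)
  | isM (t : Tm) : AlmostNegative (isM t)
  | isT (t : Tm) : AlmostNegative (isT t)
  | and {φ ψ : Fm} : AlmostNegative φ → AlmostNegative ψ → AlmostNegative (φ.and ψ)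
  | imp {φ ψ : Fm} : AlmostNegative φ → AlmostNegative ψ → AlmostNegative (φ.imp ψ)
  | all {φ : Fm} : AlmostNegative φ → AlmostNegative (all φ)

/-- `ECT_V`, for almost-negative `φ(n)` and arbitrary `ψ(n, m)`:
`(∀n. φ(n) → ∃m. ψ(n, m)) → ∃e. ∀n. φ(n) → e n is defined and ψ(n, e n)`. -/
inductive ECTV : Set Fm
  | mk (φ ψ : Fm) : AlmostNegative φ →
      ECTV ((all (φ.imp (ex ψ))).imp
        (ex (all ((φ.inst 2 (v 0)).imp (atApp (v 1) (v 0) (ψ.inst2 3 (v 1) (v 0)))))))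

/-! ### The assumptions on v-sets, Meaning and Truth -/

/-- `∀n. x n is defined, its right component is Meaningful, and if that is True, then the left
component satisfies φ`. -/
def condEnum (x : Tm) (φ : Fm) : Fm :=
  all (atApp x.lift (v 0) ((isM (v 0).R).and ((isT (v 0).R).imp (φ.inst 2 (v 0).L))))

/-- `𝒱` is the accessibility predicate of conditional enumerations: introduction, and induction
for every formula `φ`. -/
inductive VAxioms : Set Fm
  | intro : VAxioms (all ((condEnum (v 0) (isV (v 0))).imp (isV (v 0))))
  | induction (φ : Fm) :
      VAxioms ((all ((condEnum (v 0) (φ.inst 2 (v 0))).imp φ)).imp (all ((isV (v 0)).imp φ)))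

/-- The assumptions on `Ξ`. The quantified variables `f`, `g` have the indices `1`, `0`. -/
inductive XiAxioms : Set Fm
  /-- If `Ξ(f, g)` is Meaningful, it is True if and only if for all `n`, whenever `f n` is defined
  and True, `g n` is defined and True. -/
  | truth : XiAxioms (all (all ((isM (Xi (v 1) (v 0))).imp ((isT (Xi (v 1) (v 0))).iff
      (all ((atApp (v 2) (v 0) (isT (v 0))).imp (atApp (v 1) (v 0) (isT (v 0)))))))))
  /-- `Ξ(f, g)` is Meaningful if `f n` is Meaningful whenever it is defined, and `g n` is
  Meaningful whenever `f n` and `g n` are defined and `f n` is True. -/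
  | meaning : XiAxioms (all (all (
      ((all ((defd (v 2) (v 0)).imp (atApp (v 2) (v 0) (isM (v 0))))).and
       (all (((defd (v 2) (v 0)).and ((defd (v 1) (v 0)).and (atApp (v 2) (v 0) (isT (v 0))))).imp
          (atApp (v 1) (v 0) (isM (v 0)))))).imp
      (isM (Xi (v 1) (v 0))))))

/-- The assumptions on the bar operator `Ω`. -/
inductive OmAxioms : Set Fm
  /-- `Ω(f)` is Meaningful if `f n` is defined and Meaningful for all `n`. -/
  | meaning : OmAxioms (all ((all (atApp (v 1) (v 0) (isM (v 0)))).imp (isM (Om (v 0)))))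
  /-- If `Ω(f)` is Meaningful, and if `f⟨⟩` being True implies that all `Ω(f⁽ⁿ⁾)` are True, then
  `Ω(f)` is True. -/
  | intro : OmAxioms (all (((isM (Om (v 0))).and
      ((atApp (v 0) nil (isT (v 0))).imp (all (isT (Om (shift (v 1) (v 0))))))).imp
      (isT (Om (v 0)))))
  /-- The corresponding induction, for every formula `φ`. -/
  | induction (φ : Fm) : OmAxioms ((all (((isM (Om (v 0))).and
      ((atApp (v 0) nil (isT (v 0))).imp (all (φ.inst 2 (shift (v 1) (v 0)))))).imp φ)).imp
      (all ((isT (Om (v 0))).imp φ)))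

/-- The theory `HA + ECT_V` with all the assumptions on `𝒱`, `ℳ`, `𝒯`. -/
def BarTheory : Set Fm := HA ∪ ECTV ∪ VAxioms ∪ XiAxioms ∪ OmAxioms

/-- The theory proves `φ`. -/
def Provable (φ : Fm) : Prop := Derives BarTheory [] φ

/-! ### The language of set theory -/

/-- For all v-sets. -/
def allV (φ : Fm) : Fm := all ((isV (v 0)).imp φ)
/-- There is a v-set. -/
def exV (φ : Fm) : Fm := ex ((isV (v 0)).and φ)

/-- The bounded quantifier `∀a ∈ EL(y). φ(a)`, over the left components of the values `y n` with
True right component. -/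
def allEl (y : Tm) (φ : Fm) : Fm :=
  all (all ((kleeneT y.lift.lift (v 1) (v 0)).imp
    ((isT (v 0).U.R).imp (φ.inst 2 (v 0).U.L))))

/-- The bounded quantifier `∃a ∈ EL(y). φ(a)`. -/
def exEl (y : Tm) (φ : Fm) : Fm :=
  ex (atApp y.lift (v 0) ((isT (v 0).R).and (φ.inst 2 (v 0).L)))

/-- The binary relation given by the formula `E` in the variables of index `0` and `1` (other
variables are set to `0`), at the terms `s`, `t`. -/
def rel (E : Fm) (s t : Tm) : Fm := E.subst (fun | 0 => s | 1 => t | _ => zero)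

/-- The recursive characterization of extensional equality: for all v-sets `x` (index `1`) and `y`
(index `0`), `x ≃ y` if and only if every element of `x` is equal to an element of `y` and
conversely. -/
def extEqClause (E : Fm) : Fm :=
  all (all (((isV (v 1)).and (isV (v 0))).imp
    ((rel E (v 1) (v 0)).iff
      ((allEl (v 1) (exEl (v 1) (rel E (v 1) (v 0)))).and
       (allEl (v 0) (exEl (v 2) (rel E (v 1) (v 0))))))))

/-- The formula `E` defines extensional equality of v-sets in the theory.  (By induction on v-sets,
any two such formulas are provably equivalent on v-sets.) -/
def IsExtEq (E : Fm) : Prop := Provable (extEqClause E)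

/-- `s ∈ y`: some element in `EL(y)` is extensionally equal to `s`. -/
def mem (E : Fm) (s y : Tm) : Fm := exEl y (rel E s.lift (v 0))

/-- `q ≃ {a, b}`. -/
def isUPair (E : Fm) (q a b : Tm) : Fm :=
  ((mem E a q).and (mem E b q)).and (allEl q ((rel E (v 0) a.lift).or (rel E (v 0) b.lift)))

/-- `p` is the Kuratowski pair `{{a}, {a, b}}`. -/
def isOPair (E : Fm) (p a b : Tm) : Fm :=
  ((exEl p (isUPair E (v 0) a.lift a.lift)).and (exEl p (isUPair E (v 0) a.lift b.lift))).and
    (allEl p ((isUPair E (v 0) a.lift a.lift).or (isUPair E (v 0) a.lift b.lift)))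

/-- The Kuratowski pair of `a` and `b` is an element of `r`. -/
def related (E : Fm) (r a b : Tm) : Fm := exEl r (isOPair E (v 0) a.lift b.lift)

/-- `A` has an element. -/
def inhabited (A : Tm) : Fm := exEl A top

/-- Elements of elements of `A` are elements of `A`. -/
def transitive (E : Fm) (A : Tm) : Fm := allEl A (allEl (v 0) (mem E (v 0) A.lift.lift))

/-- `A` is closed under Strong Collection: for every `a ∈ A` and every v-set `r`, if every `u ∈ a`
is related by `r` to some `w ∈ A`, then there is `b ∈ A` such that every `w ∈ b` has some `u ∈ a`
related to it, and every `u ∈ a` is related to some `w ∈ b`. -/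
def strongCollection (E : Fm) (A : Tm) : Fm :=
  allEl A (allV
    ((allEl (v 1) (exEl A.lift.lift.lift (related E (v 2) (v 1) (v 0)))).imp
     (exEl A.lift.lift
       ((allEl (v 0) (exEl (v 3) (related E (v 3) (v 0) (v 1)))).and
        (allEl (v 2) (exEl (v 1) (related E (v 3) (v 1) (v 0))))))))

/-- `A` is regular. -/
def regular (E : Fm) (A : Tm) : Fm :=
  (inhabited A).and ((transitive E A).and (strongCollection E A))

/-- Every v-set is contained in a regular v-set. -/
def regularExtension (E : Fm) : Fm := allV (exV ((mem E (v 1) (v 0)).and (regular E (v 0))))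

/-! ### Sets built from a sequence of conditions -/

/-- `τ` is a sequence of Meaningful conditions. -/
def meaningfulSeq (τ : Tm) : Fm := all (atApp τ.lift (v 0) (isM (v 0)))

/-- Some condition in `τ` is not True. -/
def hasUntrue (τ : Tm) : Fm := ex (not (atApp τ.lift (v 0) (isT (v 0))))

/-- All conditions of `y` are in `τ`: for every `n` there is `m` such that `τ m` is True if and only
if the `n`th condition of `y` is True. -/
def condsIn (y τ : Tm) : Fm :=
  all (ex ((atApp τ.lift.lift (v 0) (isT (v 0))).iff
    (atApp y.lift.lift (v 1) (isT (v 0).R))))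

/-- `A` contains every v-set all of whose conditions are in `τ` and all of whose elements are
in `A`. -/
def closedUnderBuilding (E : Fm) (τ A : Tm) : Fm :=
  allV (((condsIn (v 0) τ.lift).and (allEl (v 0) (mem E (v 0) A.lift.lift))).imp
    (mem E (v 0) A.lift))

/-- The elements of `A` are inductively generated by the rule in `closedUnderBuilding`: the
induction principle for the formula `φ(y)`, with `y` of index `0`. (The parameters of `φ` may
include `τ`.) -/
def inductivelyBuilt (φ : Fm) (τ A : Tm) : Fm :=
  (allV (((condsIn (v 0) τ.lift).and (allEl (v 0) (φ.inst 2 (v 0)))).imp φ)).imp (allEl A φ)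

end VSets

set_option linter.unusedSimpArgs false
set_option linter.unusedVariables false

namespace VSets
open Fm Tm

/-! ### Substitution -/

/-! The v-sets that can be built from `τ` are represented by trees, and a bar condition Ω expresses
that a tree is well-founded. A number `n` is read as a program, and thereby as a tree: a branch is a
pair `p = ⟨q, o⟩` in which `o` is a halting computation of `n` on `q`, and its output `⟨n', m⟩`
names a subtree `n'` and the condition `τ m` under which the branch is present. A number `p` that is
no such pair receives the untrue condition `BB`, so that every enumeration is total although `n` is
only a partial function. `F τ c n` assigns to a finite path the condition at its end, and `A τ n`,
the Truth of Ω of this sequence, says that `n` is well-founded along True conditions (`A_intro`,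
`A_elim`, `A_ind`). The tree `n` describes the v-set `St τ n` with the elements `St τ n'`, and `Vt
τ` enumerates all `St τ n` under the conditions `A τ n`, which are Meaningful because of Ω.

The main lemma is `collection`. Let the conditions of `y` be in `τ`, and let every element of `y` be
Φ-related to an element of `Vt τ`. Church's Thesis yields a program `e` that finds a suitable tree
for every element whose condition is True, and a total program `μ` that finds in `τ` the conditions
of `y`. The tree with the branches `e k` under the conditions `τ (μ k)` represents the required set.
Halting computations of `e` serve as inputs of this tree, so nothing is needed where `e` diverges;
inputs of no use are switched off by a condition of `τ` that is not True. If Φ is extensional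
equality, this is closure under building (`closed_Vt`); if Φ is given by a v-set of pairs, it is
Strong Collection (`regular_Vt`). Ω-induction shows that nothing else is in `Vt τ` (`built`).

For a v-set `x`, `h(x)` is `Cs x`: an untrue condition, the conditions of `x`, and for each `n` the
conjunctions, formed with Ξ, of the `n`th condition of `x` with conditions in `Cs` of the `n`th
element. Ξ is Meaningful even if the `n`th condition is not True and the element is not a v-set.
Induction on v-sets puts `x` into `Vt τ` whenever `τ` contains the conditions in `Cs x` (`mem_Vt`).
Extensional equality is defined explicitly, as being related by a bisimulation that some program
enumerates (`exists_extEq`).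

Derivations are not written out. Truth values (`HProp`) are sets of contexts, the worlds are
contexts of assumptions ordered by inclusion, and the domain `D` consists of terms up to provable
equality. Forcing of a formula coincides with its derivability (`forces_sem`), so that an argument
about `⊩` is an informal intuitionistic argument and yields a derivation. Equations proved without
assumptions become equations in `D` and can be rewritten. The axiom schemas apply to definable
predicates only; instance search for `DefT`, `DefP` and `DefAN` finds the formulas.

Programs are handled through `frame`: a halting run of the stack machine splits into the evaluation
of the current program and the rest of the stack. This gives composition, recursion and a universal
program, then programs for all primitive recursive functions and the recursion theorem (`app_self`).
-/

/-- The assignment `a, ρ 0, ρ 1, …`. -/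
def scons {α : Type*} (a : α) (ρ : ℕ → α) : ℕ → α
  | 0 => a
  | n + 1 => ρ n

@[simp] theorem scons_zero {α : Type*} (a : α) (ρ : ℕ → α) : scons a ρ 0 = a := rfl
@[simp] theorem scons_succ {α : Type*} (a : α) (ρ : ℕ → α) (n : ℕ) : scons a ρ (n + 1) = ρ n := rfl
@[simp] theorem scons_one {α : Type*} (a : α) (ρ : ℕ → α) : scons a ρ 1 = ρ 0 := rfl

theorem Tm.subst_subst (σ τ : ℕ → Tm) (t : Tm) :
    (t.subst σ).subst τ = t.subst (fun n => (σ n).subst τ) := by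
  induction t with
  | var n => rfl
  | fn f ts ih => simp only [Tm.subst]; congr 1; funext i; exact ih i

theorem Tm.subst_var (t : Tm) : t.subst Tm.var = t := by
  induction t with
  | var n => rfl
  | fn f ts ih => simp only [Tm.subst]; congr 1; funext i; exact ih i

theorem up_var : up Tm.var = Tm.var := by
  funext n; cases n <;> rfl

theorem up_subst_up (σ τ : ℕ → Tm) :
    (fun n => (up σ n).subst (up τ)) = up (fun n => (σ n).subst τ) := by
  funext n
  cases n with
  | zero => rfl
  | succ n => simp only [up, Tm.lift, Tm.subst_subst]; rfl

namespace Fm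

theorem subst_subst (σ τ : ℕ → Tm) (φ : Fm) :
    (φ.subst σ).subst τ = φ.subst (fun n => (σ n).subst τ) := by
  induction φ generalizing σ τ with
  | all φ ih => simp only [subst, ih, up_subst_up]
  | ex φ ih => simp only [subst, ih, up_subst_up]
  | _ => simp_all [subst, Tm.subst_subst]

theorem subst_var (φ : Fm) : φ.subst Tm.var = φ := by
  induction φ <;> simp_all [subst, Tm.subst_var, up_var]

theorem inst_eq (k : ℕ) (t : Tm) (φ : Fm) :
    φ.inst k t = φ.subst (scons t (fun j => .var (j + k))) := by
  unfold inst; congr 1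

theorem inst2_eq (k : ℕ) (s t : Tm) (φ : Fm) :
    φ.inst2 k s t = φ.subst (scons t (scons s (fun j => .var (j + k)))) := by
  unfold inst2; congr 1; funext n; rcases n with _ | _ | n <;> rfl

theorem inst_subst (φ : Fm) (t : Tm) (σ : ℕ → Tm) :
    (φ.inst 0 t).subst σ = (φ.subst (up σ)).inst 0 (t.subst σ) := by
  simp only [inst_eq, subst_subst]
  congr 1; funext n
  cases n with
  | zero => rfl
  | succ n => simp only [scons_succ, up, Tm.lift, Tm.subst_subst, Tm.subst]; exact (Tm.subst_var _).symm

theorem lift_subst (φ : Fm) (σ : ℕ → Tm) : φ.lift.subst (up σ) = (φ.subst σ).lift := by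
  simp only [lift, subst_subst]; rfl

end Fm

/-! ### Bounds on the free variables -/

/-- The variables of `t` have indices below `N`. -/
def Tm.Below (N : ℕ) : Tm → Prop
  | .var n => n < N
  | .fn _ ts => ∀ i, (ts i).Below N

/-- The free variables of `φ` have indices below `N`. -/
def Fm.Below : ℕ → Fm → Prop
  | N, eq s t => s.Below N ∧ t.Below N
  | N, isV t => t.Below N
  | N, isM t => t.Below N
  | N, isT t => t.Below N
  | _, bot => True
  | N, and φ ψ => φ.Below N ∧ ψ.Below N
  | N, or φ ψ => φ.Below N ∧ ψ.Below N
  | N, imp φ ψ => φ.Below N ∧ ψ.Below N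
  | N, all φ => φ.Below (N + 1)
  | N, ex φ => φ.Below (N + 1)

theorem Tm.Below.mono {M N : ℕ} (h : M ≤ N) {t : Tm} (ht : t.Below M) : t.Below N := by
  induction t with
  | var n => exact lt_of_lt_of_le ht h
  | fn f ts ih => exact fun i => ih i (ht i)

theorem Fm.Below.mono {M N : ℕ} (h : M ≤ N) {φ : Fm} (hφ : φ.Below M) : φ.Below N := by
  induction φ generalizing M N with
  | eq s t => exact ⟨hφ.1.mono h, hφ.2.mono h⟩
  | isV t => exact Tm.Below.mono h hφ
  | isM t => exact Tm.Below.mono h hφ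
  | isT t => exact Tm.Below.mono h hφ
  | bot => trivial
  | and φ ψ h1 h2 => exact ⟨h1 h hφ.1, h2 h hφ.2⟩
  | or φ ψ h1 h2 => exact ⟨h1 h hφ.1, h2 h hφ.2⟩
  | imp φ ψ h1 h2 => exact ⟨h1 h hφ.1, h2 h hφ.2⟩
  | all φ ih => exact ih (M := M + 1) (N := N + 1) (by omega) hφ
  | ex φ ih => exact ih (M := M + 1) (N := N + 1) (by omega) hφ

theorem Tm.exists_below (t : Tm) : ∃ N, t.Below N := by
  induction t with
  | var n => exact ⟨n + 1, Nat.lt_succ_self n⟩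
  | fn f ts ih =>
    choose N hN using ih
    exact ⟨Finset.univ.sup N, fun i => (hN i).mono (Finset.le_sup (Finset.mem_univ i))⟩

theorem Fm.exists_below (φ : Fm) : ∃ N, φ.Below N := by
  induction φ with
  | eq s t =>
    obtain ⟨M, hM⟩ := s.exists_below
    obtain ⟨N, hN⟩ := t.exists_below
    exact ⟨max M N, hM.mono (le_max_left _ _), hN.mono (le_max_right _ _)⟩
  | isV t => exact t.exists_below
  | isM t => exact t.exists_below
  | isT t => exact t.exists_below
  | bot => exact ⟨0, trivial⟩
  | and φ ψ h1 h2 =>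
    obtain ⟨⟨M, hM⟩, N, hN⟩ := And.intro h1 h2
    exact ⟨max M N, hM.mono (le_max_left _ _), hN.mono (le_max_right _ _)⟩
  | or φ ψ h1 h2 =>
    obtain ⟨⟨M, hM⟩, N, hN⟩ := And.intro h1 h2
    exact ⟨max M N, hM.mono (le_max_left _ _), hN.mono (le_max_right _ _)⟩
  | imp φ ψ h1 h2 =>
    obtain ⟨⟨M, hM⟩, N, hN⟩ := And.intro h1 h2
    exact ⟨max M N, hM.mono (le_max_left _ _), hN.mono (le_max_right _ _)⟩
  | all φ ih => obtain ⟨N, hN⟩ := ih; exact ⟨N, Fm.Below.mono (Nat.le_succ N) hN⟩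
  | ex φ ih => obtain ⟨N, hN⟩ := ih; exact ⟨N, Fm.Below.mono (Nat.le_succ N) hN⟩

theorem Tm.Below.subst_congr {N : ℕ} {σ τ : ℕ → Tm} (h : ∀ n < N, σ n = τ n) {t : Tm}
    (ht : t.Below N) : t.subst σ = t.subst τ := by
  induction t with
  | var n => exact h n ht
  | fn f ts ih => simp only [Tm.subst]; congr 1; funext i; exact ih i (ht i)

theorem up_congr {N : ℕ} {σ τ : ℕ → Tm} (h : ∀ n < N, σ n = τ n) :
    ∀ n < N + 1, up σ n = up τ n := by
  intro n hn
  cases n with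
  | zero => rfl
  | succ n => simp only [up, h n (by omega)]

theorem Fm.Below.subst_congr {N : ℕ} {σ τ : ℕ → Tm} (h : ∀ n < N, σ n = τ n) {φ : Fm}
    (hφ : φ.Below N) : φ.subst σ = φ.subst τ := by
  induction φ generalizing N σ τ with
  | eq s t => simp only [Fm.subst, hφ.1.subst_congr h, hφ.2.subst_congr h]
  | isV t => simp only [Fm.subst, Tm.Below.subst_congr h hφ]
  | isM t => simp only [Fm.subst, Tm.Below.subst_congr h hφ]
  | isT t => simp only [Fm.subst, Tm.Below.subst_congr h hφ]
  | bot => rfl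
  | and φ ψ h1 h2 => simp only [Fm.subst, h1 h hφ.1, h2 h hφ.2]
  | or φ ψ h1 h2 => simp only [Fm.subst, h1 h hφ.1, h2 h hφ.2]
  | imp φ ψ h1 h2 => simp only [Fm.subst, h1 h hφ.1, h2 h hφ.2]
  | all φ ih => simp only [Fm.subst, ih (up_congr h) hφ]
  | ex φ ih => simp only [Fm.subst, ih (up_congr h) hφ]

/-! ### The axioms are closed under substitution -/

theorem QuantifierFree.subst {φ : Fm} (h : QuantifierFree φ) (σ : ℕ → Tm) :
    QuantifierFree (φ.subst σ) := by
  induction h with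
  | eq s t => exact .eq _ _
  | bot => exact .bot
  | and _ _ h1 h2 => exact .and h1 h2
  | or _ _ h1 h2 => exact .or h1 h2
  | imp _ _ h1 h2 => exact .imp h1 h2

theorem Sigma1.subst {φ : Fm} (h : Sigma1 φ) (σ : ℕ → Tm) : Sigma1 (φ.subst σ) := by
  induction h generalizing σ with
  | qf h => exact .qf (h.subst σ)
  | ex _ ih => exact .ex (ih _)

theorem AlmostNegative.subst {φ : Fm} (h : AlmostNegative φ) (σ : ℕ → Tm) :
    AlmostNegative (φ.subst σ) := by
  induction h generalizing σ with
  | sigma1 h => exact .sigma1 (h.subst σ)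
  | isV t => exact .isV _
  | isM t => exact .isM _
  | isT t => exact .isT _
  | and _ _ h1 h2 => exact .and (h1 σ) (h2 σ)
  | imp _ _ h1 h2 => exact .imp (h1 σ) (h2 σ)
  | all _ ih => exact .all (ih _)

theorem comp_vec {α β : Type*} (f : α → β) : (fun i => f ((![] : Fin 0 → α) i)) = ![] :=
  funext fun i => i.elim0
theorem comp_vec_cons {α β : Type*} {n : ℕ} (f : α → β) (a : α) (g : Fin n → α) :
    (fun i => f (Matrix.vecCons a g i)) = Matrix.vecCons (f a) (fun i => f (g i)) := by
  funext i; refine Fin.cases rfl (fun j => rfl) i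
theorem comp_fin_cons {α β : Type*} {n : ℕ} (f : α → β) (a : α) (g : Fin n → α) :
    (fun i => f ((Fin.cons a g : Fin (n + 1) → α) i)) = Fin.cons (f a) (fun i => f (g i)) := by
  funext i; refine Fin.cases rfl (fun j => rfl) i

@[simp] theorem subst_v (σ : ℕ → Tm) (n : ℕ) : (v n).subst σ = σ n := rfl
@[simp] theorem subst_zero (σ : ℕ → Tm) : zero.subst σ = zero := by
  simp only [zero, Tm.subst, comp_vec]
@[simp] theorem subst_succ (σ : ℕ → Tm) (t : Tm) : t.succ.subst σ = (t.subst σ).succ := by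
  simp only [succ, Tm.subst, comp_vec_cons, comp_vec]
@[simp] theorem subst_num (σ : ℕ → Tm) (n : ℕ) : (num n).subst σ = num n := by
  induction n with
  | zero => exact subst_zero σ
  | succ n ih => rw [num, subst_succ, ih]
@[simp] theorem subst_pair (σ : ℕ → Tm) (s t : Tm) :
    (pair s t).subst σ = pair (s.subst σ) (t.subst σ) := by
  simp only [pair, Tm.subst, comp_vec_cons, comp_vec]
@[simp] theorem subst_L (σ : ℕ → Tm) (t : Tm) : t.L.subst σ = (t.subst σ).L := by
  simp only [Tm.L, Tm.subst, comp_vec_cons, comp_vec]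
@[simp] theorem subst_R (σ : ℕ → Tm) (t : Tm) : t.R.subst σ = (t.subst σ).R := by
  simp only [Tm.R, Tm.subst, comp_vec_cons, comp_vec]
@[simp] theorem subst_U (σ : ℕ → Tm) (t : Tm) : t.U.subst σ = (t.subst σ).U := subst_R σ t
@[simp] theorem subst_nil (σ : ℕ → Tm) : nil.subst σ = nil := subst_zero σ
@[simp] theorem subst_Xi (σ : ℕ → Tm) (s t : Tm) :
    (Xi s t).subst σ = Xi (s.subst σ) (t.subst σ) := by
  simp only [Xi, double, add, subst_succ, Tm.subst, comp_vec_cons, comp_vec, subst_pair]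
@[simp] theorem subst_Om (σ : ℕ → Tm) (t : Tm) : (Om t).subst σ = Om (t.subst σ) := by
  simp only [Om, double, add, subst_succ, Tm.subst, comp_vec_cons, comp_vec]
@[simp] theorem subst_shift (σ : ℕ → Tm) (s t : Tm) :
    (shift s t).subst σ = shift (s.subst σ) (t.subst σ) := by
  simp only [shift, subst_pair, subst_num, subst_zero]

theorem Tm.lift_subst (t : Tm) (σ : ℕ → Tm) : t.lift.subst (up σ) = (t.subst σ).lift := by
  simp only [Tm.lift, Tm.subst_subst]; rfl

@[simp] theorem lift_v (n : ℕ) : (v n).lift = v (n + 1) := rfl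

theorem Fm.inst_subst' (k : ℕ) (t : Tm) (φ : Fm) (σ : ℕ → Tm) :
    (φ.inst k t).subst σ = φ.subst (scons (t.subst σ) (fun j => σ (j + k))) := by
  rw [inst_eq, Fm.subst_subst]
  congr 1; funext n; cases n <;> rfl

theorem Fm.inst2_subst' (k : ℕ) (s t : Tm) (φ : Fm) (σ : ℕ → Tm) :
    (φ.inst2 k s t).subst σ =
      φ.subst (scons (t.subst σ) (scons (s.subst σ) (fun j => σ (j + k)))) := by
  rw [inst2_eq, Fm.subst_subst]
  congr 1; funext n; rcases n with _ | _ | n <;> rfl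

theorem subst_kleeneT (e i o : Tm) (σ : ℕ → Tm) :
    (kleeneT e i o).subst σ = kleeneT (e.subst σ) (i.subst σ) (o.subst σ) := by
  simp only [kleeneT, Fm.subst, Tm.subst, comp_vec_cons, comp_vec, subst_pair, subst_L, subst_R,
    subst_zero]

theorem subst_defd (e i : Tm) (σ : ℕ → Tm) :
    (defd e i).subst σ = defd (e.subst σ) (i.subst σ) := by
  simp only [defd, Fm.subst, subst_kleeneT, Tm.lift_subst, subst_v]; rfl

theorem subst_atApp (e i : Tm) (φ : Fm) (σ : ℕ → Tm) :
    (atApp e i φ).subst σ = atApp (e.subst σ) (i.subst σ) (φ.subst (up σ)) := by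
  simp only [atApp, Fm.subst, subst_kleeneT, Tm.lift_subst, subst_v, Fm.inst_subst']
  rw [Fm.inst_eq, Fm.subst_subst]
  congr 4; funext n; cases n with
  | zero => simp [up]
  | succ n => simp only [scons_succ, up, Tm.lift, Tm.subst_subst]; rfl

theorem subst_condEnum (x : Tm) (φ : Fm) (σ : ℕ → Tm) :
    (condEnum x φ).subst σ = condEnum (x.subst σ) (φ.subst (up σ)) := by
  simp only [condEnum, Fm.subst, subst_atApp, Tm.lift_subst, subst_v, up, Fm.inst_subst', subst_R,
    subst_L]
  rw [Fm.inst_eq, Fm.subst_subst]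
  congr 5; funext n; cases n with
  | zero => rfl
  | succ n => simp only [scons_succ, up, Tm.lift, Tm.subst_subst]; rfl

theorem HA.subst {φ : Fm} (h : HA φ) (σ : ℕ → Tm) : HA (φ.subst σ) := by
  cases h with
  | succ_ne t =>
    simp only [Fm.subst, Fm.not, subst_succ, subst_zero]
    exact .succ_ne _
  | succ_inj s t =>
    simp only [Fm.subst, subst_succ]
    exact .succ_inj _ _
  | proj i ts => exact .proj i _
  | comp f g ts => exact .comp f g _
  | prec_zero f g ts =>
    simp only [Fm.subst, Tm.subst, comp_fin_cons, subst_zero]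
    exact .prec_zero f g _
  | prec_succ f g t ts =>
    simp only [Fm.subst, Tm.subst, comp_fin_cons, subst_succ]
    exact .prec_succ f g _ _
  | induction φ =>
    convert HA.induction (φ.subst (up σ)) using 1
    simp only [Fm.subst, Fm.inst_subst, subst_zero]
    congr 3
    rw [Fm.inst_subst', Fm.inst_eq, Fm.subst_subst, subst_succ]
    congr 2; funext n; cases n with
    | zero => rfl
    | succ n => simp only [scons_succ, up, Tm.lift, Tm.subst_subst]; rfl

theorem ECTV.subst {φ : Fm} (h : ECTV φ) (σ : ℕ → Tm) : ECTV (φ.subst σ) := by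
  cases h with
  | mk φ ψ h =>
    convert ECTV.mk (φ.subst (up σ)) (ψ.subst (up (up σ))) (h.subst _) using 1
    simp only [Fm.subst, subst_atApp, Fm.inst_subst', Fm.inst2_subst', subst_v, up, lift_v]
    rw [Fm.inst_eq, Fm.subst_subst, Fm.inst2_eq, Fm.subst_subst]
    congr 5
    · funext n; cases n with
      | zero => rfl
      | succ n => simp only [scons_succ, up, Tm.lift, Tm.subst_subst]; rfl
    · congr 2; funext n; rcases n with _ | _ | n
      · rfl
      · rfl
      · simp only [scons_succ, up, Tm.lift, Tm.subst_subst]; rfl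

theorem VAxioms.subst {φ : Fm} (h : VAxioms φ) (σ : ℕ → Tm) : VAxioms (φ.subst σ) := by
  cases h with
  | intro =>
    convert VAxioms.intro using 1
    simp only [Fm.subst, subst_condEnum, subst_v, up]
  | induction φ =>
    convert VAxioms.induction (φ.subst (up σ)) using 1
    simp only [Fm.subst, subst_condEnum, subst_v, up, Fm.inst_subst']
    rw [Fm.inst_eq, Fm.subst_subst]
    congr 6; funext n; cases n with
    | zero => rfl
    | succ n => simp only [scons_succ, up, Tm.lift, Tm.subst_subst]; rfl

theorem XiAxioms.subst {φ : Fm} (h : XiAxioms φ) (σ : ℕ → Tm) : XiAxioms (φ.subst σ) := by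
  cases h with
  | truth =>
    convert XiAxioms.truth using 1
    simp only [Fm.subst, Fm.iff, subst_atApp, subst_defd, subst_Xi, subst_Om, subst_nil, subst_shift,
      subst_v, lift_v, up]
  | meaning =>
    convert XiAxioms.meaning using 1
    simp only [Fm.subst, Fm.iff, subst_atApp, subst_defd, subst_Xi, subst_Om, subst_nil, subst_shift,
      subst_v, lift_v, up]

theorem OmAxioms.subst {φ : Fm} (h : OmAxioms φ) (σ : ℕ → Tm) : OmAxioms (φ.subst σ) := by
  cases h with
  | meaning =>
    convert OmAxioms.meaning using 1
    simp only [Fm.subst, Fm.iff, subst_atApp, subst_defd, subst_Xi, subst_Om, subst_nil, subst_shift,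
      subst_v, lift_v, up]
  | intro =>
    convert OmAxioms.intro using 1
    simp only [Fm.subst, Fm.iff, subst_atApp, subst_defd, subst_Xi, subst_Om, subst_nil, subst_shift,
      subst_v, lift_v, up]
  | induction φ =>
    convert OmAxioms.induction (φ.subst (up σ)) using 1
    simp only [Fm.subst, subst_atApp, subst_v, up, subst_Om, subst_nil, Fm.inst_subst', subst_shift,
      lift_v]
    rw [Fm.inst_eq, Fm.subst_subst]
    congr 6
    congr 1; funext n; cases n with
    | zero => simp [up]
    | succ n => simp only [scons_succ, up, Tm.lift, Tm.subst_subst]; rfl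

theorem BarTheory.subst {φ : Fm} (h : φ ∈ BarTheory) (σ : ℕ → Tm) : φ.subst σ ∈ BarTheory := by
  rcases h with (((h | h) | h) | h) | h
  · exact .inl (.inl (.inl (.inl (h.subst σ))))
  · exact .inl (.inl (.inl (.inr (h.subst σ))))
  · exact .inl (.inl (.inr (h.subst σ)))
  · exact .inl (.inr (h.subst σ))
  · exact .inr (h.subst σ)

/-! ### Derivations -/

/-- Derivability in the theory. -/
abbrev Der (Γ : List Fm) (φ : Fm) : Prop := Derives BarTheory Γ φ

theorem Der.weaken {Γ Δ : List Fm} {φ : Fm} (h : Der Γ φ) (hs : Γ ⊆ Δ) : Der Δ φ := by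
  induction h generalizing Δ with
  | ax h => exact .ax h
  | hyp h => exact .hyp (hs h)
  | botE _ ih => exact .botE (ih hs)
  | andI _ _ h1 h2 => exact .andI (h1 hs) (h2 hs)
  | andL _ ih => exact .andL (ih hs)
  | andR _ ih => exact .andR (ih hs)
  | orL _ ih => exact .orL (ih hs)
  | orR _ ih => exact .orR (ih hs)
  | orE _ _ _ h1 h2 h3 =>
    exact .orE (h1 hs) (h2 (List.cons_subset_cons _ hs)) (h3 (List.cons_subset_cons _ hs))
  | impI _ ih => exact .impI (ih (List.cons_subset_cons _ hs))
  | impE _ _ h1 h2 => exact .impE (h1 hs) (h2 hs)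
  | allI _ ih => exact .allI (ih (List.map_subset _ hs))
  | allE t _ ih => exact .allE t (ih hs)
  | exI t _ ih => exact .exI t (ih hs)
  | exE _ _ h1 h2 => exact .exE (h1 hs) (h2 (List.cons_subset_cons _ (List.map_subset _ hs)))
  | eqRefl t => exact .eqRefl t
  | eqE φ _ _ h1 h2 => exact .eqE φ (h1 hs) (h2 hs)

theorem Der.subst {Γ : List Fm} {φ : Fm} (h : Der Γ φ) (σ : ℕ → Tm) :
    Der (Γ.map (Fm.subst σ)) (φ.subst σ) := by
  have key : ∀ (Γ : List Fm) (σ : ℕ → Tm), (Γ.map Fm.lift).map (Fm.subst (up σ)) =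
      (Γ.map (Fm.subst σ)).map Fm.lift := by
    intro Γ σ; simp only [List.map_map]; congr 1; funext φ; exact Fm.lift_subst φ σ
  induction h generalizing σ with
  | ax h => exact .ax (BarTheory.subst h σ)
  | hyp h => exact .hyp (List.mem_map_of_mem h)
  | botE _ ih => exact .botE (ih σ)
  | andI _ _ h1 h2 => exact .andI (h1 σ) (h2 σ)
  | andL _ ih => exact .andL (ih σ)
  | andR _ ih => exact .andR (ih σ)
  | orL _ ih => exact .orL (ih σ)
  | orR _ ih => exact .orR (ih σ)
  | orE _ _ _ h1 h2 h3 => exact .orE (h1 σ) (h2 σ) (h3 σ)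
  | impI _ ih => exact .impI (ih σ)
  | impE _ _ h1 h2 => exact .impE (h1 σ) (h2 σ)
  | allI _ ih => exact .allI (by have := ih (up σ); rwa [key] at this)
  | allE t _ ih => rw [Fm.inst_subst]; exact .allE _ (ih σ)
  | exI t _ ih => exact .exI (t.subst σ) (by have := ih σ; rwa [Fm.inst_subst] at this)
  | exE _ _ h1 h2 =>
    refine .exE (h1 σ) ?_
    have := h2 (up σ)
    rwa [List.map_cons, key, Fm.lift_subst] at this
  | eqRefl t => exact .eqRefl _
  | eqE φ _ _ h1 h2 =>
    rw [Fm.inst_subst]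
    exact .eqE _ (h1 σ) (by have := h2 σ; rwa [Fm.inst_subst] at this)

theorem exists_below_list (Γ : List Fm) : ∃ N, ∀ φ ∈ Γ, φ.Below N := by
  induction Γ with
  | nil => exact ⟨0, by simp⟩
  | cons φ Γ ih =>
    obtain ⟨N, hN⟩ := ih
    obtain ⟨M, hM⟩ := φ.exists_below
    refine ⟨max M N, fun ψ hψ => ?_⟩
    rcases List.mem_cons.1 hψ with rfl | h
    · exact hM.mono (le_max_left _ _)
    · exact (hN ψ h).mono (le_max_right _ _)

/-- The substitution that makes the variable `x` the one bound by the next quantifier. -/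
def bindVar (x : ℕ) (n : ℕ) : Tm := if n = x then v 0 else v (n + 1)

theorem map_bindVar {Γ : List Fm} {N : ℕ} (h : ∀ φ ∈ Γ, φ.Below N) :
    Γ.map (Fm.subst (bindVar N)) = Γ.map Fm.lift := by
  refine List.map_congr_left fun φ hφ => ?_
  exact (h φ hφ).subst_congr fun n hn => by simp [bindVar, hn.ne]

theorem inst_bindVar {φ : Fm} {N : ℕ} (h : φ.Below (N + 1)) :
    (φ.inst 0 (v N)).subst (bindVar N) = φ := by
  rw [Fm.inst_subst']
  conv_rhs => rw [← Fm.subst_var φ]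
  refine h.subst_congr fun n hn => ?_
  cases n with
  | zero => simp [bindVar]
  | succ n => simp [bindVar, show n ≠ N by omega]

/-- A variable `N` beyond all free variables of `Γ` and `φ` is generic. Renaming by `bindVar N`
turns the derivation for `v N` into one that has the form required by `allI`. In this form the
context need not be shifted, as suits a quantifier over elements of a fixed domain. -/
theorem Der.allI' {Γ : List Fm} {φ : Fm} (h : ∀ n, Der Γ (φ.inst 0 (v n))) : Der Γ (all φ) := by
  obtain ⟨N, hN⟩ := exists_below_list (φ :: Γ)
  have := (h N).subst (bindVar N)
  rw [map_bindVar fun ψ hψ => hN ψ (List.mem_cons_of_mem _ hψ),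
    inst_bindVar ((hN φ List.mem_cons_self).mono (Nat.le_succ N))] at this
  exact .allI this

theorem Der.exE' {Γ : List Fm} {φ χ : Fm} (h : Der Γ (ex φ))
    (h' : ∀ n, Der (φ.inst 0 (v n) :: Γ) χ) : Der Γ χ := by
  obtain ⟨N, hN⟩ := exists_below_list (χ :: φ :: Γ)
  have hΓ : ∀ ψ ∈ Γ, ψ.Below N := fun ψ hψ => hN ψ (by simp [hψ])
  have := (h' N).subst (bindVar N)
  rw [List.map_cons, map_bindVar hΓ,
    inst_bindVar ((hN φ (by simp)).mono (Nat.le_succ N))] at this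
  refine .exE h ?_
  have hχ : χ.subst (bindVar N) = χ.lift :=
    (hN χ (by simp)).subst_congr fun n hn => by simp [bindVar, hn.ne]
  rwa [hχ] at this

/-! ### Replacement of equals in derivations -/

theorem Der.eqSymm {Γ : List Fm} {s t : Tm} (h : Der Γ (eq s t)) : Der Γ (eq t s) := by
  have := Derives.eqE (φ := eq (v 0) s.lift) h
    (by simpa [Fm.inst_eq, Fm.subst, Tm.lift, Tm.subst_subst, Tm.subst, Tm.subst_var] using Derives.eqRefl s)
  simpa [Fm.inst_eq, Fm.subst, Tm.lift, Tm.subst_subst, Tm.subst, Tm.subst_var] using this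

theorem Der.eqTrans {Γ : List Fm} {s t r : Tm} (h : Der Γ (eq s t)) (h' : Der Γ (eq t r)) :
    Der Γ (eq s r) := by
  have := Derives.eqE (φ := eq s.lift (v 0)) h'
    (by simpa [Fm.inst_eq, Fm.subst, Tm.lift, Tm.subst_subst, Tm.subst, Tm.subst_var] using h)
  simpa [Fm.inst_eq, Fm.subst, Tm.lift, Tm.subst_subst, Tm.subst, Tm.subst_var] using this

theorem lift_inst_tm (s t : Tm) : s.lift.subst (scons t (fun j => .var (j + 0))) = s := by
  rw [Tm.lift, Tm.subst_subst]; exact Tm.subst_var s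

theorem Der.eqUpdate {Γ : List Fm} {k : ℕ} (f : PR k) (a : Fin k → Tm) (i : Fin k) {s : Tm}
    (h : Der Γ (eq (a i) s)) : Der Γ (eq (.fn f a) (.fn f (Function.update a i s))) := by
  have e : ∀ t, (eq (Tm.fn f a).lift
      (.fn f (Function.update (fun j => (a j).lift) i (v 0)))).inst 0 t =
      eq (.fn f a) (.fn f (Function.update a i t)) := by
    intro t
    rw [Fm.inst_eq, Fm.subst, lift_inst_tm, Tm.subst]
    congr 2; funext j
    by_cases hj : j = i
    · subst hj; simp
    · simp only [Function.update_of_ne hj]; exact lift_inst_tm _ _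
  have := Derives.eqE (φ := eq (Tm.fn f a).lift
    (.fn f (Function.update (fun j => (a j).lift) i (v 0)))) h
    (by rw [e, Function.update_eq_self]; exact Derives.eqRefl _)
  rwa [e] at this

/-- The rule `eqE` replaces one term, so the arguments are exchanged one at a time, along a growing
set of positions. -/
theorem Der.eqFn {Γ : List Fm} {k : ℕ} (f : PR k) (a b : Fin k → Tm)
    (h : ∀ i, Der Γ (eq (a i) (b i))) : Der Γ (eq (.fn f a) (.fn f b)) := by
  have key : ∀ s : Finset (Fin k),
      Der Γ (eq (.fn f a) (.fn f (fun i => if i ∈ s then b i else a i))) := by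
    intro s
    induction s using Finset.induction_on with
    | empty => simpa using Derives.eqRefl _
    | insert i s hi ih =>
      refine ih.eqTrans ?_
      have := Der.eqUpdate (Γ := Γ) f (fun j => if j ∈ s then b j else a j) i (s := b i)
        (by simpa [hi] using h i)
      convert this using 4 with j
      by_cases hj : j = i
      · subst hj; simp
      · simp [hj]
  simpa using key Finset.univ

theorem eqSubst_tm {σ τ : ℕ → Tm} (h : ∀ n, Der [] (eq (σ n) (τ n))) (t : Tm) :
    Der [] (eq (t.subst σ) (t.subst τ)) := by
  induction t with
  | var n => exact h n
  | fn f ts ih => exact Der.eqFn f _ _ ih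

theorem up_eq {σ τ : ℕ → Tm} (h : ∀ n, Der [] (eq (σ n) (τ n))) (n : ℕ) :
    Der [] (eq (up σ n) (up τ n)) := by
  cases n with
  | zero => exact .eqRefl _
  | succ n => exact (h n).subst _

theorem Der.nil_weaken {Γ : List Fm} {φ : Fm} (h : Der [] φ) : Der Γ φ := h.weaken (by simp)

theorem Der.eqPred {Γ : List Fm} (P : Tm → Fm) (hP : ∀ t, (P (v 0)).inst 0 t = P t)
    {s t : Tm} (h : Der Γ (eq s t)) (hs : Der Γ (P s)) : Der Γ (P t) := by
  have := Derives.eqE (φ := P (v 0)) h (by rw [hP]; exact hs)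
  rwa [hP] at this

/-- The equations are assumed derivable without assumptions, so they survive under quantifiers and
in every context. The induction uses both directions, since an implication reverses the direction in
its premise. -/
theorem Der.eqSubst {φ : Fm} {Γ : List Fm} {σ τ : ℕ → Tm} (h : ∀ n, Der [] (eq (σ n) (τ n)))
    (hφ : Der Γ (φ.subst σ)) : Der Γ (φ.subst τ) := by
  have symm : ∀ {σ τ : ℕ → Tm}, (∀ n, Der [] (eq (σ n) (τ n))) → ∀ n, Der [] (eq (τ n) (σ n)) :=
    fun h n => (h n).eqSymm
  induction φ generalizing Γ σ τ with
  | eq s t =>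
    exact ((eqSubst_tm h s).eqSymm.nil_weaken).eqTrans (hφ.eqTrans (eqSubst_tm h t).nil_weaken)
  | isV t => exact Der.eqPred isV (by simp [Fm.inst_eq, Fm.subst]) (eqSubst_tm h t).nil_weaken hφ
  | isM t => exact Der.eqPred isM (by simp [Fm.inst_eq, Fm.subst]) (eqSubst_tm h t).nil_weaken hφ
  | isT t => exact Der.eqPred isT (by simp [Fm.inst_eq, Fm.subst]) (eqSubst_tm h t).nil_weaken hφ
  | bot => exact hφ
  | and φ ψ h1 h2 => exact .andI (h1 h hφ.andL) (h2 h hφ.andR)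
  | or φ ψ h1 h2 =>
    exact .orE hφ (.orL (h1 h (.hyp (by simp)))) (.orR (h2 h (.hyp (by simp))))
  | imp φ ψ h1 h2 =>
    refine .impI (h2 h (.impE (hφ.weaken (by simp)) (h1 (symm h) (.hyp (by simp)))))
  | all φ ih =>
    refine .allI (ih (up_eq h) ?_)
    have := Derives.allE (v 0) (hφ.subst (fun n => v (n + 1)))
    refine cast ?_ this
    congr 1
    simp only [Fm.inst_eq, Fm.subst_subst]
    congr 1; funext n; cases n with
    | zero => rfl
    | succ n => simp only [up, Tm.lift, Tm.subst_subst]; rfl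
  | ex φ ih =>
    refine .exE hφ (.exI (v 0) ?_)
    have e : ((φ.subst (up τ)).subst (up fun n => v (n + 1))).inst 0 (v 0) = φ.subst (up τ) := by
      simp only [Fm.inst_eq, Fm.subst_subst]
      congr 1; funext n; cases n with
      | zero => rfl
      | succ n => simp only [up, Tm.lift, Tm.subst_subst]; rfl
    rw [e]
    exact ih (up_eq h) (.hyp (by simp))

/-! ### Forcing -/

/-- Extension of contexts. -/
class Le (w w' : List Fm) : Prop where
  sub : w ⊆ w'

instance Le.refl (w : List Fm) : Le w w := ⟨List.Subset.refl w⟩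
-- Instance search composes extensions of contexts, so that `h.w` transports a fact to any later
-- context without an explicit proof of inclusion.
set_option synthInstance.checkSynthOrder false in
instance (priority := low) Le.trans (u v w : List Fm) [h : Le v w] [h' : Le u v] : Le u w :=
  ⟨List.Subset.trans h'.sub h.sub⟩

theorem Der.impList {Γ Δ : List Fm} {χ : Fm} :
    Der (Γ ++ Δ) χ ↔ Der Δ (Γ.foldr (fun φ ψ => φ.imp ψ) χ) := by
  induction Γ generalizing Δ with
  | nil => rfl
  | cons φ Γ ih =>
    constructor
    · intro h
      exact .impI (ih.1 (h.weaken (by intro x; simp; tauto)))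
    · intro h
      have := Derives.impE (h.weaken (List.subset_cons_self φ Δ)) (.hyp (by simp))
      exact (ih.2 this).weaken (by intro x; simp; tauto)

/-- The covering relation in `HProp.closed` is stable under extension: the assumptions of `w'` are
moved into the conclusion as premises of implications, the cover of `w` is applied, and the premises
are discharged again in `w'`. -/
theorem cover_mono {P : List Fm → Prop} (mono : ∀ {w w'}, w ⊆ w' → P w → P w') {w w' : List Fm}
    (h : ∀ χ, (∀ u, w ⊆ u → P u → Der u χ) → Der w χ) (hw : w ⊆ w') (χ : Fm)
    (hχ : ∀ u, w' ⊆ u → P u → Der u χ) : Der w' χ := by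
  have := h (w'.foldr (fun φ ψ => φ.imp ψ) χ) fun u hu hP =>
    Der.impList.1 (hχ _ (List.subset_append_left _ _) (mono (List.subset_append_right _ _) hP))
  exact (Der.impList.2 this).weaken (List.append_subset.2 ⟨List.Subset.refl _, hw⟩)

/-- Truth values: sets of contexts that are closed under extension and under deduction. -/
structure HProp where
  val : List Fm → Prop
  mono : ∀ {w w'}, w ⊆ w' → val w → val w'
  closed : ∀ w, (∀ χ, (∀ u, w ⊆ u → val u → Der u χ) → Der w χ) → val w

/-- The truth value `P` holds in the context `w`. -/
def Forces (w : List Fm) (P : HProp) : Prop := P.val w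

notation:50 w:51 " ⊩ " P:51 => Forces w P

theorem Forces.w {w w' : List Fm} {P : HProp} (h : w ⊩ P) [l : Le w w'] : w' ⊩ P := P.mono l.sub h

namespace HProp

/-- Derivability of a formula. -/
def of (φ : Fm) : HProp where
  val w := Der w φ
  mono h h' := h'.weaken h
  closed _ h := h φ fun _ _ h => h

def bot : HProp := of .bot

def and (P Q : HProp) : HProp where
  val w := (w ⊩ P) ∧ (w ⊩ Q)
  mono h h' := ⟨P.mono h h'.1, Q.mono h h'.2⟩
  closed w h := ⟨P.closed w fun χ hχ => h χ fun u hu hP => hχ u hu hP.1,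
    Q.closed w fun χ hχ => h χ fun u hu hP => hχ u hu hP.2⟩

def imp (P Q : HProp) : HProp where
  val w := ∀ u, w ⊆ u → u ⊩ P → u ⊩ Q
  mono h h' u hu := h' u (List.Subset.trans h hu)
  closed _ h u hu hP := Q.closed u fun χ hχ =>
    cover_mono (P := fun w => ∀ u, w ⊆ u → u ⊩ P → u ⊩ Q) (fun h h' u hu => h' u (List.Subset.trans h hu)) h hu
      χ fun u' hu' hi => hχ u' hu' (hi u' (List.Subset.refl _) (P.mono hu' hP))

/-- The union of two truth values need not be closed under deduction. The second-order encoding is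
closed because each `R` is, and it permits elimination into every truth value. The existential
quantifier `ex` has the same form. -/
def or (P Q : HProp) : HProp where
  val w := ∀ (R : HProp) (u : List Fm), w ⊆ u → (∀ u', u ⊆ u' → u' ⊩ P → u' ⊩ R) →
    (∀ u', u ⊆ u' → u' ⊩ Q → u' ⊩ R) → u ⊩ R
  mono h h' R u hu := h' R u (List.Subset.trans h hu)
  closed _ h R u hu hP hQ := R.closed u fun χ hχ =>
    cover_mono (P := fun w => ∀ (R : HProp) (u : List Fm), w ⊆ u →
      (∀ u', u ⊆ u' → u' ⊩ P → u' ⊩ R) → (∀ u', u ⊆ u' → u' ⊩ Q → u' ⊩ R) → u ⊩ R)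
      (fun h h' R u hu => h' R u (List.Subset.trans h hu)) h hu
      χ fun u' hu' hi => hχ u' hu' (hi R u' (List.Subset.refl _)
        (fun v hv => hP v (List.Subset.trans hu' hv)) (fun v hv => hQ v (List.Subset.trans hu' hv)))

def all {α : Type} (P : α → HProp) : HProp where
  val w := ∀ d, w ⊩ P d
  mono h h' d := (P d).mono h (h' d)
  closed w h d := (P d).closed w fun χ hχ => h χ fun u hu hP => hχ u hu (hP d)

def ex {α : Type} (P : α → HProp) : HProp where
  val w := ∀ (R : HProp) (u : List Fm), w ⊆ u → (∀ d u', u ⊆ u' → u' ⊩ P d → u' ⊩ R) → u ⊩ R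
  mono h h' R u hu := h' R u (List.Subset.trans h hu)
  closed _ h R u hu hP := R.closed u fun χ hχ =>
    cover_mono (P := fun w => ∀ (R : HProp) (u : List Fm), w ⊆ u →
      (∀ d u', u ⊆ u' → u' ⊩ P d → u' ⊩ R) → u ⊩ R)
      (fun h h' R u hu => h' R u (List.Subset.trans h hu)) h hu
      χ fun u' hu' hi => hχ u' hu' (hi R u' (List.Subset.refl _)
        (fun d v hv => hP d v (List.Subset.trans hu' hv)))

end HProp

open HProp

theorem Forces.elim {w : List Fm} (h : w ⊩ bot) (P : HProp) : w ⊩ P :=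
  P.closed w fun _ _ => Derives.botE h

theorem forces_and {w : List Fm} {P Q : HProp} : (w ⊩ HProp.and P Q) ↔ (w ⊩ P) ∧ (w ⊩ Q) := Iff.rfl

theorem forces_imp {w : List Fm} {P Q : HProp} :
    (w ⊩ HProp.imp P Q) ↔ ∀ ⦃u⦄ [Le w u], u ⊩ P → u ⊩ Q :=
  ⟨fun h u l => h u l.sub, fun h u hu => @h u ⟨hu⟩⟩

theorem forces_all {w : List Fm} {α : Type} {P : α → HProp} : (w ⊩ HProp.all P) ↔ ∀ d, w ⊩ P d := Iff.rfl

theorem Forces.orL {w : List Fm} {P Q : HProp} (h : w ⊩ P) : w ⊩ HProp.or P Q :=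
  fun _ u hu hP _ => hP u (List.Subset.refl _) (P.mono hu h)
theorem Forces.orR {w : List Fm} {P Q : HProp} (h : w ⊩ Q) : w ⊩ HProp.or P Q :=
  fun _ u hu _ hQ => hQ u (List.Subset.refl _) (Q.mono hu h)
theorem Forces.exI {w : List Fm} {α : Type} {P : α → HProp} (d : α) (h : w ⊩ P d) : w ⊩ HProp.ex P :=
  fun _ u hu hP => hP d u (List.Subset.refl _) ((P d).mono hu h)

theorem Forces.orE {w : List Fm} {P Q R : HProp} (h : w ⊩ HProp.or P Q)
    (hP : ∀ ⦃u⦄ [Le w u], u ⊩ P → u ⊩ R) (hQ : ∀ ⦃u⦄ [Le w u], u ⊩ Q → u ⊩ R) : w ⊩ R :=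
  h R w (List.Subset.refl _) (fun u hu => @hP u ⟨hu⟩) (fun u hu => @hQ u ⟨hu⟩)

theorem Forces.exE {w : List Fm} {α : Type} {P : α → HProp} {R : HProp} (h : w ⊩ HProp.ex P)
    (hP : ∀ d ⦃u⦄ [Le w u], u ⊩ P d → u ⊩ R) : w ⊩ R :=
  h R w (List.Subset.refl _) (fun d u hu => @hP d u ⟨hu⟩)

/-! ### The domain -/

/-- Provable equality of terms. -/
instance tmSetoid : Setoid Tm where
  r s t := Der [] (eq s t)
  iseqv := ⟨fun t => .eqRefl t, fun h => h.eqSymm, fun h h' => h.eqTrans h'⟩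

/-- Terms up to provable equality. -/
def D : Type := Quotient tmSetoid

namespace D
/-- The class of a term. -/
def mk (t : Tm) : D := Quotient.mk tmSetoid t
/-- A term in the class. -/
noncomputable def out (d : D) : Tm := Quotient.out d
@[simp] theorem mk_out (d : D) : mk d.out = d := Quotient.out_eq d
theorem mk_eq {s t : Tm} : mk s = mk t ↔ Der [] (eq s t) := Quotient.eq (r := tmSetoid)
theorem out_mk (t : Tm) : Der [] (eq (mk t).out t) := mk_eq.1 (mk_out _)
end D

/-- Application of a function symbol. -/
noncomputable def ap {k : ℕ} (f : PR k) (a : Fin k → D) : D := D.mk (.fn f fun i => (a i).out)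

theorem mk_fn {k : ℕ} (f : PR k) (ts : Fin k → Tm) : D.mk (.fn f ts) = ap f fun i => D.mk (ts i) :=
  D.mk_eq.2 (Der.eqFn f _ _ fun i => (D.out_mk _).eqSymm)

/-- Evaluation of terms. -/
noncomputable def Tm.eval (ρ : ℕ → D) : Tm → D
  | .var n => ρ n
  | .fn f ts => ap f fun i => (ts i).eval ρ

theorem eval_eq (ρ : ℕ → D) (t : Tm) : t.eval ρ = D.mk (t.subst fun n => (ρ n).out) := by
  induction t with
  | var n => exact (D.mk_out _).symm
  | fn f ts ih => rw [Tm.subst, mk_fn, Tm.eval]; congr 1; funext i; exact ih i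

theorem eval_subst (ρ : ℕ → D) (σ : ℕ → Tm) (t : Tm) :
    (t.subst σ).eval ρ = t.eval fun n => (σ n).eval ρ := by
  induction t with
  | var n => rfl
  | fn f ts ih => simp only [Tm.subst, Tm.eval]; congr 1; funext i; exact ih i

/-- Equality of elements of the domain. -/
noncomputable def eqH (a b : D) : HProp := of (eq a.out b.out)
noncomputable def Vs (a : D) : HProp := of (isV a.out)
noncomputable def Ms (a : D) : HProp := of (isM a.out)
noncomputable def Ts (a : D) : HProp := of (isT a.out)

/-- The truth value of a formula. -/
noncomputable def Fm.sem : Fm → (ℕ → D) → HProp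
  | eq s t, ρ => eqH (s.eval ρ) (t.eval ρ)
  | isV t, ρ => Vs (t.eval ρ)
  | isM t, ρ => Ms (t.eval ρ)
  | isT t, ρ => Ts (t.eval ρ)
  | .bot, _ => HProp.bot
  | .and φ ψ, ρ => HProp.and (φ.sem ρ) (ψ.sem ρ)
  | .or φ ψ, ρ => HProp.or (φ.sem ρ) (ψ.sem ρ)
  | .imp φ ψ, ρ => HProp.imp (φ.sem ρ) (ψ.sem ρ)
  | .all φ, ρ => HProp.all fun d => φ.sem (scons d ρ)
  | .ex φ, ρ => HProp.ex fun d => φ.sem (scons d ρ)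

theorem eval_up (ρ : ℕ → D) (σ : ℕ → Tm) (d : D) :
    (fun n => (up σ n).eval (scons d ρ)) = scons d fun n => (σ n).eval ρ := by
  funext n; cases n with
  | zero => rfl
  | succ n => simp only [up, Tm.lift, eval_subst]; rfl

theorem sem_subst (φ : Fm) (ρ : ℕ → D) (σ : ℕ → Tm) :
    (φ.subst σ).sem ρ = φ.sem fun n => (σ n).eval ρ := by
  induction φ generalizing ρ σ with
  | all φ ih => simp only [Fm.subst, Fm.sem, ih, eval_up]
  | ex φ ih => simp only [Fm.subst, Fm.sem, ih, eval_up]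
  | _ => simp_all [Fm.subst, Fm.sem, eval_subst]

theorem inst_var_subst (φ : Fm) (ρ : ℕ → D) (d : D) :
    ((φ.subst (up fun n => (ρ n).out)).inst 0 d.out) = φ.subst fun n => (scons d ρ n).out := by
  rw [Fm.inst_eq, Fm.subst_subst]
  congr 1; funext n; cases n with
  | zero => rfl
  | succ n => exact lift_inst_tm _ _

theorem der_inst_var (φ : Fm) (ρ : ℕ → D) (Γ : List Fm) (t : Tm) :
    Der Γ (φ.subst fun n => (scons (D.mk t) ρ n).out) ↔
      Der Γ ((φ.subst (up fun n => (ρ n).out)).inst 0 t) := by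
  have e : ((φ.subst (up fun n => (ρ n).out)).inst 0 t) =
      φ.subst (scons t fun n => (ρ n).out) := by
    rw [Fm.inst_eq, Fm.subst_subst]
    congr 1; funext n; cases n with
    | zero => rfl
    | succ n => exact lift_inst_tm _ _
  have h : ∀ n, Der [] (eq (scons (D.mk t) ρ n).out (scons t (fun n => (ρ n).out) n)) := by
    intro n; cases n with
    | zero => exact D.out_mk t
    | succ n => exact .eqRefl _
  rw [e]
  exact ⟨Der.eqSubst h, Der.eqSubst fun n => (h n).eqSymm⟩

theorem Der.eqEq {Γ : List Fm} {s s' t t' : Tm} (h : Der [] (eq s s')) (h' : Der [] (eq t t')) :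
    Der Γ (eq s t) ↔ Der Γ (eq s' t') :=
  ⟨fun k => h.eqSymm.nil_weaken.eqTrans (k.eqTrans h'.nil_weaken),
    fun k => h.nil_weaken.eqTrans (k.eqTrans h'.eqSymm.nil_weaken)⟩

theorem Der.eqPred_iff {Γ : List Fm} (P : Tm → Fm) (hP : ∀ t, (P (v 0)).inst 0 t = P t)
    {s t : Tm} (h : Der [] (eq s t)) : Der Γ (P s) ↔ Der Γ (P t) :=
  ⟨Der.eqPred P hP h.nil_weaken, Der.eqPred P hP h.eqSymm.nil_weaken⟩

/-- Every operation on truth values has the same introduction and elimination rules as its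
connective. An implication is tested in the context extended by its premise, a universal quantifier
at a fresh variable. Elimination of a derivable disjunction or existential statement into an
arbitrary truth value is what `HProp.closed` is for. -/
theorem forces_sem (φ : Fm) (ρ : ℕ → D) (w : List Fm) :
    (w ⊩ φ.sem ρ) ↔ Der w (φ.subst fun n => (ρ n).out) := by
  have out_eval : ∀ t : Tm, ∀ ρ : ℕ → D, Der [] (eq (t.eval ρ).out (t.subst fun n => (ρ n).out)) :=
    fun t ρ => by rw [eval_eq]; exact D.out_mk _
  induction φ generalizing ρ w with
  | eq s t => exact Der.eqEq (out_eval _ _) (out_eval _ _)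
  | isV t => exact Der.eqPred_iff isV (by simp [Fm.inst_eq, Fm.subst]) (out_eval _ _)
  | isM t => exact Der.eqPred_iff isM (by simp [Fm.inst_eq, Fm.subst]) (out_eval _ _)
  | isT t => exact Der.eqPred_iff isT (by simp [Fm.inst_eq, Fm.subst]) (out_eval _ _)
  | bot => exact Iff.rfl
  | and φ ψ h1 h2 =>
    exact ⟨fun h => .andI ((h1 _ _).1 h.1) ((h2 _ _).1 h.2),
      fun h => ⟨(h1 _ _).2 h.andL, (h2 _ _).2 h.andR⟩⟩
  | or φ ψ h1 h2 =>
    constructor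
    · intro h
      exact h (of _) w (List.Subset.refl _) (fun u _ hu => Derives.orL ((h1 ρ u).1 hu))
        (fun u _ hu => Derives.orR ((h2 ρ u).1 hu))
    · intro h R u hu hP hQ
      refine R.closed u fun χ hχ => .orE (h.weaken hu) ?_ ?_
      · exact hχ _ (List.subset_cons_self _ _) (hP _ (List.subset_cons_self _ _)
          ((h1 _ _).2 (.hyp (by simp))))
      · exact hχ _ (List.subset_cons_self _ _) (hQ _ (List.subset_cons_self _ _)
          ((h2 _ _).2 (.hyp (by simp))))
  | imp φ ψ h1 h2 =>
    constructor
    · intro h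
      exact .impI ((h2 _ _).1 (h _ (List.subset_cons_self _ _) ((h1 _ _).2 (.hyp (by simp)))))
    · intro h u hu hP
      exact (h2 _ _).2 (.impE (h.weaken hu) ((h1 _ _).1 hP))
  | all φ ih =>
    constructor
    · intro h
      refine Der.allI' fun n => ?_
      exact (der_inst_var φ ρ w (v n)).1 ((ih _ _).1 (h (D.mk (v n))))
    · intro h d
      refine (ih _ _).2 ?_
      have := Derives.allE d.out h
      rwa [inst_var_subst] at this
  | ex φ ih =>
    constructor
    · intro h
      refine h (of _) w (List.Subset.refl _) fun d u _ hu => ?_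
      have := (ih _ _).1 hu
      rw [← inst_var_subst] at this
      exact Derives.exI _ this
    · intro h R u hu hP
      refine R.closed u fun χ hχ => Der.exE' (h.weaken hu) fun n => ?_
      refine hχ _ (List.subset_cons_self _ _) (hP (D.mk (v n)) _ (List.subset_cons_self _ _) ?_)
      refine (ih _ _).2 ((der_inst_var _ _ _ _).2 (.hyp (by simp)))

/-- The assignment of the variables to themselves. -/
def vars (n : ℕ) : D := D.mk (v n)

theorem eval_vars (t : Tm) : t.eval vars = D.mk t := by
  induction t with
  | var n => rfl
  | fn f ts ih => rw [Tm.eval, mk_fn]; congr 1; funext i; exact ih i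

theorem eval_vars_out (d : D) : d.out.eval vars = d := by rw [eval_vars, D.mk_out]

theorem der_iff_sem (φ : Fm) : Der [] φ ↔ [] ⊩ φ.sem vars := by
  rw [forces_sem]
  have h : ∀ n, Der [] (eq (v n) (vars n).out) := fun n => (D.out_mk _).eqSymm
  conv_lhs => rw [← Fm.subst_var φ]
  exact ⟨Der.eqSubst h, Der.eqSubst fun n => (h n).eqSymm⟩

/-- Closure of the axioms under substitution makes them hold for all assignments, not only for
`vars`. -/
theorem sem_of_ax {φ : Fm} (h : φ ∈ BarTheory) (ρ : ℕ → D) (w : List Fm) : w ⊩ φ.sem ρ :=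
  (forces_sem φ ρ w).2 (.ax (BarTheory.subst h _))

theorem eq_of_der {s t : Tm} (h : Der [] (eq s t)) : D.mk s = D.mk t := D.mk_eq.2 h

theorem Forces.eq_iff {a b : D} : ([] ⊩ eqH a b) ↔ a = b := by
  constructor
  · intro h
    have := D.mk_eq.2 (show Der [] (eq a.out b.out) from h)
    simpa using this
  · rintro rfl
    exact .eqRefl _

/-- Elements of the domain that are equal in every context are equal. -/
theorem eq_of_forces {a b : D} (h : ∀ w, w ⊩ eqH a b) : a = b := Forces.eq_iff.1 (h [])

theorem forces_rfl {w : List Fm} (a : D) : w ⊩ eqH a a := Derives.eqRefl _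
theorem forces_of_eq {w : List Fm} {a b : D} (h : a = b) : w ⊩ eqH a b := h ▸ forces_rfl a

theorem forces_subst {w : List Fm} {a b : D} (φ : Fm) (ρ : ℕ → D) (h : w ⊩ eqH a b)
    (ha : w ⊩ φ.sem (scons a ρ)) : w ⊩ φ.sem (scons b ρ) := by
  rw [forces_sem] at *
  rw [← inst_var_subst] at *
  exact .eqE _ h ha

/-! ### Operations on the domain -/

noncomputable def ap0 (f : PR 0) : D := ap f ![]
noncomputable def ap1 (f : PR 1) (a : D) : D := ap f ![a]
noncomputable def ap2 (f : PR 2) (a b : D) : D := ap f ![a, b]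
noncomputable def ap3 (f : PR 3) (a b c : D) : D := ap f ![a, b, c]

noncomputable abbrev Z : D := ap0 .zero
noncomputable abbrev S (a : D) : D := ap1 .succ a
noncomputable abbrev pr (a b : D) : D := ap2 .pair a b
noncomputable abbrev Lf (a : D) : D := ap1 .left a
noncomputable abbrev Rt (a : D) : D := ap1 .right a
noncomputable abbrev ad (a b : D) : D := ap2 .add a b
/-- The elements that interpret the numerals. -/
noncomputable def nm : ℕ → D
  | 0 => Z
  | n + 1 => S (nm n)
noncomputable def XiD (f g : D) : D := S (ad (pr f g) (pr f g))
noncomputable def OmD (f : D) : D := S (S (ad (ad f f) (ad f f)))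
noncomputable def shiftD (f n : D) : D :=
  pr (nm 5) (pr f (pr (nm 5) (pr (pr (nm 2) Z) (pr (nm 8) n))))

theorem ap_vec0 (f : PR 0) (a : Fin 0 → D) : ap f a = ap0 f := by
  rw [ap0]; congr 1; exact Subsingleton.elim _ _
theorem ap_vec1 (f : PR 1) (a : Fin 1 → D) : ap f a = ap1 f (a 0) := by
  rw [ap1]; congr 1; funext i; fin_cases i; rfl
theorem ap_vec2 (f : PR 2) (a : Fin 2 → D) : ap f a = ap2 f (a 0) (a 1) := by
  rw [ap2]; congr 1; funext i; fin_cases i <;> rfl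
theorem ap_vec3 (f : PR 3) (a : Fin 3 → D) : ap f a = ap3 f (a 0) (a 1) (a 2) := by
  rw [ap3]; congr 1; funext i; fin_cases i <;> rfl

@[simp] theorem eval_var (ρ : ℕ → D) (n : ℕ) : (v n).eval ρ = ρ n := rfl
@[simp] theorem eval_fn1 (ρ : ℕ → D) (f : PR 1) (t : Tm) : (Tm.fn f ![t]).eval ρ = ap1 f (t.eval ρ) := by
  rw [Tm.eval, ap_vec1]; rfl
@[simp] theorem eval_fn2 (ρ : ℕ → D) (f : PR 2) (s t : Tm) :
    (Tm.fn f ![s, t]).eval ρ = ap2 f (s.eval ρ) (t.eval ρ) := by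
  rw [Tm.eval, ap_vec2]; rfl
@[simp] theorem eval_fn3 (ρ : ℕ → D) (f : PR 3) (s t r : Tm) :
    (Tm.fn f ![s, t, r]).eval ρ = ap3 f (s.eval ρ) (t.eval ρ) (r.eval ρ) := by
  rw [Tm.eval, ap_vec3]; rfl
@[simp] theorem eval_zero (ρ : ℕ → D) : zero.eval ρ = Z := by
  rw [Tm.zero, Tm.eval, ap_vec0]
@[simp] theorem eval_succ (ρ : ℕ → D) (t : Tm) : t.succ.eval ρ = S (t.eval ρ) := eval_fn1 _ _ _
@[simp] theorem eval_pair (ρ : ℕ → D) (s t : Tm) : (pair s t).eval ρ = pr (s.eval ρ) (t.eval ρ) :=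
  eval_fn2 _ _ _ _
@[simp] theorem eval_L (ρ : ℕ → D) (t : Tm) : t.L.eval ρ = Lf (t.eval ρ) := eval_fn1 _ _ _
@[simp] theorem eval_R (ρ : ℕ → D) (t : Tm) : t.R.eval ρ = Rt (t.eval ρ) := eval_fn1 _ _ _
@[simp] theorem eval_U (ρ : ℕ → D) (t : Tm) : t.U.eval ρ = Rt (t.eval ρ) := eval_fn1 _ _ _
@[simp] theorem eval_num (ρ : ℕ → D) (n : ℕ) : (num n).eval ρ = nm n := by
  induction n with
  | zero => exact eval_zero ρ
  | succ n ih => rw [num, eval_succ, ih, nm]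
@[simp] theorem eval_nil (ρ : ℕ → D) : nil.eval ρ = Z := eval_zero ρ
@[simp] theorem eval_Xi (ρ : ℕ → D) (s t : Tm) : (Xi s t).eval ρ = XiD (s.eval ρ) (t.eval ρ) := by
  simp only [Xi, double, add, eval_succ, eval_fn2, eval_pair, XiD]
@[simp] theorem eval_Om (ρ : ℕ → D) (t : Tm) : (Om t).eval ρ = OmD (t.eval ρ) := by
  simp only [Om, double, add, eval_succ, eval_fn2, eval_pair, OmD]
@[simp] theorem eval_shift (ρ : ℕ → D) (s t : Tm) :
    (shift s t).eval ρ = shiftD (s.eval ρ) (t.eval ρ) := by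
  simp only [shift, eval_pair, eval_num, eval_zero, shiftD]
@[simp] theorem eval_lift (ρ : ℕ → D) (d : D) (t : Tm) : t.lift.eval (scons d ρ) = t.eval ρ := by
  rw [Tm.lift, eval_subst]; rfl

/-! ### The equations of the primitive recursive functions -/

theorem ap_mk {k : ℕ} (f : PR k) (ts : Fin k → Tm) : ap f (fun i => D.mk (ts i)) = D.mk (.fn f ts) :=
  (mk_fn f ts).symm

theorem ha_eq {s t : Tm} (h : HA (eq s t)) : D.mk s = D.mk t :=
  eq_of_der (.ax (.inl (.inl (.inl (.inl h)))))

theorem mk_zero : D.mk zero = Z := by rw [Tm.zero, mk_fn, ap_vec0]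
theorem mk_succ (t : Tm) : D.mk t.succ = S (D.mk t) := by rw [Tm.succ, mk_fn, ap_vec1]; rfl

theorem exists_rep {k : ℕ} (a : Fin k → D) : ∃ ts : Fin k → Tm, a = fun i => D.mk (ts i) :=
  ⟨fun i => (a i).out, funext fun i => (D.mk_out _).symm⟩

theorem ap_proj {n : ℕ} (i : Fin n) (a : Fin n → D) : ap (.proj i) a = a i := by
  obtain ⟨ts, rfl⟩ := exists_rep a
  rw [ap_mk]; exact ha_eq (.proj i ts)

theorem ap_comp {m n : ℕ} (f : PR m) (g : Fin m → PR n) (a : Fin n → D) :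
    ap (.comp f g) a = ap f fun i => ap (g i) a := by
  obtain ⟨ts, rfl⟩ := exists_rep a
  simp only [ap_mk]; exact ha_eq (.comp f g ts)

theorem ap_prec_zero {n : ℕ} (f : PR n) (g : PR (n + 2)) (a : Fin n → D) :
    ap (.prec f g) (Fin.cons Z a) = ap f a := by
  obtain ⟨ts, rfl⟩ := exists_rep a
  rw [← mk_zero, ← comp_fin_cons D.mk, ap_mk, ap_mk]
  exact ha_eq (.prec_zero f g ts)

theorem ap_prec_succ {n : ℕ} (f : PR n) (g : PR (n + 2)) (d : D) (a : Fin n → D) :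
    ap (.prec f g) (Fin.cons (S d) a) =
      ap g (Fin.cons d (Fin.cons (ap (.prec f g) (Fin.cons d a)) a)) := by
  obtain ⟨ts, rfl⟩ := exists_rep a
  obtain ⟨t, rfl⟩ : ∃ t, d = D.mk t := ⟨d.out, (D.mk_out d).symm⟩
  rw [← mk_succ]
  simp only [← comp_fin_cons D.mk, ap_mk]
  exact ha_eq (.prec_succ f g t ts)

section
variable {n : ℕ} (x : Fin n → D)

@[simp] theorem ap_c1 (f : PR 1) (a : PR n) : ap (.c1 f a) x = ap1 f (ap a x) := by
  rw [PR.c1, ap_comp, ap_vec1]; rfl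
@[simp] theorem ap_c2 (f : PR 2) (a b : PR n) : ap (.c2 f a b) x = ap2 f (ap a x) (ap b x) := by
  rw [PR.c2, ap_comp, ap_vec2]; rfl
@[simp] theorem ap_c3 (f : PR 3) (a b c : PR n) :
    ap (.c3 f a b c) x = ap3 f (ap a x) (ap b x) (ap c x) := by
  rw [PR.c3, ap_comp, ap_vec3]; rfl
@[simp] theorem ap_const (k : ℕ) : ap (.const k) x = nm k := by
  induction k with
  | zero => rw [PR.const, ap_comp, ap_vec0]; rfl
  | succ k ih => rw [PR.const, ap_c1, ih]; rfl

end

theorem prec1_zero (f : PR 0) (g : PR 2) : ap1 (.prec f g) Z = ap0 f := ap_prec_zero f g ![]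
theorem prec1_succ (f : PR 0) (g : PR 2) (d : D) :
    ap1 (.prec f g) (S d) = ap2 g d (ap1 (.prec f g) d) := ap_prec_succ f g d ![]
theorem prec2_zero (f : PR 1) (g : PR 3) (a : D) : ap2 (.prec f g) Z a = ap1 f a :=
  ap_prec_zero f g ![a]
theorem prec2_succ (f : PR 1) (g : PR 3) (d a : D) :
    ap2 (.prec f g) (S d) a = ap3 g d (ap2 (.prec f g) d a) a := ap_prec_succ f g d ![a]
theorem prec3_zero (f : PR 2) (g : PR 4) (a b : D) : ap3 (.prec f g) Z a b = ap2 f a b :=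
  ap_prec_zero f g ![a, b]
theorem prec3_succ (f : PR 2) (g : PR 4) (d a b : D) :
    ap3 (.prec f g) (S d) a b = ap g ![d, ap3 (.prec f g) d a b, a, b] := ap_prec_succ f g d ![a, b]

@[simp] theorem proj1_0 (a : D) : ap1 (.proj 0) a = a := ap_proj _ _
@[simp] theorem proj2_0 (a b : D) : ap2 (.proj 0) a b = a := ap_proj _ _
@[simp] theorem proj2_1 (a b : D) : ap2 (.proj 1) a b = b := ap_proj _ _
@[simp] theorem proj3_1 (a b c : D) : ap3 (.proj 1) a b c = b := ap_proj _ _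
@[simp] theorem ap1_c1 (f : PR 1) (a : PR 1) (x : D) : ap1 (.c1 f a) x = ap1 f (ap1 a x) := ap_c1 _ _ _
@[simp] theorem ap1_c2 (f : PR 2) (a b : PR 1) (x : D) :
    ap1 (.c2 f a b) x = ap2 f (ap1 a x) (ap1 b x) := ap_c2 _ _ _ _
@[simp] theorem ap1_c3 (f : PR 3) (a b c : PR 1) (x : D) :
    ap1 (.c3 f a b c) x = ap3 f (ap1 a x) (ap1 b x) (ap1 c x) := ap_c3 _ _ _ _ _
@[simp] theorem ap1_const (k : ℕ) (x : D) : ap1 (.const k) x = nm k := ap_const _ _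
@[simp] theorem ap2_c1 (f : PR 1) (a : PR 2) (x y : D) : ap2 (.c1 f a) x y = ap1 f (ap2 a x y) :=
  ap_c1 _ _ _
@[simp] theorem ap2_c2 (f : PR 2) (a b : PR 2) (x y : D) :
    ap2 (.c2 f a b) x y = ap2 f (ap2 a x y) (ap2 b x y) := ap_c2 _ _ _ _
@[simp] theorem ap2_c3 (f : PR 3) (a b c : PR 2) (x y : D) :
    ap2 (.c3 f a b c) x y = ap3 f (ap2 a x y) (ap2 b x y) (ap2 c x y) := ap_c3 _ _ _ _ _
@[simp] theorem ap2_const (k : ℕ) (x y : D) : ap2 (.const k) x y = nm k := ap_const _ _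
@[simp] theorem ap3_c1 (f : PR 1) (a : PR 3) (x y t : D) :
    ap3 (.c1 f a) x y t = ap1 f (ap3 a x y t) := ap_c1 _ _ _

/-! ### Definable functions and predicates -/

/-- Tuples that assign values to variables. -/
class Env (X : Type) where
  enc : X → ℕ → D

instance : Env Unit := ⟨fun _ => vars⟩
instance {X : Type} [Env X] : Env (X × D) := ⟨fun p => scons p.2 (Env.enc p.1)⟩

/-- Definable by a term. -/
class DefT {X : Type} [Env X] (f : X → D) : Prop where
  ex : ∃ t : Tm, ∀ x, t.eval (Env.enc x) = f x

/-- Definable by a formula. -/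
class DefP {X : Type} [Env X] (P : X → HProp) : Prop where
  ex : ∃ φ : Fm, ∀ x, φ.sem (Env.enc x) = P x

/-- Definable by an almost-negative formula. -/
class DefAN {X : Type} [Env X] (P : X → HProp) : Prop where
  ex : ∃ φ : Fm, AlmostNegative φ ∧ ∀ x, φ.sem (Env.enc x) = P x

/-- All elements of the domain are definable. -/
class HasConst (X : Type) [Env X] : Prop where
  ex : ∀ a : D, ∃ t : Tm, ∀ x : X, t.eval (Env.enc x) = a

instance : HasConst Unit := ⟨fun a => ⟨a.out, fun _ => eval_vars_out a⟩⟩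
instance {X : Type} [Env X] [h : HasConst X] : HasConst (X × D) :=
  ⟨fun a => let ⟨t, ht⟩ := h.ex a; ⟨t.lift, fun x => (eval_lift _ _ _).trans (ht x.1)⟩⟩

section
variable {X : Type} [Env X]

instance (a : D) [h : HasConst X] : DefT (fun _ : X => a) := ⟨h.ex a⟩

instance : DefT (fun p : X × D => p.2) := ⟨v 0, fun _ => rfl⟩
instance : DefT (fun p : (X × D) × D => p.1.2) := ⟨v 1, fun _ => rfl⟩
instance : DefT (fun p : ((X × D) × D) × D => p.1.1.2) := ⟨v 2, fun _ => rfl⟩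
instance : DefT (fun p : (((X × D) × D) × D) × D => p.1.1.1.2) := ⟨v 3, fun _ => rfl⟩
instance : DefT (fun p : ((((X × D) × D) × D) × D) × D => p.1.1.1.1.2) := ⟨v 4, fun _ => rfl⟩
instance : DefT (fun p : (((((X × D) × D) × D) × D) × D) × D => p.1.1.1.1.1.2) :=
  ⟨v 5, fun _ => rfl⟩

theorem DefT.weaken (f : X → D) [h : DefT f] : DefT (fun p : X × D => f p.1) :=
  let ⟨t, ht⟩ := h.ex
  ⟨t.lift, fun _ => (eval_lift _ _ _).trans (ht _)⟩

instance (priority := low) (f : X → D) [DefT f] : DefT (fun p : X × D => f p.1) := .weaken f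
instance (priority := low) (f : X → D) [DefT f] : DefT (fun p : (X × D) × D => f p.1.1) :=
  .weaken fun q : X × D => f q.1
instance (priority := low) (f : X → D) [DefT f] : DefT (fun p : ((X × D) × D) × D => f p.1.1.1) :=
  .weaken fun q : (X × D) × D => f q.1.1
instance (priority := low) (f : X → D) [DefT f] :
    DefT (fun p : (((X × D) × D) × D) × D => f p.1.1.1.1) :=
  .weaken fun q : ((X × D) × D) × D => f q.1.1.1

/-- For a variable predicate `P`, instance search does not find the definability of a composition;
it is supplied by hand through this lemma and through `DefP.of1` and `DefP.of2`. -/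
theorem DefP.comp_snd (P : X → D → HProp) (f : D → D) [hP : DefP (fun p : X × D => P p.1 p.2)]
    [hf : DefT fun p : X × D => f p.2] : DefP (fun p : X × D => P p.1 (f p.2)) := by
  obtain ⟨φ, hφ⟩ := hP.ex
  obtain ⟨t, ht⟩ := hf.ex
  refine ⟨φ.subst (scons t fun n => v (n + 1)), fun x => ?_⟩
  rw [sem_subst, ← ht, ← hφ (x.1, t.eval (Env.enc x))]
  congr 1; funext n; cases n <;> rfl

instance (f : PR 0) : DefT (fun _ : X => ap0 f) := ⟨.fn f ![], fun _ => by rw [Tm.eval, ap_vec0]⟩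
instance (f : PR 1) (a : X → D) [ha : DefT a] : DefT (fun x => ap1 f (a x)) :=
  let ⟨s, hs⟩ := ha.ex
  ⟨.fn f ![s], fun x => by rw [eval_fn1, hs]⟩
instance (f : PR 2) (a b : X → D) [ha : DefT a] [hb : DefT b] :
    DefT (fun x => ap2 f (a x) (b x)) :=
  let ⟨s, hs⟩ := ha.ex
  let ⟨t, ht⟩ := hb.ex
  ⟨.fn f ![s, t], fun x => by rw [eval_fn2, hs, ht]⟩
instance (f : PR 3) (a b c : X → D) [ha : DefT a] [hb : DefT b] [hc : DefT c] :
    DefT (fun x => ap3 f (a x) (b x) (c x)) :=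
  let ⟨s, hs⟩ := ha.ex
  let ⟨t, ht⟩ := hb.ex
  let ⟨r, hr⟩ := hc.ex
  ⟨.fn f ![s, t, r], fun x => by rw [eval_fn3, hs, ht, hr]⟩
instance (n : ℕ) : DefT (fun _ : X => nm n) := ⟨num n, fun _ => eval_num _ _⟩
instance (a b : X → D) [DefT a] [DefT b] : DefT (fun x => XiD (a x) (b x)) := by
  unfold XiD; infer_instance
instance (a : X → D) [DefT a] : DefT (fun x => OmD (a x)) := by
  unfold OmD; infer_instance
instance (a b : X → D) [DefT a] [DefT b] : DefT (fun x => shiftD (a x) (b x)) := by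
  unfold shiftD; infer_instance

instance (a b : X → D) [ha : DefT a] [hb : DefT b] : DefP (fun x => eqH (a x) (b x)) :=
  let ⟨s, hs⟩ := ha.ex
  let ⟨t, ht⟩ := hb.ex
  ⟨.eq s t, fun x => by rw [Fm.sem, hs, ht]⟩
instance (a : X → D) [ha : DefT a] : DefP (fun x => Vs (a x)) :=
  let ⟨s, hs⟩ := ha.ex
  ⟨.isV s, fun x => by rw [Fm.sem, hs]⟩
instance (a : X → D) [ha : DefT a] : DefP (fun x => Ms (a x)) :=
  let ⟨s, hs⟩ := ha.ex
  ⟨.isM s, fun x => by rw [Fm.sem, hs]⟩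
instance (a : X → D) [ha : DefT a] : DefP (fun x => Ts (a x)) :=
  let ⟨s, hs⟩ := ha.ex
  ⟨.isT s, fun x => by rw [Fm.sem, hs]⟩
instance : DefP (fun _ : X => HProp.bot) := ⟨.bot, fun _ => rfl⟩
instance (P Q : X → HProp) [hP : DefP P] [hQ : DefP Q] : DefP (fun x => HProp.and (P x) (Q x)) :=
  let ⟨φ, hφ⟩ := hP.ex
  let ⟨ψ, hψ⟩ := hQ.ex
  ⟨.and φ ψ, fun x => by rw [Fm.sem, hφ, hψ]⟩
instance (P Q : X → HProp) [hP : DefP P] [hQ : DefP Q] : DefP (fun x => HProp.or (P x) (Q x)) :=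
  let ⟨φ, hφ⟩ := hP.ex
  let ⟨ψ, hψ⟩ := hQ.ex
  ⟨.or φ ψ, fun x => by rw [Fm.sem, hφ, hψ]⟩
instance (P Q : X → HProp) [hP : DefP P] [hQ : DefP Q] : DefP (fun x => HProp.imp (P x) (Q x)) :=
  let ⟨φ, hφ⟩ := hP.ex
  let ⟨ψ, hψ⟩ := hQ.ex
  ⟨.imp φ ψ, fun x => by rw [Fm.sem, hφ, hψ]⟩
instance (P : X → D → HProp) [hP : DefP (fun p : X × D => P p.1 p.2)] :
    DefP (fun x => HProp.all (P x)) :=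
  let ⟨φ, hφ⟩ := hP.ex
  ⟨.all φ, fun x => congrArg HProp.all (funext fun d => hφ (x, d))⟩
instance (P : X → D → HProp) [hP : DefP (fun p : X × D => P p.1 p.2)] :
    DefP (fun x => HProp.ex (P x)) :=
  let ⟨φ, hφ⟩ := hP.ex
  ⟨.ex φ, fun x => congrArg HProp.ex (funext fun d => hφ (x, d))⟩

instance (a b : X → D) [ha : DefT a] [hb : DefT b] : DefAN (fun x => eqH (a x) (b x)) :=
  let ⟨s, hs⟩ := ha.ex
  let ⟨t, ht⟩ := hb.ex
  ⟨.eq s t, .sigma1 (.qf (.eq _ _)), fun x => by rw [Fm.sem, hs, ht]⟩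
instance (a : X → D) [ha : DefT a] : DefAN (fun x => Ts (a x)) :=
  let ⟨s, hs⟩ := ha.ex
  ⟨.isT s, .isT _, fun x => by rw [Fm.sem, hs]⟩
instance : DefAN (fun _ : X => HProp.bot) := ⟨.bot, .sigma1 (.qf .bot), fun _ => rfl⟩
instance (P Q : X → HProp) [hP : DefAN P] [hQ : DefAN Q] :
    DefAN (fun x => HProp.imp (P x) (Q x)) :=
  let ⟨φ, hφ, hφ'⟩ := hP.ex
  let ⟨ψ, hψ, hψ'⟩ := hQ.ex
  ⟨.imp φ ψ, .imp hφ hψ, fun x => by rw [Fm.sem, hφ', hψ']⟩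
instance (P : X → D → HProp) [hP : DefAN (fun p : X × D => P p.1 p.2)] :
    DefAN (fun x => HProp.all (P x)) :=
  let ⟨φ, hφ, hφ'⟩ := hP.ex
  ⟨.all φ, .all hφ, fun x => congrArg HProp.all (funext fun d => hφ' (x, d))⟩

end

/-- Unary definable predicates with parameters. -/
abbrev Def1 (P : D → HProp) : Prop := DefP (fun p : Unit × D => P p.2)
/-- Binary definable predicates with parameters. -/
abbrev Def2 (P : D → D → HProp) : Prop := DefP (fun p : (Unit × D) × D => P p.1.2 p.2)

/-- Every assignment can be replaced by parameters. -/
theorem def_sem (φ : Fm) (ρ : ℕ → D) : Def1 fun d => φ.sem (scons d ρ) := by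
  refine ⟨φ.subst (scons (v 0) fun n => (ρ n).out.lift), fun x => ?_⟩
  rw [sem_subst]; congr 1; funext n; cases n with
  | zero => rfl
  | succ n => exact (eval_lift _ _ _).trans (eval_vars_out _)

/-! ### The axioms in the semantics -/

/-- The Kleene predicate. -/
noncomputable def KT (e i o : D) : HProp := eqH (ap2 .run (Lf o) (pr Z (pr e i))) (pr Z (pr Z (Rt o)))
/-- The value `e i` is defined and has the property `P`. -/
noncomputable def atA (e i : D) (P : D → HProp) : HProp :=
  HProp.ex fun o => HProp.and (KT e i o) (P (Rt o))
/-- The value `e i` is defined. -/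
noncomputable def dfd (e i : D) : HProp := HProp.ex fun o => KT e i o
/-- `x` enumerates Meaningful conditions and, conditionally, elements that satisfy `P`. -/
noncomputable def cEnum (x : D) (P : D → HProp) : HProp :=
  HProp.all fun n => atA x n fun y => HProp.and (Ms (Rt y)) (HProp.imp (Ts (Rt y)) (P (Lf y)))
noncomputable def iffH (P Q : HProp) : HProp := HProp.and (HProp.imp P Q) (HProp.imp Q P)
noncomputable def notH (P : HProp) : HProp := HProp.imp P HProp.bot

section
variable {X : Type} [Env X]
instance (e i o : X → D) [DefT e] [DefT i] [DefT o] : DefP (fun x => KT (e x) (i x) (o x)) := by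
  unfold KT; infer_instance
instance (e i o : X → D) [DefT e] [DefT i] [DefT o] : DefAN (fun x => KT (e x) (i x) (o x)) := by
  unfold KT; infer_instance
instance (e i : X → D) (P : X → D → HProp) [DefT e] [DefT i] [DefP (fun p : X × D => P p.1 p.2)] :
    DefP (fun x => atA (e x) (i x) (P x)) := by
  have := DefP.comp_snd P Rt
  unfold atA; infer_instance
instance (P Q : X → HProp) [DefP P] [DefP Q] : DefP (fun x => iffH (P x) (Q x)) := by
  unfold iffH; infer_instance
end

@[simp] theorem sem_inst (k : ℕ) (t : Tm) (φ : Fm) (ρ : ℕ → D) :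
    (φ.inst k t).sem ρ = φ.sem (scons (t.eval ρ) fun j => ρ (j + k)) := by
  rw [Fm.inst_eq, sem_subst]; congr 1; funext n; cases n <;> rfl
@[simp] theorem sem_inst2 (k : ℕ) (s t : Tm) (φ : Fm) (ρ : ℕ → D) :
    (φ.inst2 k s t).sem ρ = φ.sem (scons (t.eval ρ) (scons (s.eval ρ) fun j => ρ (j + k))) := by
  rw [Fm.inst2_eq, sem_subst]; congr 1; funext n; rcases n with _ | _ | n <;> rfl
@[simp] theorem sem_kleeneT (e i o : Tm) (ρ : ℕ → D) :
    (kleeneT e i o).sem ρ = KT (e.eval ρ) (i.eval ρ) (o.eval ρ) := by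
  simp [kleeneT, Fm.sem, KT]
@[simp] theorem sem_defd (e i : Tm) (ρ : ℕ → D) : (defd e i).sem ρ = dfd (e.eval ρ) (i.eval ρ) := by
  simp [defd, Fm.sem, dfd]
@[simp] theorem sem_atApp (e i : Tm) (φ : Fm) (ρ : ℕ → D) :
    (atApp e i φ).sem ρ = atA (e.eval ρ) (i.eval ρ) fun d => φ.sem (scons d ρ) := by
  simp [atApp, Fm.sem, atA]
@[simp] theorem sem_condEnum (x : Tm) (φ : Fm) (ρ : ℕ → D) :
    (condEnum x φ).sem ρ = cEnum (x.eval ρ) fun d => φ.sem (scons d ρ) := by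
  simp [condEnum, Fm.sem, cEnum]
@[simp] theorem sem_iff (φ ψ : Fm) (ρ : ℕ → D) : (φ.iff ψ).sem ρ = iffH (φ.sem ρ) (ψ.sem ρ) := rfl
@[simp] theorem sem_not (φ : Fm) (ρ : ℕ → D) : (φ.not).sem ρ = notH (φ.sem ρ) := rfl

theorem enc_pair (d : D) : Env.enc (X := Unit × D) ((), d) = scons d vars := rfl
theorem enc_pair2 (d e : D) : Env.enc (X := (Unit × D) × D) (((), d), e) = scons e (scons d vars) :=
  rfl

variable {w : List Fm}

theorem Forces.eqSubst (P : D → HProp) [hP : Def1 P] {a b : D} (h : w ⊩ eqH a b)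
    (ha : w ⊩ P a) : w ⊩ P b := by
  obtain ⟨φ, hφ⟩ := hP.ex
  have := hφ ((), a)
  rw [enc_pair] at this
  simp only at this
  have h2 := hφ ((), b)
  rw [enc_pair] at h2
  simp only at h2
  rw [← this] at ha
  rw [← h2]
  exact forces_subst φ _ h ha

theorem ind (P : D → HProp) [hP : Def1 P] (h0 : w ⊩ P Z)
    (hS : ∀ d ⦃u⦄ [Le w u], u ⊩ P d → u ⊩ P (S d)) (d : D) : w ⊩ P d := by
  obtain ⟨φ, hφ⟩ := hP.ex
  have hφ' : ∀ d, φ.sem (scons d vars) = P d := fun d => hφ ((), d)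
  have := sem_of_ax (.inl (.inl (.inl (.inl (HA.induction φ))))) vars w
  simp only [Fm.sem, sem_inst, eval_zero, eval_succ, eval_var, scons_zero, forces_imp, forces_all,
    scons_succ] at this
  have e : (fun j => vars (j + 0)) = vars := rfl
  simp only [e, hφ'] at this
  exact this h0 (fun d u l hu => hS d hu) d

theorem succ_ne (a : D) (h : w ⊩ eqH (S a) Z) (P : HProp) : w ⊩ P := by
  have := sem_of_ax (.inl (.inl (.inl (.inl (HA.succ_ne (v 0)))))) (fun _ => a) w
  simp only [Fm.sem, sem_not, notH, eval_zero, eval_succ, eval_var, forces_imp] at this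
  exact (this h).elim P

theorem succ_inj {a b : D} (h : w ⊩ eqH (S a) (S b)) : w ⊩ eqH a b := by
  have := sem_of_ax (.inl (.inl (.inl (.inl (HA.succ_inj (v 0) (v 1)))))) (scons a fun _ => b) w
  simp only [Fm.sem, eval_succ, eval_var, forces_imp, scons_zero, scons_one] at this
  exact this h

theorem ect (P : D → HProp) (Q : D → D → HProp) [hP : DefAN (fun p : Unit × D => P p.2)]
    [hQ : Def2 Q] (h : ∀ n ⦃u⦄ [Le w u], u ⊩ P n → u ⊩ HProp.ex (Q n)) :
    w ⊩ HProp.ex fun e => HProp.all fun n => HProp.imp (P n) (atA e n (Q n)) := by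
  obtain ⟨φ, hAN, hφ⟩ := hP.ex
  obtain ⟨ψ, hψ⟩ := hQ.ex
  have hφ' : ∀ d, φ.sem (scons d vars) = P d := fun d => hφ ((), d)
  have hψ' : ∀ d e, ψ.sem (scons e (scons d vars)) = Q d e := fun d e => hψ (((), d), e)
  have := sem_of_ax (.inl (.inl (.inl (.inr (ECTV.mk φ ψ hAN))))) vars w
  simp only [Fm.sem, sem_inst, sem_inst2, sem_atApp, eval_var, scons_zero, scons_one, scons_succ,
    hφ', hψ'] at this
  rw [forces_imp] at this
  exact this (fun d => forces_imp.2 (h d))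

theorem v_intro {x : D} (h : w ⊩ cEnum x Vs) : w ⊩ Vs x := by
  have := sem_of_ax (.inl (.inl (.inr VAxioms.intro))) vars w
  simp only [Fm.sem, sem_condEnum, eval_var, scons_zero, forces_all, forces_imp] at this
  exact this x h

theorem v_ind (P : D → HProp) [hP : Def1 P]
    (h : ∀ x ⦃u⦄ [Le w u], u ⊩ cEnum x P → u ⊩ P x) {x : D} {u : List Fm} [Le w u]
    (hx : u ⊩ Vs x) : u ⊩ P x := by
  obtain ⟨φ, hφ⟩ := hP.ex
  have hφ' : ∀ d, φ.sem (scons d vars) = P d := fun d => hφ ((), d)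
  have := sem_of_ax (.inl (.inl (.inr (VAxioms.induction φ)))) vars w
  simp only [Fm.sem, sem_condEnum, eval_var, sem_inst, scons_zero, scons_succ, hφ', forces_all,
    forces_imp] at this
  exact @this w _ (fun x u l hu => h x hu) x _ _ hx

theorem xi_truth {f g : D} (h : w ⊩ Ms (XiD f g)) :
    (w ⊩ Ts (XiD f g)) ↔ ∀ n, ∀ ⦃u⦄ [Le w u], u ⊩ atA f n Ts → u ⊩ atA g n Ts := by
  have := sem_of_ax (.inl (.inr XiAxioms.truth)) vars w
  simp only [Fm.sem, sem_iff, iffH, sem_atApp, eval_Xi, eval_var, scons_zero, scons_succ, scons_one,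
    forces_all, forces_imp, forces_and] at this
  have := this f g h
  exact ⟨fun hT n u l hu => this.1 hT n hu, fun hT => this.2 hT⟩

theorem xi_meaning {f g : D} (h1 : ∀ n ⦃u⦄ [Le w u], u ⊩ dfd f n → u ⊩ atA f n Ms)
    (h2 : ∀ n ⦃u⦄ [Le w u], u ⊩ dfd f n → u ⊩ dfd g n → u ⊩ atA f n Ts → u ⊩ atA g n Ms) :
    w ⊩ Ms (XiD f g) := by
  have := sem_of_ax (.inl (.inr XiAxioms.meaning)) vars w
  simp only [Fm.sem, sem_defd, sem_atApp, eval_Xi, eval_var, scons_zero, scons_succ, scons_one,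
    forces_all, forces_imp, forces_and] at this
  exact this f g ⟨h1, fun n u l hu => h2 n hu.1 hu.2.1 hu.2.2⟩

theorem om_meaning {f : D} (h : ∀ n, w ⊩ atA f n Ms) : w ⊩ Ms (OmD f) := by
  have := sem_of_ax (.inr OmAxioms.meaning) vars w
  simp only [Fm.sem, sem_atApp, eval_Om, eval_var, scons_zero, scons_succ, scons_one,
    forces_all, forces_imp, forces_and] at this
  exact this f h

theorem om_intro {f : D} (h : w ⊩ Ms (OmD f))
    (h' : ∀ ⦃u⦄ [Le w u], u ⊩ atA f Z Ts → ∀ n, u ⊩ Ts (OmD (shiftD f n))) : w ⊩ Ts (OmD f) := by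
  have := sem_of_ax (.inr OmAxioms.intro) vars w
  simp only [Fm.sem, sem_atApp, eval_Om, eval_var, eval_nil, eval_shift, scons_zero, scons_succ,
    scons_one, forces_all, forces_imp, forces_and] at this
  exact this f ⟨h, h'⟩

theorem om_ind (P : D → HProp) [hP : Def1 P]
    (h : ∀ f ⦃u⦄ [Le w u], u ⊩ Ms (OmD f) →
      (∀ ⦃u'⦄ [Le u u'], u' ⊩ atA f Z Ts → ∀ n, u' ⊩ P (shiftD f n)) → u ⊩ P f)
    {f : D} {u : List Fm} [Le w u] (hf : u ⊩ Ts (OmD f)) : u ⊩ P f := by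
  obtain ⟨φ, hφ⟩ := hP.ex
  have hφ' : ∀ d, φ.sem (scons d vars) = P d := fun d => hφ ((), d)
  have := sem_of_ax (.inr (OmAxioms.induction φ)) vars w
  simp only [Fm.sem, sem_atApp, eval_Om, eval_var, eval_nil, eval_shift, sem_inst, scons_zero,
    scons_succ, scons_one, hφ', forces_all, forces_imp, forces_and] at this
  exact @this w _ (fun f u l hu => h f hu.1 fun u' l' hT n => hu.2 hT n) f _ _ hf

/-! ### Equality and arithmetic -/

theorem Forces.symm {a b : D} (h : w ⊩ eqH a b) : w ⊩ eqH b a :=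
  Forces.eqSubst (P := fun x => eqH x a) h (forces_rfl a)
theorem Forces.trans {a b c : D} (h : w ⊩ eqH a b) (h' : w ⊩ eqH b c) : w ⊩ eqH a c :=
  Forces.eqSubst (P := fun x => eqH a x) h' h
theorem Forces.congr1 (f : PR 1) {a b : D} (h : w ⊩ eqH a b) : w ⊩ eqH (ap1 f a) (ap1 f b) :=
  Forces.eqSubst (P := fun x => eqH (ap1 f a) (ap1 f x)) h (forces_rfl _)
theorem Forces.congr2 (f : PR 2) {a b c d : D} (h : w ⊩ eqH a b) (h' : w ⊩ eqH c d) :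
    w ⊩ eqH (ap2 f a c) (ap2 f b d) :=
  Forces.eqSubst (P := fun x => eqH (ap2 f a c) (ap2 f b x)) h'
    (Forces.eqSubst (P := fun x => eqH (ap2 f a c) (ap2 f x c)) h (forces_rfl _))
theorem Forces.congr3 (f : PR 3) {a b c d e g : D} (h : w ⊩ eqH a b) (h' : w ⊩ eqH c d)
    (h'' : w ⊩ eqH e g) : w ⊩ eqH (ap3 f a c e) (ap3 f b d g) :=
  Forces.eqSubst (P := fun x => eqH (ap3 f a c e) (ap3 f b d x)) h''
    (Forces.eqSubst (P := fun x => eqH (ap3 f a c e) (ap3 f b x e)) h'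
      (Forces.eqSubst (P := fun x => eqH (ap3 f a c e) (ap3 f x c e)) h (forces_rfl _)))

/-- Functions defined by the same recursion are equal. -/
theorem rec_unique (F G : D → D) (H : D → D → D) [DefT fun p : Unit × D => F p.2]
    [DefT fun p : Unit × D => G p.2] [DefT fun p : ((Unit × D) × D) × D => H p.1.2 p.2]
    [DefT fun p : ((Unit × D) × D) => F p.1.2] [DefT fun p : ((Unit × D) × D) => H p.1.2 p.2]
    (h0 : F Z = G Z) (hF : ∀ d, F (S d) = H d (F d)) (hG : ∀ d, G (S d) = H d (G d)) (d : D) :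
    F d = G d := by
  refine eq_of_forces fun w => ind (P := fun d => eqH (F d) (G d)) (forces_of_eq h0) ?_ d
  intro d u _ hd
  rw [hF, hG]
  have : ∀ a, DefT fun p : Unit × D => H a p.2 := fun a => by
    obtain ⟨t, ht⟩ := ‹DefT fun p : ((Unit × D) × D) => H p.1.2 p.2›.ex
    refine ⟨t.subst (scons (v 0) (scons a.out.lift fun n => v (n + 1))), fun x => ?_⟩
    rw [eval_subst, ← ht (((), a), x.2)]
    congr 1; funext n; rcases n with _ | _ | n
    · rfl
    · exact (eval_lift _ _ _).trans (eval_vars_out _)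
    · rfl
  exact Forces.eqSubst (P := fun x => eqH (H d (F d)) (H d x)) hd (forces_rfl _)

noncomputable abbrev sb (a b : D) : D := ap2 .sub a b
noncomputable abbrev pd (a : D) : D := ap1 .pred a
noncomputable abbrev ifz (a b c : D) : D := ap3 .ifz a b c
noncomputable abbrev tr (a : D) : D := ap1 .tri a
noncomputable abbrev rt (a : D) : D := ap1 .root a

@[simp] theorem Z_ad (a : D) : ad Z a = a := by
  rw [ad, PR.add, prec2_zero, proj1_0]
@[simp] theorem S_ad (a b : D) : ad (S a) b = S (ad a b) := by
  simp only [ad, PR.add, prec2_succ, ap3_c1, proj3_1]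
@[simp] theorem ad_Z (a : D) : ad a Z = a :=
  rec_unique (fun a => ad a Z) (fun a => a) (fun _ x => S x) (by simp) (by simp) (by simp) a
@[simp] theorem ad_S (a b : D) : ad a (S b) = S (ad a b) :=
  rec_unique (fun a => ad a (S b)) (fun a => S (ad a b)) (fun _ x => S x) (by simp) (by simp) (by simp) a
theorem ad_comm (a b : D) : ad a b = ad b a :=
  rec_unique (fun a => ad a b) (fun a => ad b a) (fun _ x => S x) (by simp) (by simp) (by simp) a
theorem ad_assoc (a b c : D) : ad (ad a b) c = ad a (ad b c) :=
  rec_unique (fun a => ad (ad a b) c) (fun a => ad a (ad b c)) (fun _ x => S x) (by simp) (by simp)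
    (by simp) a

@[simp] theorem pd_Z : pd Z = Z := prec1_zero _ _
@[simp] theorem pd_S (a : D) : pd (S a) = a := by rw [pd, PR.pred, prec1_succ, proj2_0]
@[simp] theorem sb_Z (a : D) : sb a Z = a := by
  simp only [sb, PR.sub, PR.rsub, ap2_c2, proj2_0, proj2_1, prec2_zero, proj1_0]
theorem sb_S (a b : D) : sb a (S b) = pd (sb a b) := by
  simp only [sb, PR.sub, PR.rsub, ap2_c2, proj2_0, proj2_1, prec2_succ, ap3_c1, proj3_1]
@[simp] theorem S_sb_S (a b : D) : sb (S a) (S b) = sb a b :=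
  rec_unique (fun b => sb (S a) (S b)) (fun b => sb a b) (fun _ x => pd x) (by simp [sb_S])
    (fun _ => sb_S _ _) (by simp [sb_S]) b
@[simp] theorem Z_sb (a : D) : sb Z a = Z :=
  rec_unique (fun a => sb Z a) (fun _ => Z) (fun _ x => pd x) (by simp) (by simp [sb_S]) (by simp) a
@[simp] theorem sb_self (a : D) : sb a a = Z :=
  rec_unique (fun a => sb a a) (fun _ => Z) (fun _ x => x) (by simp) (by simp) (by simp) a
@[simp] theorem ad_sb (a b : D) : sb (ad a b) a = b :=
  rec_unique (fun a => sb (ad a b) a) (fun _ => b) (fun _ x => x) (by simp) (by simp) (by simp) a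
theorem pd_sb (a b : D) : sb (pd a) b = pd (sb a b) :=
  rec_unique (fun b => sb (pd a) b) (fun b => pd (sb a b)) (fun _ x => pd x) (by simp)
    (by simp [sb_S]) (by simp [sb_S]) b
theorem sb_right_comm (a b c : D) : sb (sb a b) c = sb (sb a c) b :=
  rec_unique (fun c => sb (sb a b) c) (fun c => sb (sb a c) b) (fun _ x => pd x) (by simp)
    (by simp [sb_S]) (by simp [sb_S, pd_sb]) c

@[simp] theorem ifz_Z (a b : D) : ifz Z a b = a := by
  rw [ifz, PR.ifz, prec3_zero, proj2_0]
@[simp] theorem ifz_S (n a b : D) : ifz (S n) a b = b := by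
  rw [ifz, PR.ifz, prec3_succ, ap_proj]; rfl

@[simp] theorem tr_Z : tr Z = Z := prec1_zero _ _
@[simp] theorem tr_S (a : D) : tr (S a) = S (ad (tr a) a) := by
  rw [tr, PR.tri, prec1_succ]
  simp only [ap2_c2, ap2_c1, proj2_0, proj2_1, ad_S]; rfl
theorem pr_eq (a b : D) : pr a b = ad (tr (ad a b)) b := by
  simp only [pr, PR.pair, ap2_c2, ap2_c1, proj2_0, proj2_1]
@[simp] theorem rt_Z : rt Z = Z := prec1_zero _ _
theorem rt_S (a : D) : rt (S a) = ifz (sb (tr (S (rt a))) (S a)) (S (rt a)) (rt a) := by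
  rw [rt, PR.root, prec1_succ]
  simp only [ap2_c2, ap2_c1, ap2_c3, proj2_0, proj2_1]; rfl
theorem Rt_eq (a : D) : Rt a = sb a (tr (rt a)) := by
  simp only [Rt, PR.right, ap1_c2, ap1_c1, proj1_0]
theorem Lf_eq (a : D) : Lf a = sb (rt a) (Rt a) := by
  simp only [Lf, PR.left, ap1_c2, ap1_c1, proj1_0]

/-- The root stays `a` on the interval from `tri a` to `tri a + a`. As long as `j + (d + 1) = a`,
the next triangular number `tri a + a + 1` exceeds `tri a + j + 1`, and the recursion for `root`
keeps its value. -/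
theorem rt_tri_add {a : D} (h : w ⊩ eqH (rt (tr a)) a) (j : D) :
    ∀ d ⦃u⦄ [Le w u], u ⊩ eqH (ad j d) a → u ⊩ eqH (rt (ad (tr a) j)) a := by
  have := ind (w := w) (P := fun j => HProp.all fun d => HProp.imp (eqH (ad j d) a)
    (eqH (rt (ad (tr a) j)) a)) ?_ ?_ j
  · simpa only [forces_all, forces_imp] using this
  · simp only [forces_all, forces_imp]
    intro d u _ _
    rw [ad_Z]; exact h.w
  · intro j u _ hj
    simp only [forces_all, forces_imp] at hj ⊢
    intro d u' _ hd
    have hd' : u' ⊩ eqH (ad j (S d)) a := by simpa using hd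
    have hr := hj _ hd'
    rw [ad_S, rt_S]
    refine Forces.eqSubst (P := fun r => eqH (ifz (sb (tr (S r)) (S (ad (tr a) j))) (S r) r) a)
      hr.symm ?_
    rw [tr_S, S_sb_S]
    refine Forces.eqSubst (P := fun r => eqH (ifz (sb (ad (tr a) r) (ad (tr a) j)) (S a) a) a)
      hd' ?_
    rw [← ad_assoc, ad_sb, ifz_S]
    exact forces_rfl _

/-- One step past `tri a + a` is the next triangular number; there the difference tested by `root`
is zero and the root moves on to `a + 1`. -/
theorem rt_tri (a : D) : rt (tr a) = a := by
  refine eq_of_forces fun w => ind (P := fun a => eqH (rt (tr a)) a) ?_ ?_ a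
  · simpa using forces_rfl _
  · intro a u _ ha
    have := rt_tri_add ha a Z (u := u) (by simpa using forces_rfl _)
    rw [tr_S, rt_S]
    refine Forces.eqSubst (P := fun r => eqH (ifz (sb (tr (S r)) (S (ad (tr a) a))) (S r) r) (S a))
      this.symm ?_
    rw [tr_S, S_sb_S, sb_self, ifz_Z]
    exact forces_rfl _

theorem rt_pr (a b : D) : rt (pr a b) = ad a b := by
  refine eq_of_forces fun w => ?_
  rw [pr_eq]
  refine rt_tri_add (w := w) (forces_of_eq (rt_tri _)) b a ?_
  rw [ad_comm]; exact forces_rfl _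

@[simp] theorem Rt_pr (a b : D) : Rt (pr a b) = b := by
  rw [Rt_eq, rt_pr, pr_eq, ad_sb]
@[simp] theorem Lf_pr (a b : D) : Lf (pr a b) = a := by
  rw [Lf_eq, Rt_pr, rt_pr, ad_comm, ad_sb]
@[simp] theorem pr_Z_Z : pr Z Z = Z := by rw [pr_eq]; simp
@[simp] theorem Lf_Z : Lf Z = Z := by conv_lhs => rw [← pr_Z_Z, Lf_pr]
@[simp] theorem Rt_Z : Rt Z = Z := by conv_lhs => rw [← pr_Z_Z, Rt_pr]

/-- Every number is zero or a successor. -/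
theorem zero_or_succ (a : D) : w ⊩ HProp.or (eqH a Z) (HProp.ex fun b => eqH a (S b)) :=
  ind (P := fun a => HProp.or (eqH a Z) (HProp.ex fun b => eqH a (S b))) (.orL (forces_rfl _))
    (fun d _ _ _ => .orR (.exI d (forces_rfl _))) a

/-- The distance of two numbers. -/
def PR.dist : PR 2 := .c2 .add .sub (.c2 .sub (.proj 1) (.proj 0))
noncomputable abbrev dist (a b : D) : D := ap2 PR.dist a b
theorem dist_eq (a b : D) : dist a b = ad (sb a b) (sb b a) := by
  simp only [dist, PR.dist, ap2_c2, proj2_0, proj2_1]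
@[simp] theorem dist_self (a : D) : dist a a = Z := by simp [dist_eq]

theorem eq_of_dist {a b : D} (h : w ⊩ eqH (dist a b) Z) : w ⊩ eqH a b := by
  have := ind (w := w) (P := fun a => HProp.all fun b => HProp.imp (eqH (dist a b) Z) (eqH a b))
    ?_ ?_ a
  · simp only [forces_all, forces_imp] at this; exact this b h
  · simp only [forces_all, forces_imp]
    intro b u _ hb
    simp only [dist_eq, Z_sb, sb_Z, Z_ad] at hb
    exact hb.symm
  · intro a u _ ha
    simp only [forces_all, forces_imp] at ha ⊢
    intro b u1 _ hb
    refine (zero_or_succ (w := u1) b).orE ?_ ?_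
    · intro u2 _ h0
      have := Forces.eqSubst (P := fun b => eqH (dist (S a) b) Z) h0 hb.w
      simp only [dist_eq, Z_sb, sb_Z, ad_Z] at this
      exact succ_ne _ this _
    · intro u2 _ h1
      refine h1.exE fun c u3 _ hc => ?_
      have := Forces.eqSubst (P := fun b => eqH (dist (S a) b) Z) hc hb.w
      rw [dist_eq, S_sb_S, S_sb_S, ← dist_eq] at this
      exact Forces.trans ((ha c this).congr1 _) hc.symm

/-! ### The evaluator -/

theorem forces_ex {α : Type} {P Q : α → HProp} (h : w ⊩ HProp.ex P)
    (hPQ : ∀ d ⦃u⦄ [Le w u], u ⊩ P d → u ⊩ Q d) : w ⊩ HProp.ex Q :=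
  h.exE fun d u _ hd => .exI d (hPQ d hd)

theorem nm_zero : nm 0 = Z := rfl
theorem nm_succ (n : ℕ) : nm (n + 1) = S (nm n) := rfl

/-- Selection by the tag of a program. -/
noncomputable def sw (t : D) : List D → D → D
  | [], d => d
  | b :: bs, d => ifz t b (sw (pd t) bs d)

theorem ifz_of_zero {t a b : D} (h : w ⊩ eqH t Z) : w ⊩ eqH (ifz t a b) a := by
  have : w ⊩ eqH (ifz t a b) (ifz Z a b) := Forces.congr3 .ifz h (forces_rfl a) (forces_rfl b)
  rwa [ifz_Z] at this
theorem ifz_of_succ {t n a b : D} (h : w ⊩ eqH t (S n)) : w ⊩ eqH (ifz t a b) b := by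
  have : w ⊩ eqH (ifz t a b) (ifz (S n) a b) := Forces.congr3 .ifz h (forces_rfl a) (forces_rfl b)
  rwa [ifz_S] at this

theorem sw_zero (b d : D) (bs : List D) : sw Z (b :: bs) d = b := by rw [sw, ifz_Z]
theorem sw_succ (t b d : D) (bs : List D) : sw (S t) (b :: bs) d = sw t bs d := by
  rw [sw, ifz_S, pd_S]

theorem sw_nm (j : ℕ) (bs : List D) (d : D) : sw (nm j) bs d = bs.getD j d := by
  induction bs generalizing j with
  | nil => rfl
  | cons b bs ih =>
    cases j with
    | zero => rw [nm_zero, sw_zero, List.getD_cons_zero]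
    | succ j => rw [nm_succ, sw_succ, ih, List.getD_cons_succ]
theorem sw_nm_length_ad (bs : List D) (t d : D) : sw (ad (nm bs.length) t) bs d = d := by
  induction bs with
  | nil => rfl
  | cons b bs ih => rw [List.length_cons, nm_succ, S_ad, sw_succ, ih]

theorem ap1_switch (t d : PR 1) (bs : List (PR 1)) (x : D) :
    ap1 (PR.switch t bs d) x = sw (ap1 t x) (bs.map fun b => ap1 b x) (ap1 d x) := by
  induction bs generalizing t with
  | nil => rfl
  | cons b bs ih => simp only [PR.switch, ap1_c3, ih, List.map_cons, sw, ap1_c1]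

theorem sw_congr {t t' : D} (h : w ⊩ eqH t t') (bs : List D) (d : D) :
    w ⊩ eqH (sw t bs d) (sw t' bs d) := by
  induction bs generalizing t t' with
  | nil => exact forces_rfl _
  | cons b bs ih => exact Forces.congr3 _ h (forces_rfl _) (ih (h.congr1 _))

/-- A tag is an element of `D`, possibly nonstandard, and cannot be matched in Lean. Repeated use of
`zero_or_succ` splits off finitely many numerals and leaves one remaining case. -/
theorem tag_cases (n : ℕ) {t : D} {R : HProp} (h : ∀ j < n, ∀ ⦃u⦄ [Le w u], u ⊩ eqH t (nm j) → u ⊩ R)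
    (h' : ∀ t' ⦃u⦄ [Le w u], u ⊩ eqH t (ad (nm n) t') → u ⊩ R) : w ⊩ R := by
  induction n with
  | zero =>
    have := h' t (u := w)
    simp only [nm_zero, Z_ad] at this
    exact this (forces_rfl _)
  | succ n ih =>
    refine ih (fun j hj u _ hu => h j (by omega) hu) fun t' u _ ht => ?_
    refine (zero_or_succ (w := u) t').orE ?_ ?_
    · intro u1 _ h0
      refine h n (by omega) ((ht.w).trans ?_)
      simpa using Forces.congr2 .add (forces_rfl (nm n)) h0
    · intro u1 _ h1
      refine h1.exE fun t'' u2 _ h2 => h' t'' ((ht.w).trans ?_)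
      simpa [nm_succ] using Forces.congr2 .add (forces_rfl (nm n)) h2

noncomputable abbrev stepD (s : D) : D := ap1 .step s
noncomputable abbrev runD (n s : D) : D := ap2 .run n s
/-- A final state. -/
noncomputable abbrev halt (y : D) : D := pr Z (pr Z y)

/-- The states that may follow the state `⟨k, ⟨e, i⟩⟩`, in the order of the tags. -/
noncomputable def branches (k e i : D) : List D :=
  [ pr (Rt k) (pr (Lf k) i), pr k (pr Z (Rt e)), pr k (pr Z (S i)), pr k (pr Z (Lf i)),
    pr k (pr Z (Rt i)), pr (pr (Lf (Rt e)) k) (pr (Rt (Rt e)) i),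
    pr (pr (pr (nm 7) (pr (Rt (Rt e)) i)) k) (pr (Lf (Rt e)) i),
    pr (pr (pr (nm 8) i) k) (pr (Lf (Rt e)) (Rt (Rt e))), pr k (pr Z (pr (Rt e) i)),
    ifz (Rt i) (pr k (pr (Lf (Rt e)) (Lf i)))
      (pr (pr (pr (nm 8) (pr (Lf i) (pd (Rt i)))) (pr (Rt (Rt e)) k))
        (pr e (pr (Lf i) (pd (Rt i))))) ]

theorem step_eq (k e i : D) :
    stepD (pr k (pr e i)) = sw (Lf e) (branches k e i) (pr k (pr (Lf i) (Rt i))) := by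
  simp only [stepD, PR.step, ap1_switch, PR.state, PR.prog, List.map_cons, List.map_nil, ap1_c1,
    ap1_c2, ap1_c3, proj1_0, ap1_const, Lf_pr, Rt_pr, branches, nm_zero]

theorem step_of_tag {e t : D} (h : w ⊩ eqH (Lf e) t) (k i : D) :
    w ⊩ eqH (stepD (pr k (pr e i))) (sw t (branches k e i) (pr k (pr (Lf i) (Rt i)))) := by
  rw [step_eq]; exact sw_congr h _ _

@[simp] theorem run_Z (s : D) : runD Z s = s := by simp [runD, PR.run, prec2_zero]
theorem run_S (n s : D) : runD (S n) s = stepD (runD n s) := by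
  simp only [runD, PR.run, prec2_succ, ap3_c1, proj3_1]
theorem run_S' (n s : D) : runD (S n) s = runD n (stepD s) :=
  rec_unique (fun n => runD (S n) s) (fun n => runD n (stepD s)) (fun _ x => stepD x)
    (by simp [run_S]) (fun _ => run_S _ _) (fun _ => run_S _ _) n
theorem run_ad (m n s : D) : runD (ad m n) s = runD n (runD m s) :=
  rec_unique (fun n => runD (ad m n) s) (fun n => runD n (runD m s)) (fun _ x => stepD x)
    (by simp) (by simp [run_S]) (by simp [run_S]) n
theorem step_halt (y : D) : stepD (halt y) = halt y := by
  rw [step_eq, Lf_Z, branches, sw_zero, Lf_Z, Rt_Z]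
@[simp] theorem run_halt (n y : D) : runD n (halt y) = halt y :=
  rec_unique (fun n => runD n (halt y)) (fun _ => halt y) (fun _ x => stepD x) (by simp)
    (fun _ => run_S _ _) (fun _ => (step_halt y).symm) n

/-- The state `t` is reached from the state `s`. -/
noncomputable def Reach (s t : D) : HProp := HProp.ex fun m => eqH (runD m s) t

theorem Reach.refl (s : D) : w ⊩ Reach s s := .exI Z (by rw [run_Z]; exact forces_rfl _)

theorem Reach.trans {r s t : D} (h : w ⊩ Reach r s) (h' : w ⊩ Reach s t) : w ⊩ Reach r t := by
  refine h.exE fun m u1 _ hm => Forces.exE h'.w fun n u2 _ hn => .exI (ad m n) ?_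
  rw [run_ad]
  exact (Forces.congr2 .run (forces_rfl n) hm.w).trans hn

theorem Reach.step {r s t : D} (h : w ⊩ eqH (stepD r) s) (h' : w ⊩ Reach s t) : w ⊩ Reach r t :=
  Reach.trans (.exI (S Z) (by rw [run_S, run_Z]; exact h)) h'

/-- In every context, the evaluation of `e` on `i` yields the output `a`. -/
noncomputable def Ev (e i a : D) : HProp :=
  HProp.all fun k => Reach (pr k (pr e i)) (pr (Rt k) (pr (Lf k) a))

section
variable {X : Type} [Env X]
instance (e i : X → D) [DefT e] [DefT i] : DefP (fun x => Reach (e x) (i x)) := by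
  unfold Reach; infer_instance
instance (e i o : X → D) [DefT e] [DefT i] [DefT o] : DefP (fun x => Ev (e x) (i x) (o x)) := by
  unfold Ev; infer_instance
end

theorem Forces.evAt {e i a : D} (h : w ⊩ Ev e i a) (k : D) :
    w ⊩ Reach (pr k (pr e i)) (pr (Rt k) (pr (Lf k) a)) := h k

theorem ev_pop {e i : D} (h : w ⊩ eqH (Lf e) Z) : w ⊩ Ev e i i := fun k =>
  Reach.step (step_of_tag h k i) (by rw [branches, sw_zero]; exact Reach.refl _)

theorem ev_same {e i e' i' a : D}
    (h : ∀ k, w ⊩ eqH (stepD (pr k (pr e i))) (pr k (pr e' i'))) (h' : w ⊩ Ev e' i' a) :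
    w ⊩ Ev e i a := fun k => Reach.step (h k) (h' k)

theorem ev_push {e i e' i' f a b : D}
    (h : ∀ k, w ⊩ eqH (stepD (pr k (pr e i))) (pr (pr f k) (pr e' i'))) (h1 : w ⊩ Ev e' i' a)
    (h2 : w ⊩ Ev f a b) : w ⊩ Ev e i b := fun k => by
  have := h1.evAt (pr f k)
  rw [Lf_pr, Rt_pr] at this
  exact Reach.step (h k) (Reach.trans this (h2 k))

theorem ev_push2 {e i e' i' f g a b c : D}
    (h : ∀ k, w ⊩ eqH (stepD (pr k (pr e i))) (pr (pr f (pr g k)) (pr e' i')))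
    (h1 : w ⊩ Ev e' i' a) (h2 : w ⊩ Ev f a b) (h3 : w ⊩ Ev g b c) : w ⊩ Ev e i c := fun k => by
  have h1 := h1.evAt (pr f (pr g k))
  have h2 := h2.evAt (pr g k)
  rw [Lf_pr, Rt_pr] at h1 h2
  exact Reach.step (h k) (Reach.trans h1 (Reach.trans h2 (h3 k)))

/-! ### Decomposition of runs along the stack -/

/-- The statement that every halting evaluation decomposes along the stack. -/
noncomputable def Frame (N : D) : HProp :=
  HProp.all fun e => HProp.all fun i => HProp.all fun s => HProp.all fun y =>
    HProp.imp (eqH (runD N (pr s (pr e i))) (halt y))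
      (HProp.ex fun a => HProp.and (Ev e i a) (eqH (runD N (pr (Rt s) (pr (Lf s) a))) (halt y)))

section
variable {N e i s y : D}

instance : Def1 Frame := by
  unfold Frame; infer_instance

theorem Frame.out (h : w ⊩ Frame N) (h' : w ⊩ eqH (runD N (pr s (pr e i))) (halt y)) :
    w ⊩ HProp.ex fun a => HProp.and (Ev e i a) (eqH (runD N (pr (Rt s) (pr (Lf s) a))) (halt y)) := by
  simp only [Frame, forces_all, forces_imp] at h
  exact h e i s y h'

/-- Final states are fixed by `step`, so a number of steps is only an upper bound. Hence the same
`N` may occur in the premise and in the conclusion of `Frame`. -/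
theorem halts_succ {t : D} (h : w ⊩ eqH (runD N t) (halt y)) : w ⊩ eqH (runD (S N) t) (halt y) := by
  rw [run_S]
  have : w ⊩ eqH (stepD (runD N t)) (stepD (halt y)) := h.congr1 .step
  rwa [step_halt] at this

theorem halts_step {t t' : D} (h : w ⊩ eqH (runD (S N) t) (halt y)) (ht : w ⊩ eqH (stepD t) t') :
    w ⊩ eqH (runD N t') (halt y) := by
  rw [run_S'] at h
  exact (Forces.congr2 .run (forces_rfl N) ht.symm).trans h

theorem frame_same {e' i' : D} (hN : w ⊩ Frame N)
    (h : w ⊩ eqH (runD (S N) (pr s (pr e i))) (halt y))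
    (hs : ∀ k, w ⊩ eqH (stepD (pr k (pr e i))) (pr k (pr e' i'))) :
    w ⊩ HProp.ex fun a => HProp.and (Ev e i a)
      (eqH (runD (S N) (pr (Rt s) (pr (Lf s) a))) (halt y)) :=
  (Frame.out hN (halts_step h (hs s))).exE fun a u _ ha =>
    .exI a ⟨ev_same (fun k => (hs k).w) ha.1, halts_succ ha.2⟩

theorem frame_push {e' i' f : D} (hN : w ⊩ Frame N)
    (h : w ⊩ eqH (runD (S N) (pr s (pr e i))) (halt y))
    (hs : ∀ k, w ⊩ eqH (stepD (pr k (pr e i))) (pr (pr f k) (pr e' i'))) :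
    w ⊩ HProp.ex fun a => HProp.and (Ev e i a)
      (eqH (runD (S N) (pr (Rt s) (pr (Lf s) a))) (halt y)) := by
  refine (Frame.out hN (halts_step h (hs s))).exE fun a u _ ha => ?_
  rw [Lf_pr, Rt_pr] at ha
  refine (Frame.out hN.w ha.2).exE fun b u1 _ hb => .exI b ⟨?_, halts_succ hb.2⟩
  exact ev_push (fun k => (hs k).w) ha.1.w hb.1

theorem frame_push2 {e' i' f g : D} (hN : w ⊩ Frame N)
    (h : w ⊩ eqH (runD (S N) (pr s (pr e i))) (halt y))
    (hs : ∀ k, w ⊩ eqH (stepD (pr k (pr e i))) (pr (pr f (pr g k)) (pr e' i'))) :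
    w ⊩ HProp.ex fun a => HProp.and (Ev e i a)
      (eqH (runD (S N) (pr (Rt s) (pr (Lf s) a))) (halt y)) := by
  refine (Frame.out hN (halts_step h (hs s))).exE fun a u _ ha => ?_
  rw [Lf_pr, Rt_pr] at ha
  refine (Frame.out hN.w ha.2).exE fun b u1 _ hb => ?_
  rw [Lf_pr, Rt_pr] at hb
  refine (Frame.out hN.w hb.2).exE fun c u2 _ hc => .exI c ⟨?_, halts_succ hc.2⟩
  exact ev_push2 (fun k => (hs k).w) ha.1.w hb.1.w hc.1

theorem frame_zero (h : w ⊩ eqH (runD Z (pr s (pr e i))) (halt y)) :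
    w ⊩ HProp.ex fun a => HProp.and (Ev e i a) (eqH (runD Z (pr (Rt s) (pr (Lf s) a))) (halt y)) := by
  rw [run_Z] at h
  have hs : w ⊩ eqH s Z := by simpa using h.congr1 .left
  have h2 : w ⊩ eqH (pr e i) (pr Z y) := by simpa using h.congr1 .right
  have he : w ⊩ eqH e Z := by simpa using h2.congr1 .left
  have hi : w ⊩ eqH i y := by simpa using h2.congr1 .right
  -- A run of no steps starts in a final state, so `s` and `e` are zero; since `0 = ⟨0, 0⟩`, popping
  -- leads to a final state with the same output.
  refine .exI i ⟨ev_pop (by simpa using he.congr1 .left), ?_⟩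
  rw [run_Z]
  refine Forces.congr2 _ (by simpa using hs.congr1 .right)
    (Forces.congr2 _ (by simpa using hs.congr1 .left) hi)

/-- One step pops the stack, keeps it, or pushes one or two programs. The remaining run has `N`
steps, so the induction hypothesis applies to it, and then once more for each pushed program; the
evaluations so obtained are composed. -/
theorem frame_succ (hN : w ⊩ Frame N) (h : w ⊩ eqH (runD (S N) (pr s (pr e i))) (halt y)) :
    w ⊩ HProp.ex fun a => HProp.and (Ev e i a)
      (eqH (runD (S N) (pr (Rt s) (pr (Lf s) a))) (halt y)) := by
  refine tag_cases 10 (t := Lf e) ?_ ?_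
  · intro j hj u _ ht
    have hs := fun k => step_of_tag ht k i
    interval_cases j <;>
      simp only [sw_nm, branches, List.getD_cons_succ, List.getD_cons_zero] at hs
    · refine .exI i ⟨ev_pop ht, halts_succ (halts_step h.w (hs s))⟩
    · exact frame_same hN.w h.w hs
    · exact frame_same hN.w h.w hs
    · exact frame_same hN.w h.w hs
    · exact frame_same hN.w h.w hs
    · exact frame_push hN.w h.w hs
    · exact frame_push hN.w h.w hs
    · exact frame_push hN.w h.w hs
    · exact frame_same hN.w h.w hs
    · refine (zero_or_succ (w := u) (Rt i)).orE ?_ ?_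
      · intro u1 _ h0
        refine frame_same (e' := Lf (Rt e)) (i' := Lf i) hN.w h.w fun k => ((hs k).w).trans (ifz_of_zero h0)
      · intro u1 _ h1
        refine h1.exE fun n u2 _ h2 => ?_
        refine frame_push2 (e' := e) (i' := pr (Lf i) (pd (Rt i))) (f := pr (nm 8) (pr (Lf i) (pd (Rt i)))) (g := Rt (Rt e)) hN.w h.w fun k => ((hs k).w).trans (ifz_of_succ h2)
  · intro t' u _ ht
    have hs := fun k => step_of_tag ht k i
    exact frame_same hN.w h.w fun k => by
      have := hs k
      rwa [show (10 : ℕ) = (branches k e i).length from rfl, sw_nm_length_ad] at this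

theorem frame (N : D) : w ⊩ Frame N := by
  refine ind (P := Frame) ?_ ?_ N
  · simp only [Frame, forces_all, forces_imp]
    intro e i s y u _ h
    exact frame_zero h
  · intro N u _ hN
    rw [Frame]
    simp only [forces_all, forces_imp]
    intro e i s y u _ h
    exact frame_succ hN.w h

end

/-! ### Application -/

/-- The program `e` on the input `i` has the output `a`. -/
noncomputable def App (e i a : D) : HProp := atA e i fun y => eqH y a

instance {X : Type} [Env X] (e i o : X → D) [DefT e] [DefT i] [DefT o] :
    DefP (fun x => App (e x) (i x) (o x)) := by
  unfold App; infer_instance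

/-- `App` speaks of the empty stack only, whereas programs are composed on arbitrary stacks. `frame`
for the empty stack yields an evaluation `Ev`, and the state after popping is final, which
identifies the output. -/
theorem Forces.ev {e i a : D} (h : w ⊩ App e i a) : w ⊩ Ev e i a := by
  refine Forces.exE h fun o u _ ho => ?_
  refine (Frame.out (frame (Lf o)) ho.1).exE fun b u1 _ hb => ?_
  have h2 := hb.2
  rw [Lf_Z, Rt_Z, run_halt] at h2
  have h3 : u1 ⊩ eqH b (Rt o) := by simpa using (h2.congr1 .right).congr1 .right
  exact Forces.eqSubst (P := fun a => Ev e i a) (h3.trans ho.2.w) hb.1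

theorem Forces.app {e i a : D} (h : w ⊩ Ev e i a) : w ⊩ App e i a := by
  have := h.evAt Z
  rw [Lf_Z, Rt_Z] at this
  refine Forces.exE this fun m u _ hm => .exI (pr m a) ⟨?_, ?_⟩
  · simpa [KT] using hm
  · simpa using forces_rfl _

/-- Both computations are continued to the sum of their lengths, which does not change the final
states. -/
theorem Forces.unique {e i a b : D} (h : w ⊩ App e i a) (h' : w ⊩ App e i b) : w ⊩ eqH a b := by
  refine Forces.exE h fun o u _ ho => Forces.exE h'.w fun o' u1 _ ho' => ?_
  have h1 : u ⊩ eqH (runD (Lf o') (runD (Lf o) (pr Z (pr e i)))) (runD (Lf o') (halt (Rt o))) :=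
    Forces.congr2 .run (forces_rfl (Lf o')) ho.1
  have h2 : u1 ⊩ eqH (runD (Lf o) (runD (Lf o') (pr Z (pr e i)))) (runD (Lf o) (halt (Rt o'))) :=
    Forces.congr2 .run (forces_rfl (Lf o)) ho'.1
  rw [run_halt, ← run_ad] at h1 h2
  rw [ad_comm] at h2
  have h3 := h1.w.symm.trans h2
  have h4 : u1 ⊩ eqH (Rt o) (Rt o') := by simpa using (h3.congr1 .right).congr1 .right
  exact (ho.2.w.symm.trans h4).trans ho'.2

theorem Forces.appCongr {e e' i i' a a' : D} (h : w ⊩ App e i a) (he : w ⊩ eqH e e') (hi : w ⊩ eqH i i')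
    (ha : w ⊩ eqH a a') : w ⊩ App e' i' a' :=
  Forces.eqSubst (P := fun x => App e' i' x) ha (Forces.eqSubst (P := fun x => App e' x a) hi
    (Forces.eqSubst (P := fun x => App x i a) he h))

section
variable {e i a b c f g p m : D}

theorem app_id : w ⊩ App (pr (nm 0) p) i i := Forces.app (ev_pop (by rw [Lf_pr]; exact forces_rfl _))

theorem step_tag (n : ℕ) (p k i : D) : stepD (pr k (pr (pr (nm n) p) i)) =
    sw (nm n) (branches k (pr (nm n) p) i) (pr k (pr (Lf i) (Rt i))) := by
  rw [step_eq, Lf_pr]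

theorem ev_ret {e i a : D} (h : ∀ k, stepD (pr k (pr e i)) = pr k (pr Z a)) : w ⊩ Ev e i a :=
  ev_same (fun k => forces_of_eq (h k)) (ev_pop (by rw [Lf_Z]; exact forces_rfl _))

theorem app_const : w ⊩ App (pr (nm 1) p) i p := Forces.app <| ev_ret fun k => by
  rw [step_tag]; simp only [sw_nm, branches, List.getD_cons_succ, List.getD_cons_zero, Rt_pr]
theorem app_succ : w ⊩ App (pr (nm 2) p) i (S i) := Forces.app <| ev_ret fun k => by
  rw [step_tag]; simp only [sw_nm, branches, List.getD_cons_succ, List.getD_cons_zero]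
theorem app_left : w ⊩ App (pr (nm 3) p) i (Lf i) := Forces.app <| ev_ret fun k => by
  rw [step_tag]; simp only [sw_nm, branches, List.getD_cons_succ, List.getD_cons_zero]
theorem app_right : w ⊩ App (pr (nm 4) p) i (Rt i) := Forces.app <| ev_ret fun k => by
  rw [step_tag]; simp only [sw_nm, branches, List.getD_cons_succ, List.getD_cons_zero]
theorem ev_tag8 : w ⊩ Ev (pr (nm 8) p) i (pr p i) := ev_ret fun k => by
  rw [step_tag]; simp only [sw_nm, branches, List.getD_cons_succ, List.getD_cons_zero, Rt_pr]
theorem app_comp (hg : w ⊩ App g i a) (hf : w ⊩ App f a b) :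
    w ⊩ App (pr (nm 5) (pr f g)) i b := by
  refine Forces.app (ev_push (fun k => forces_of_eq ?_) hg.ev hf.ev)
  rw [step_tag]; simp only [sw_nm, branches, List.getD_cons_succ, List.getD_cons_zero, Rt_pr, Lf_pr]
theorem app_pair (hf : w ⊩ App f i a) (hg : w ⊩ App g i b) :
    w ⊩ App (pr (nm 6) (pr f g)) i (pr a b) := by
  refine Forces.app (ev_push (f := pr (nm 7) (pr g i)) (fun k => forces_of_eq ?_) hf.ev
    (ev_push (f := pr (nm 8) a) (fun k => forces_of_eq ?_) hg.ev ev_tag8))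
  · rw [step_tag]; simp only [sw_nm, branches, List.getD_cons_succ, List.getD_cons_zero, Rt_pr, Lf_pr]
  · rw [step_tag]; simp only [sw_nm, branches, List.getD_cons_succ, List.getD_cons_zero, Rt_pr, Lf_pr]
theorem app_prec_zero (hf : w ⊩ App f a b) : w ⊩ App (pr (nm 9) (pr f g)) (pr a Z) b := by
  refine Forces.app (ev_same (fun k => forces_of_eq ?_) hf.ev)
  rw [step_tag]
  simp only [sw_nm, branches, List.getD_cons_succ, List.getD_cons_zero, Rt_pr, Lf_pr, ifz_Z]
theorem app_prec_succ (h : w ⊩ App (pr (nm 9) (pr f g)) (pr a m) c)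
    (hg : w ⊩ App g (pr (pr a m) c) b) : w ⊩ App (pr (nm 9) (pr f g)) (pr a (S m)) b := by
  refine Forces.app (ev_push2 (f := pr (nm 8) (pr a m)) (fun k => forces_of_eq ?_) h.ev ev_tag8 hg.ev)
  rw [step_tag]
  simp only [sw_nm, branches, List.getD_cons_succ, List.getD_cons_zero, Rt_pr, Lf_pr, ifz_S, pd_S]
theorem app_univ (h : w ⊩ App e i a) : w ⊩ App (pr (nm 10) p) (pr e i) a := by
  refine Forces.app (ev_same (fun k => forces_of_eq ?_) h.ev)
  rw [step_tag]
  simp only [sw_nm, branches, List.getD_cons_succ, List.getD_cons_zero, List.getD_nil, Lf_pr, Rt_pr]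
/-- The program `i ↦ f ⟨p, i⟩`. -/
noncomputable def curry (f p : D) : D := pr (nm 5) (pr f (pr (nm 8) p))
theorem app_curry (h : w ⊩ App f (pr p i) a) : w ⊩ App (curry f p) i a := app_comp ev_tag8.app h

end

/-! ### Programs for the primitive recursive functions -/

/-- The code of a tuple. -/
noncomputable def tup : {n : ℕ} → (Fin n → D) → D
  | 0, _ => Z
  | _ + 1, a => pr (a 0) (tup fun i => a i.succ)

namespace PR

/-- The program, with a code for every component, that computes a tuple. -/
def tupleCode : {m : ℕ} → (Fin m → PR 0) → PR 0
  | 0, _ => prog 1 (const 0)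
  | _ + 1, c => prog 6 (c2 pair (c 0) (tupleCode fun i => c i.succ))

/-- The program for the projection of a tuple. -/
def projCode : ℕ → PR 0
  | 0 => prog 3 (const 0)
  | i + 1 => prog 5 (c2 pair (projCode i) (prog 4 (const 0)))

/-- Composition of programs. -/
def compCode (f g : PR 0) : PR 0 := prog 5 (c2 pair f g)
/-- Pairing of programs. -/
def pairCode (f g : PR 0) : PR 0 := prog 6 (c2 pair f g)
/-- The left projection. -/
def leftCode : PR 0 := prog 3 (const 0)
/-- The right projection. -/
def rightCode : PR 0 := prog 4 (const 0)

/-- A program for a primitive recursive function, with the tuple of the arguments as its input. -/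
def code : {n : ℕ} → PR n → PR 0
  | _, zero => prog 1 (const 0)
  | _, succ => compCode (prog 2 (const 0)) leftCode
  | _, proj i => projCode i
  | _, comp f g => compCode (code f) (tupleCode fun i => code (g i))
  | _, prec f g =>
    compCode (prog 9 (c2 pair (code f) (compCode (code g)
      (pairCode (compCode rightCode leftCode)
        (pairCode rightCode (compCode leftCode leftCode)))))) (pairCode rightCode leftCode)

end PR

section
variable {i a b : D} {f g : PR 0}

theorem ap0_c2 (f : PR 2) (a b : PR 0) : ap0 (.c2 f a b) = ap2 f (ap0 a) (ap0 b) := ap_c2 ..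
theorem ap0_const (k : ℕ) : ap0 (.const k) = nm k := ap_const _ _
theorem ap0_prog (k : ℕ) (p : PR 0) : ap0 (.prog k p) = pr (nm k) (ap0 p) := by
  rw [PR.prog, ap0_c2, ap0_const]

theorem app_compCode (hg : w ⊩ App (ap0 g) i a) (hf : w ⊩ App (ap0 f) a b) :
    w ⊩ App (ap0 (.compCode f g)) i b := by
  rw [PR.compCode, ap0_prog, ap0_c2]; exact app_comp hg hf
theorem app_pairCode (hf : w ⊩ App (ap0 f) i a) (hg : w ⊩ App (ap0 g) i b) :
    w ⊩ App (ap0 (.pairCode f g)) i (pr a b) := by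
  rw [PR.pairCode, ap0_prog, ap0_c2]; exact app_pair hf hg
theorem app_leftCode : w ⊩ App (ap0 .leftCode) (pr a b) a := by
  rw [PR.leftCode, ap0_prog]; simpa using app_left (w := w) (i := pr a b)
theorem app_rightCode : w ⊩ App (ap0 .rightCode) (pr a b) b := by
  rw [PR.rightCode, ap0_prog]; simpa using app_right (w := w) (i := pr a b)

theorem app_tupleCode {m : ℕ} {c : Fin m → PR 0} {d : Fin m → D}
    (h : ∀ j, w ⊩ App (ap0 (c j)) i (d j)) : w ⊩ App (ap0 (.tupleCode c)) i (tup d) := by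
  induction m with
  | zero => rw [PR.tupleCode, ap0_prog, ap0_const, tup]; exact app_const
  | succ m ih =>
    rw [PR.tupleCode, ap0_prog, ap0_c2, tup]
    exact app_pair (h 0) (ih fun j => h j.succ)

theorem app_projCode {n : ℕ} (j : Fin n) (d : Fin n → D) : w ⊩ App (ap0 (.projCode j)) (tup d) (d j) := by
  induction n with
  | zero => exact j.elim0
  | succ n ih =>
    rw [tup]
    induction j using Fin.cases with
    | zero => exact app_leftCode
    | succ j =>
      rw [Fin.val_succ, PR.projCode]
      exact app_compCode (g := .rightCode) app_rightCode (ih j fun i => d i.succ)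

end

theorem defT_ap {X : Type} [Env X] {n : ℕ} (f : PR n) (a : Fin n → X → D) (h : ∀ i, DefT (a i)) :
    DefT fun x => ap f fun i => a i x := by
  choose t ht using fun i => (h i).ex
  exact ⟨.fn f t, fun x => by rw [Tm.eval]; simp only [ht]⟩

theorem app_code {n : ℕ} (f : PR n) : ∀ {w : List Fm} (d : Fin n → D), w ⊩ App (ap0 f.code) (tup d) (ap f d) := by
  induction f with
  | zero =>
    intro w d
    rw [PR.code, ap0_prog, ap0_const, ap_vec0]; exact app_const
  | succ =>
    intro w d
    rw [PR.code, tup, ap_vec1]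
    exact app_compCode app_leftCode (by rw [ap0_prog]; exact app_succ)
  | proj i => intro w d; rw [ap_proj]; exact app_projCode i d
  | comp f g hf hg =>
    intro w d
    rw [ap_comp]
    exact app_compCode (app_tupleCode fun i => hg i d) (hf _)
  | @prec n f g hf hg =>
    intro w d
    obtain ⟨m, a, rfl⟩ : ∃ m a, d = Fin.cons m a := ⟨d 0, fun i => d i.succ, by
      funext i; induction i using Fin.cases <;> rfl⟩
    refine app_compCode (a := pr (tup a) m) (app_pairCode ?_ ?_) ?_
    · rw [tup]; exact app_rightCode
    · rw [tup]; exact app_leftCode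
    · rw [ap0_prog, ap0_c2]
      -- Induction on the recursion argument needs the value to be definable as a function of `m`,
      -- with the other arguments as parameters.
      have := defT_ap (X := Unit × D) (PR.prec f g) (Fin.cons (fun p => p.2) fun i _ => a i)
        (fun i => by induction i using Fin.cases <;> simp only [Fin.cons_zero, Fin.cons_succ] <;> infer_instance)
      have e : (fun x : Unit × D => ap (PR.prec f g) fun i =>
          (Fin.cons (fun p => p.2) (fun i _ => a i) : Fin (n + 1) → Unit × D → D) i x) =
          fun x => ap (PR.prec f g) (Fin.cons x.2 a) := by
        funext x; congr 1; funext i; induction i using Fin.cases <;> rfl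
      rw [e] at this
      refine ind (P := fun m => App (pr (nm 9) (pr (ap0 f.code) (ap0 (PR.compCode g.code
        (PR.pairCode (PR.compCode .rightCode .leftCode)
        (PR.pairCode .rightCode (PR.compCode .leftCode .leftCode))))))) (pr (tup a) m)
          (ap (PR.prec f g) (Fin.cons m a))) ?_ ?_ m
      · rw [ap_prec_zero]; exact app_prec_zero (hf a)
      · intro m u _ hu
        rw [ap_prec_succ]
        refine app_prec_succ hu (app_compCode (app_pairCode (app_compCode app_leftCode app_rightCode)
          (app_pairCode app_rightCode (app_compCode app_leftCode app_leftCode))) ?_)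
        exact hg (Fin.cons m (Fin.cons _ a))

/-! ### Programs for definable functions -/

/-- The empty context, without parameters. -/
inductive Nil : Type
  | mk

noncomputable instance : Env Nil := ⟨fun _ _ => Z⟩

/-- Terms in two variables as function symbols. -/
def Tm.toPR : Tm → PR 2
  | .var 0 => .proj 1
  | .var 1 => .proj 0
  | .var (_ + 2) => .const 0
  | .fn f ts => .comp f fun i => (ts i).toPR

theorem ap_toPR (t : Tm) (x y : D) :
    ap2 t.toPR x y = t.eval (Env.enc (X := (Nil × D) × D) ((.mk, x), y)) := by
  induction t with
  | var n =>
    rcases n with _ | _ | n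
    · exact proj2_1 _ _
    · exact proj2_0 _ _
    · exact ap2_const _ _ _
  | fn f ts ih => rw [toPR, ap2, ap_comp, Tm.eval]; exact congrArg _ (funext ih)

theorem exists_PR2 (F : D → D → D) [h : DefT fun p : (Nil × D) × D => F p.1.2 p.2] :
    ∃ f : PR 2, ∀ x y, ap2 f x y = F x y :=
  let ⟨t, ht⟩ := h.ex
  ⟨t.toPR, fun x y => (ap_toPR t x y).trans (ht ((.mk, x), y))⟩

theorem exists_PR1 (F : D → D) [h : DefT fun p : Nil × D => F p.2] :
    ∃ f : PR 1, ∀ x, ap1 f x = F x := by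
  obtain ⟨t, ht⟩ := h.ex
  refine ⟨.c2 t.toPR (.const 0) (.proj 0), fun x => ?_⟩
  rw [ap1_c2, ap_toPR, proj1_0, ← ht (.mk, x)]
  congr 1; funext n; rcases n with _ | _ | n
  · rfl
  · exact ap1_const _ _
  · rfl

/-- A program for the definable function `F`, with the pair of the arguments as its input. -/
noncomputable def fnc (F : D → D → D) [DefT fun p : (Nil × D) × D => F p.1.2 p.2] : D :=
  ap0 (.compCode (exists_PR2 F).choose.code
    (.pairCode .leftCode (.pairCode .rightCode (.prog 1 (.const 0)))))

section
variable {F : D → D → D} [DefT fun p : (Nil × D) × D => F p.1.2 p.2]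

theorem app_fnc (x y : D) : w ⊩ App (fnc F) (pr x y) (F x y) := by
  have h := (exists_PR2 F).choose_spec x y
  rw [fnc]
  refine app_compCode (app_pairCode app_leftCode (app_pairCode app_rightCode ?_)) ?_ (a := tup ![x, y])
  · rw [ap0_prog, ap0_const]; exact app_const
  · rw [← h]; exact app_code _ _

instance {X : Type} [Env X] : DefT fun _ : X => fnc F := by unfold fnc; infer_instance
end

instance {X : Type} [Env X] (f p : X → D) [DefT f] [DefT p] : DefT fun x => curry (f x) (p x) := by
  unfold curry; infer_instance

/-- The program for `i ↦ F p i`. -/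
noncomputable def lam (F : D → D → D) [DefT fun p : (Nil × D) × D => F p.1.2 p.2] (p : D) : D :=
  curry (fnc F) p

section
variable {F : D → D → D} [DefT fun p : (Nil × D) × D => F p.1.2 p.2]
theorem app_lam (p i : D) : w ⊩ App (lam F p) i (F p i) := app_curry (app_fnc p i)
instance {X : Type} [Env X] (p : X → D) [DefT p] : DefT fun x => lam F (p x) := by
  unfold lam; infer_instance
end

/-- Constant functions. -/
noncomputable def cn (a : D) : D := pr (nm 1) a
/-- Composition of programs. -/
noncomputable def cmp (f g : D) : D := pr (nm 5) (pr f g)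
/-- Pairing of programs. -/
noncomputable def prd (f g : D) : D := pr (nm 6) (pr f g)
/-- The universal program. -/
noncomputable def univ : D := pr (nm 10) Z

section
variable {X : Type} [Env X] (f g : X → D) [DefT f] [DefT g]
instance : DefT fun x => cn (f x) := by unfold cn; infer_instance
instance : DefT fun x => cmp (f x) (g x) := by unfold cmp; infer_instance
instance : DefT fun x => prd (f x) (g x) := by unfold prd; infer_instance
instance : DefT fun _ : X => univ := by unfold univ; infer_instance
end

/-! ### An undefined program, and a True and an untrue condition -/

/-- The program `⟨t, i⟩ ↦ 1 + (curry t t) i`. -/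
noncomputable def undefBody : D :=
  cmp (pr (nm 2) Z) (cmp univ (fnc fun t i => pr (curry t t) i))
/-- A program that is undefined everywhere. -/
noncomputable def undef : D := curry undefBody undefBody

theorem ne_succ (a : D) {R : HProp} (h : w ⊩ eqH a (S a)) : w ⊩ R := by
  have : w ⊩ HProp.imp (eqH a (S a)) HProp.bot :=
    ind (P := fun a => HProp.imp (eqH a (S a)) HProp.bot)
      (forces_imp.2 fun u _ h => succ_ne Z h.symm _)
      (fun d u _ hd => forces_imp.2 fun u' _ h => forces_imp.1 hd (succ_inj h)) a
  exact (forces_imp.1 this h).elim R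

/-- Self-application gives `undef i = 1 + undef i`, so an output `a` would equal its successor by
uniqueness. -/
theorem undef_app {i a : D} {R : HProp} (h : w ⊩ App undef i a) : w ⊩ R := by
  have : w ⊩ App undef i (S a) :=
    app_curry (app_comp (app_comp (app_fnc (F := fun t i => pr (curry t t) i) undefBody i)
      (app_univ h)) app_succ)
  exact ne_succ a (h.unique this)

instance {X : Type} [Env X] : DefT fun _ : X => undef := by unfold undef undefBody; infer_instance

/-! ### Values of programs -/

section
variable {e i a : D} {P : D → HProp}

theorem Forces.atI [Def1 P] (h : w ⊩ App e i a) (hP : w ⊩ P a) : w ⊩ atA e i P :=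
  Forces.exE h fun o _ _ ho => .exI o ⟨ho.1, Forces.eqSubst (P := P) ho.2.symm hP.w⟩
theorem Forces.atE {R : HProp} (h : w ⊩ atA e i P)
    (hR : ∀ a ⦃u⦄ [Le w u], u ⊩ App e i a → u ⊩ P a → u ⊩ R) : w ⊩ R :=
  Forces.exE h fun o _ _ ho => hR (Rt o) (.exI o ⟨ho.1, forces_rfl _⟩) ho.2
theorem Forces.atD [Def1 P] (h : w ⊩ atA e i P) (ha : w ⊩ App e i a) : w ⊩ P a :=
  h.atE fun _ _ _ hb hP => Forces.eqSubst (P := P) (hb.unique ha.w) hP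
theorem Forces.dfdE {R : HProp} (h : w ⊩ dfd e i)
    (hR : ∀ a ⦃u⦄ [Le w u], u ⊩ App e i a → u ⊩ R) : w ⊩ R :=
  Forces.exE h fun o _ _ ho => hR (Rt o) (.exI o ⟨ho, forces_rfl _⟩)
theorem app_of_KT {o : D} (h : w ⊩ KT e i o) : w ⊩ App e i (Rt o) := .exI o ⟨h, forces_rfl _⟩
end

/-! ### A True and an untrue condition -/

/-- A True condition. -/
noncomputable def TT : D := XiD undef undef
/-- An untrue condition. -/
noncomputable def BB : D := OmD (cn TT)

section
variable {X : Type} [Env X]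
instance : DefT fun _ : X => TT := by unfold TT; infer_instance
instance : DefT fun _ : X => BB := by unfold BB; infer_instance
end

theorem app_cn (a i : D) : w ⊩ App (cn a) i a := app_const

/-- All clauses about `Ξ(undef, undef)` are vacuous, since `undef` has no values. -/
theorem ms_TT : w ⊩ Ms TT :=
  xi_meaning (fun _ _ _ h => h.dfdE fun _ _ _ ha => undef_app ha)
    (fun _ _ _ h _ _ => h.dfdE fun _ _ _ ha => undef_app ha)
theorem ts_TT : w ⊩ Ts TT :=
  (xi_truth ms_TT).2 fun _ _ _ h => h.atE fun _ _ _ ha _ => undef_app ha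
theorem ms_BB : w ⊩ Ms BB := om_meaning fun _ => Forces.atI (app_cn _ _) ms_TT

/-! ### The bar operator -/

theorem app_shift {f n x a : D} (h : w ⊩ App f (S (pr n x)) a) : w ⊩ App (shiftD f n) x a :=
  app_comp (app_comp ev_tag8.app app_succ) h

/-- The sequences `f` and `g` consist of the same Meaningful conditions. -/
noncomputable def Sim (f g : D) : HProp :=
  HProp.all fun s => HProp.ex fun a => HProp.and (App f s a) (HProp.and (App g s a) (Ms a))

instance {X : Type} [Env X] (f g : X → D) [DefT f] [DefT g] : DefP fun x => Sim (f x) (g x) := by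
  unfold Sim; infer_instance

section
variable {f g h : D}

theorem Forces.simE (hs : w ⊩ Sim f g) (s : D) {R : HProp}
    (hR : ∀ a ⦃u⦄ [Le w u], u ⊩ App f s a → u ⊩ App g s a → u ⊩ Ms a → u ⊩ R) : w ⊩ R :=
  Forces.exE (hs s) fun a _ _ ha => hR a ha.1 ha.2.1 ha.2.2

theorem Sim.refl (h : ∀ s, w ⊩ atA f s Ms) : w ⊩ Sim f f := fun s =>
  (h s).atE fun a _ _ ha hm => .exI a ⟨ha, ha, hm⟩
theorem Forces.simTrans (h1 : w ⊩ Sim f g) (h2 : w ⊩ Sim g h) : w ⊩ Sim f h := fun s =>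
  h1.simE s fun a _ _ ha hb hm => h2.w.simE s fun a' _ _ ha' hb' _ =>
    .exI a ⟨ha.w, hb'.appCongr (forces_rfl _) (forces_rfl _) (ha'.unique hb.w), hm.w⟩
theorem Forces.simShift (h : w ⊩ Sim f g) (n : D) : w ⊩ Sim (shiftD f n) (shiftD g n) := fun s =>
  h.simE (S (pr n s)) fun a _ _ ha hb hm => .exI a ⟨app_shift ha, app_shift hb, hm⟩
theorem Forces.simMs (hs : w ⊩ Sim f g) : w ⊩ Ms (OmD g) :=
  om_meaning fun s => hs.simE s fun _ _ _ _ hb hm => hb.atI hm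
theorem Forces.simTs (hs : w ⊩ Sim f g) {s : D} (h : w ⊩ atA g s Ts) : w ⊩ atA f s Ts :=
  hs.simE s fun _ _ _ ha hb _ => ha.atI (h.w.atD hb)

/-- Ω-induction on `f` for all `g` at once: `Sim` passes to the shifts, and the premise `f⟨⟩` True
follows from `g⟨⟩` True. Distinct programs for the same sequence have distinct codes, so this
extensionality has to be proved. -/
theorem om_ext (hs : w ⊩ Sim f g) (h : w ⊩ Ts (OmD f)) : w ⊩ Ts (OmD g) := by
  have := om_ind (w := w) (P := fun f => HProp.all fun g => HProp.imp (Sim f g) (Ts (OmD g)))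
    (fun f u _ _ ih g => forces_imp.2 fun u' _ hs => om_intro hs.simMs fun u2 _ ht n => by
      have := ih (u' := u2) (hs.w.simTs ht) n (shiftD g n)
      exact forces_imp.1 this (hs.w.simShift n)) h g
  exact forces_imp.1 this hs

/-- The axioms give only introduction and induction for Ω. Inversion follows by induction on the
premise of the introduction rule itself: if all `f⁽ⁿ⁾` satisfy that premise, then the rule makes
each `Ω(f⁽ⁿ⁾)` True. -/
theorem om_inv (h : w ⊩ Ts (OmD f)) (ht : w ⊩ atA f Z Ts) (n : D) : w ⊩ Ts (OmD (shiftD f n)) := by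
  have := om_ind (w := w) (P := fun f => HProp.and (Ms (OmD f))
      (HProp.imp (atA f Z Ts) (HProp.all fun n => Ts (OmD (shiftD f n)))))
    (fun f u _ hm ih => ⟨hm, forces_imp.2 fun u' _ ht n =>
      om_intro (ih ht n).1 fun u2 _ ht2 m => forces_imp.1 (ih (u' := u2) ht.w n).2 ht2 m⟩) h
  exact forces_imp.1 this.2 ht n
end

/-- All conditions in the constant sequence of `TT` are True, so no path is ever barred. A True
`Ω(f)` with `f` similar to this sequence would have shifts of the same kind, and Ω-induction refutes
it. -/
theorem not_BB {R : HProp} (h : w ⊩ Ts BB) : w ⊩ R := by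
  have := om_ind (w := w) (P := fun f => HProp.imp (Sim f (cn TT)) HProp.bot)
    (fun f u _ _ ih => forces_imp.2 fun u' _ hs => by
      refine forces_imp.1 (ih (u' := u') (hs.simTs ((app_cn _ _).atI ts_TT)) Z) ?_
      intro s
      exact hs.simE (S (pr Z s)) fun a u2 _ ha hb hm => .exI a ⟨app_shift ha,
        (app_cn TT s).appCongr (forces_rfl _) (forces_rfl _) ((app_cn _ _).unique hb), hm⟩) h
  exact (forces_imp.1 this (Sim.refl fun s => (app_cn _ _).atI ms_TT)).elim R

/-! ### Self-reference -/

/-- The program `self t y` applies `t` to `⟨t, y⟩` and the input. -/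
noncomputable def self (t y : D) : D := curry t (pr t y)

instance {X : Type} [Env X] (f g : X → D) [DefT f] [DefT g] : DefT fun x => self (f x) (g x) := by
  unfold self; infer_instance

/-- A program that applies the left component of `G t y i` to its right component. -/
noncomputable def fixB (G : D → D → D → D)
    [DefT fun p : (Nil × D) × D => G (Lf p.1.2) (Rt p.1.2) p.2] : D :=
  cmp univ (fnc fun x i => G (Lf x) (Rt x) i)

section
variable (G : D → D → D → D) [DefT fun p : (Nil × D) × D => G (Lf p.1.2) (Rt p.1.2) p.2]

instance {X : Type} [Env X] : DefT fun _ : X => fixB G := by unfold fixB; infer_instance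

/-- This is the recursion theorem in parametric form. `self t y` hands `t` and `y` to the program
`t`; with `t = fixB G`, the function `G` can build `self t y'` for new parameters `y'` and thus make
recursive calls. `self t y` is a primitive recursive function of `y`, whether or not the calls
terminate. -/
theorem app_self {y i a : D} {e j : D} (he : G (fixB G) y i = pr e j) (h : w ⊩ App e j a) :
    w ⊩ App (self (fixB G) y) i a := by
  refine app_curry (app_comp (app_fnc _ _) ?_)
  rw [Lf_pr, Rt_pr, he]
  exact app_univ h
end

theorem Forces.mp {P Q : HProp} (h : w ⊩ HProp.imp P Q) (h' : w ⊩ P) : w ⊩ Q := forces_imp.1 h h'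
theorem Forces.sp {P : D → HProp} (h : w ⊩ HProp.all P) (d : D) : w ⊩ P d := h d

theorem DefP.of1 {X : Type} [Env X] [hX : HasConst X] (P : D → HProp) (f : X → D) [h : Def1 P]
    [hf : DefT f] : DefP fun x => P (f x) := by
  obtain ⟨φ, hφ⟩ := h.ex
  obtain ⟨t, ht⟩ := hf.ex
  choose c hc using fun n => hX.ex (vars n)
  refine ⟨φ.subst (scons t c), fun x => ?_⟩
  rw [sem_subst, ← ht, ← hφ ((), t.eval (Env.enc x)), enc_pair]
  congr 1; funext n; cases n with
  | zero => rfl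
  | succ n => exact hc n x

/-! ### Sets built from a sequence of conditions -/

/-- The distance that vanishes if `p` consists of an input and a halting computation of `n` on it. -/
noncomputable def ktd (n p : D) : D :=
  dist (ap2 .run (Lf (Rt p)) (pr Z (pr n (Lf p)))) (pr Z (pr Z (Rt (Rt p))))
/-- The output of the computation `p`. -/
noncomputable def out' (p : D) : D := Rt (Rt p)
/-- The condition of the branch `p` of the tree `n`, as a program and its input. -/
noncomputable def ch (τ n p : D) : D := ifz (ktd n p) (pr τ (Rt (out' p))) (pr (cn BB) Z)
/-- The subtree of the branch `p`. -/
noncomputable def nx (p : D) : D := Lf (out' p)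
/-- The True condition. -/
noncomputable def rootC : D := pr (cn TT) Z

/-- The program that yields, at the sequence `s`, the condition at the end of the path `s` in the tree
with the root condition `c` and the branches `n`, in the form for `fixB` with `y = ⟨τ, ⟨c, n⟩⟩`. -/
noncomputable def seqG (t y s : D) : D :=
  ifz s (pr (Lf (Lf (Rt y))) (Rt (Lf (Rt y))))
    (pr (self t (pr (Lf y) (pr (ch (Lf y) (Rt (Rt y)) (Lf (pd s))) (nx (Lf (pd s))))))
      (Rt (pd s)))

section
variable {X : Type} [Env X] (a b c : X → D) [DefT a] [DefT b] [DefT c]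
instance : DefT fun x => ktd (a x) (b x) := by unfold ktd; infer_instance
instance : DefT fun x => out' (a x) := by unfold out'; infer_instance
instance : DefT fun x => ch (a x) (b x) (c x) := by unfold ch; infer_instance
instance : DefT fun x => nx (a x) := by unfold nx; infer_instance
instance : DefT fun _ : X => rootC := by unfold rootC; infer_instance
instance : DefT fun x => seqG (a x) (b x) (c x) := by unfold seqG; infer_instance
end

/-- The conditions along the paths of a tree. -/
noncomputable def F (τ c n : D) : D := self (fixB seqG) (pr τ (pr c n))

/-- The program of the set with the tree `n`. -/
noncomputable def setG (t y p : D) : D :=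
  pr (prd (cn (self t (pr (Lf y) (nx p))))
    (cmp (Lf (ch (Lf y) (Rt y) p)) (cn (Rt (ch (Lf y) (Rt y) p))))) Z

section
variable {X : Type} [Env X] (a b c : X → D) [DefT a] [DefT b] [DefT c]
instance : DefT fun x => F (a x) (b x) (c x) := by unfold F; infer_instance
instance : DefT fun x => setG (a x) (b x) (c x) := by unfold setG; infer_instance
end

/-- The set with the tree `n`. -/
noncomputable def St (τ n : D) : D := self (fixB setG) (pr τ n)

section
variable {X : Type} [Env X] (a b : X → D) [DefT a] [DefT b]
instance : DefT fun x => St (a x) (b x) := by unfold St; infer_instance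
end

/-- The set of all sets that can be built from `τ`. -/
noncomputable def Vt (τ : D) : D := lam (fun τ n => pr (St τ n) (OmD (F τ rootC n))) τ

instance {X : Type} [Env X] (a : X → D) [DefT a] : DefT fun x => Vt (a x) := by
  unfold Vt; infer_instance

/-- `c` consists of a program and an input for which it yields a Meaningful condition. -/
noncomputable def Good (c : D) : HProp := atA (Lf c) (Rt c) Ms
/-- The condition is True. -/
noncomputable def CT (c : D) : HProp := atA (Lf c) (Rt c) Ts
/-- The tree `n` is well-founded. -/
noncomputable def A (τ n : D) : HProp := Ts (OmD (F τ rootC n))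
/-- `τ` is a sequence of Meaningful conditions. -/
noncomputable def MSeq (τ : D) : HProp := HProp.all fun n => atA τ n Ms

section
variable {X : Type} [Env X] (a b : X → D) [DefT a] [DefT b]
instance : DefP fun x => Good (a x) := by unfold Good; infer_instance
instance : DefP fun x => CT (a x) := by unfold CT; infer_instance
instance : DefP fun x => A (a x) (b x) := by unfold A; infer_instance
instance : DefP fun x => MSeq (a x) := by unfold MSeq; infer_instance
end

/-! ### Conditions of branches -/

section
variable {τ n p c s : D} {R : HProp}

/-- Whether `p` contains a halting computation is decided by a primitive recursive distance. This is
the case distinction behind all statements about branches: a genuine condition of `τ`, or `BB`. -/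
theorem KT_or (n p : D) : w ⊩ HProp.or (KT n (Lf p) (Rt p)) (HProp.ex fun d => eqH (ktd n p) (S d)) :=
  (zero_or_succ (ktd n p)).orE (fun u _ h => .orL (eq_of_dist h)) fun u _ h => .orR h

theorem ktd_of_KT (h : w ⊩ KT n (Lf p) (Rt p)) : w ⊩ eqH (ktd n p) Z := by
  have : w ⊩ eqH (ktd n p) (dist _ _) := Forces.congr2 .dist h (forces_rfl _)
  rwa [dist_self] at this

theorem ch_of_KT (h : w ⊩ KT n (Lf p) (Rt p)) : w ⊩ eqH (ch τ n p) (pr τ (Rt (out' p))) :=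
  ifz_of_zero (ktd_of_KT h)

theorem ch_of_succ {d : D} (h : w ⊩ eqH (ktd n p) (S d)) : w ⊩ eqH (ch τ n p) (pr (cn BB) Z) :=
  ifz_of_succ h

theorem CT_of_eq {e i : D} (h : w ⊩ eqH c (pr e i)) : (w ⊩ CT c) ↔ w ⊩ atA e i Ts := by
  have e : CT (pr e i) = atA e i Ts := by rw [CT, Lf_pr, Rt_pr]
  rw [← e]
  exact ⟨fun h' => Forces.eqSubst (P := CT) h h', fun h' => Forces.eqSubst (P := CT) h.symm h'⟩

theorem Good_of_eq {e i : D} (h : w ⊩ eqH c (pr e i)) (h' : w ⊩ atA e i Ms) : w ⊩ Good c := by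
  have e : Good (pr e i) = atA e i Ms := by rw [Good, Lf_pr, Rt_pr]
  rw [← e] at h'
  exact Forces.eqSubst (P := Good) h.symm h'

theorem good_ch (hM : w ⊩ MSeq τ) (n p : D) : w ⊩ Good (ch τ n p) :=
  (KT_or n p).orE (fun u _ h => Good_of_eq (ch_of_KT h) (hM.w (Rt (out' p))))
    fun u _ h => h.exE fun d _ _ h => Good_of_eq (ch_of_succ h) ((app_cn _ _).atI ms_BB)

theorem CT_ch (h : w ⊩ KT n (Lf p) (Rt p)) : (w ⊩ CT (ch τ n p)) ↔ w ⊩ atA τ (Rt (out' p)) Ts :=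
  CT_of_eq (ch_of_KT h)

theorem Forces.chE (h : w ⊩ CT (ch τ n p))
    (hR : ∀ ⦃u⦄ [Le w u], u ⊩ KT n (Lf p) (Rt p) → u ⊩ atA τ (Rt (out' p)) Ts → u ⊩ R) : w ⊩ R := by
  refine (KT_or n p).orE ?_ ?_
  · intro u _ hk
    exact hR hk ((CT_ch hk).1 h.w)
  · intro u _ hd
    refine hd.exE fun d u1 _ hd => ?_
    exact ((CT_of_eq (ch_of_succ hd)).1 h.w).atE fun a u2 _ ha ht =>
      not_BB (Forces.eqSubst (P := Ts) (ha.unique (app_cn _ _)) ht)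

theorem good_root : w ⊩ Good rootC := Good_of_eq (forces_rfl _) ((app_cn _ _).atI ms_TT)
theorem CT_root : w ⊩ CT rootC := (CT_of_eq (forces_rfl _)).2 ((app_cn _ _).atI ts_TT)

/-! ### Conditions along paths, and well-founded trees -/

theorem app_F_zero {a : D} (h : w ⊩ App (Lf c) (Rt c) a) : w ⊩ App (F τ c n) Z a := by
  refine app_self seqG (e := Lf c) (j := Rt c) ?_ h
  simp [seqG]

theorem app_F_succ {a x : D} (h : w ⊩ App (F τ (ch τ n p) (nx p)) x a) :
    w ⊩ App (F τ c n) (S (pr p x)) a := by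
  refine app_self seqG (e := F τ (ch τ n p) (nx p)) (j := x) ?_ h
  simp [seqG, F]

theorem app_F_S {a x : D} (h : w ⊩ App (F τ (ch τ n (Lf x)) (nx (Lf x))) (Rt x) a) :
    w ⊩ App (F τ c n) (S x) a := by
  refine app_self seqG (e := F τ (ch τ n (Lf x)) (nx (Lf x))) (j := Rt x) ?_ h
  simp [seqG, F]

theorem Rt_le {x N : D} (h : w ⊩ eqH (sb x N) Z) : w ⊩ eqH (sb (Rt x) N) Z := by
  rw [Rt_eq, sb_right_comm]
  have : w ⊩ eqH (sb (sb x N) (tr (rt x))) (sb Z (tr (rt x))) := Forces.congr2 .sub h (forces_rfl _)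
  rwa [Z_sb] at this

/-- Every recursive call passes from a path to its tail, which has a smaller code, while `c` and `n`
change. Therefore the induction is on a bound `N` for the path, for all `c` and `n`; truncated
subtraction expresses `s ≤ N`. -/
theorem F_total (hM : w ⊩ MSeq τ) (hc : w ⊩ Good c) (n s : D) : w ⊩ atA (F τ c n) s Ms := by
  -- The premise `s ∸ s = 0` is the bound `s ≤ N` at `N = s`, kept in the form in which the
  -- induction delivers it.
  have key : w ⊩ HProp.all fun s => HProp.imp (eqH (sb s s) Z) (HProp.all fun c => HProp.all fun n =>
      HProp.imp (Good c) (atA (F τ c n) s Ms)) := by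
    intro s
    refine forces_all.1 (ind (w := w) (P := fun N => HProp.all fun s => HProp.imp (eqH (sb s N) Z)
      (HProp.all fun c => HProp.all fun n => HProp.imp (Good c) (atA (F τ c n) s Ms))) ?_ ?_ s) s
    · intro s
      refine forces_imp.2 fun u _ hs c n => forces_imp.2 fun u1 _ hc => ?_
      rw [sb_Z] at hs
      refine Forces.eqSubst (P := fun s => atA (F τ c n) s Ms) hs.symm.w ?_
      exact hc.atE fun a u2 _ ha hm => (app_F_zero ha).atI hm
    · intro N u _ ih s
      refine forces_imp.2 fun u1 _ hs c n => forces_imp.2 fun u2 _ hc => ?_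
      refine (zero_or_succ s).orE ?_ ?_
      · intro u3 _ h0
        refine Forces.eqSubst (P := fun s => atA (F τ c n) s Ms) h0.symm ?_
        exact hc.w.atE fun a u2 _ ha hm => (app_F_zero ha).atI hm
      · intro u3 _ h
        refine h.exE fun x u4 _ hx => ?_
        refine Forces.eqSubst (P := fun s => atA (F τ c n) s Ms) hx.symm ?_
        have h1 : u4 ⊩ eqH (sb x N) Z := by
          have : u4 ⊩ eqH (sb (S x) (S N)) Z :=
            (Forces.congr2 .sub hx.symm (forces_rfl _)).trans hs.w
          rwa [S_sb_S] at this
        have h3 := (((ih.w.sp (Rt x)).mp (Rt_le h1)).sp (ch τ n (Lf x))).sp (nx (Lf x))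
        exact (h3.mp (good_ch hM.w n (Lf x))).atE fun a u5 _ ha hm => (app_F_S ha).atI hm
  exact ((((key.sp s).mp (by rw [sb_self]; exact forces_rfl _)).sp c).sp n).mp hc

theorem F_ms (hM : w ⊩ MSeq τ) (hc : w ⊩ Good c) (n : D) : w ⊩ Ms (OmD (F τ c n)) :=
  om_meaning fun s => F_total hM hc n s

theorem F_root (hc : w ⊩ CT c) : w ⊩ atA (F τ c n) Z Ts := hc.atE fun _ _ _ ha ht => (app_F_zero ha).atI ht

theorem F_shift (hM : w ⊩ MSeq τ) : w ⊩ Sim (F τ (ch τ n p) (nx p)) (shiftD (F τ c n) p) := fun s =>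
  (F_total hM (good_ch hM n p) (nx p) s).atE fun a _ _ ha hm => .exI a ⟨ha, app_shift (app_F_succ ha), hm⟩

theorem F_shift' (hM : w ⊩ MSeq τ) : w ⊩ Sim (shiftD (F τ c n) p) (F τ (ch τ n p) (nx p)) := fun s =>
  (F_total hM (good_ch hM n p) (nx p) s).atE fun a _ _ ha hm => .exI a ⟨app_shift (app_F_succ ha), ha, hm⟩

theorem F_intro (hM : w ⊩ MSeq τ) (hc : w ⊩ Good c)
    (h : ∀ ⦃u⦄ [Le w u], u ⊩ CT c → ∀ p, u ⊩ Ts (OmD (F τ (ch τ n p) (nx p)))) :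
    w ⊩ Ts (OmD (F τ c n)) :=
  om_intro (F_ms hM hc n) fun u _ ht p => om_ext (F_shift hM.w)
    (h (hc.w.atE fun a _ _ ha _ => ha.atI (ht.w.atD (app_F_zero ha))) p)

theorem F_elim (hM : w ⊩ MSeq τ) (hc : w ⊩ CT c) (h : w ⊩ Ts (OmD (F τ c n))) (p : D) :
    w ⊩ Ts (OmD (F τ (ch τ n p) (nx p))) :=
  om_ext (F_shift' hM) (om_inv h (F_root hc) p)

/-- In the tree `n` the subtree of a branch `p` is headed by the condition of `p`, whereas `A τ (nx
p)` has the True root there. Below the roots the two agree: when the condition of `p` is True,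
`F_elim` descends one level in the one tree and `F_intro` climbs in the other. `A_elim` makes the
opposite exchange. -/
theorem A_intro (hM : w ⊩ MSeq τ) (h : ∀ p ⦃u⦄ [Le w u], u ⊩ CT (ch τ n p) → u ⊩ A τ (nx p)) :
    w ⊩ A τ n :=
  F_intro hM good_root fun u _ _ p => F_intro hM.w (good_ch hM.w n p) fun u1 _ hc p' =>
    F_elim hM.w CT_root (h p hc) p'

theorem A_elim (hM : w ⊩ MSeq τ) (h : w ⊩ A τ n) (hc : w ⊩ CT (ch τ n p)) : w ⊩ A τ (nx p) :=
  F_intro hM good_root fun u _ _ p' => F_elim hM.w hc.w (F_elim hM.w CT_root h.w p) p'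

/-- Ω-induction runs over programs `f`, whose shifts are merely similar to sequences `F τ c n`, with
other roots `c`. So the induction predicate speaks of all `c` and `n` such that `f` is similar to `F
τ c n` and `c` is True. -/
theorem A_ind (P : D → HProp) [hP : Def1 P] (hM : w ⊩ MSeq τ)
    (h : ∀ n ⦃u⦄ [Le w u], (∀ p ⦃u'⦄ [Le u u'], u' ⊩ CT (ch τ n p) → u' ⊩ P (nx p)) → u ⊩ P n)
    {u : List Fm} [Le w u] (hA : u ⊩ A τ n) : u ⊩ P n := by
  have : Def1 fun f => HProp.all fun c => HProp.all fun n =>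
      HProp.imp (Sim f (F τ c n)) (HProp.imp (CT c) (P n)) := by
    have := DefP.of1 (X := ((Unit × D) × D) × D) P fun x => x.2
    infer_instance
  have := om_ind (w := w) (P := fun f => HProp.all fun c => HProp.all fun n =>
      HProp.imp (Sim f (F τ c n)) (HProp.imp (CT c) (P n)))
    (fun f u _ _ ih c n => forces_imp.2 fun u1 _ hs => forces_imp.2 fun u2 _ hc => ?_) hA
  · exact (((this.sp rootC).sp n).mp (Sim.refl fun s => F_total hM.w good_root n s)).mp CT_root
  · refine h n fun p u3 _ hp => ?_
    have := ih (u' := u3) (hs.w.simTs (F_root hc.w)) p (ch τ n p) (nx p)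
    exact (this.mp ((hs.w.simShift p).simTrans (F_shift' hM.w))).mp hp
end

/-! ### The language of set theory in the semantics -/

/-- Bounded universal quantification. -/
noncomputable def aEl (y : D) (P : D → HProp) : HProp :=
  HProp.all fun n => HProp.all fun o =>
    HProp.imp (KT y n o) (HProp.imp (Ts (Rt (Rt o))) (P (Lf (Rt o))))
/-- Bounded existential quantification. -/
noncomputable def eEl (y : D) (P : D → HProp) : HProp :=
  HProp.ex fun n => atA y n fun d => HProp.and (Ts (Rt d)) (P (Lf d))
/-- The relation defined by `E`. -/
noncomputable def RE (E : Fm) (a b : D) : HProp := E.sem (scons a (scons b fun _ => Z))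

@[simp] theorem sem_allEl (y : Tm) (φ : Fm) (ρ : ℕ → D) :
    (allEl y φ).sem ρ = aEl (y.eval ρ) fun d => φ.sem (scons d ρ) := by
  simp [allEl, aEl, Fm.sem]
@[simp] theorem sem_exEl (y : Tm) (φ : Fm) (ρ : ℕ → D) :
    (exEl y φ).sem ρ = eEl (y.eval ρ) fun d => φ.sem (scons d ρ) := by
  simp [exEl, eEl, Fm.sem]
@[simp] theorem sem_rel (E : Fm) (s t : Tm) (ρ : ℕ → D) :
    (rel E s t).sem ρ = RE E (s.eval ρ) (t.eval ρ) := by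
  rw [rel, sem_subst, RE]; congr 1; funext n; rcases n with _ | _ | n
  · rfl
  · rfl
  · exact eval_zero ρ

section
variable {X : Type} [Env X]
instance (y : X → D) (P : X → D → HProp) [hy : DefT y] [hP : DefP fun p : X × D => P p.1 p.2] :
    DefP fun x => aEl (y x) (P x) := by
  obtain ⟨t, ht⟩ := hy.ex
  obtain ⟨φ, hφ⟩ := hP.ex
  exact ⟨allEl t φ, fun x => by rw [sem_allEl, ht]; exact congrArg _ (funext fun d => hφ (x, d))⟩
instance (y : X → D) (P : X → D → HProp) [hy : DefT y] [hP : DefP fun p : X × D => P p.1 p.2] :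
    DefP fun x => eEl (y x) (P x) := by
  obtain ⟨t, ht⟩ := hy.ex
  obtain ⟨φ, hφ⟩ := hP.ex
  exact ⟨exEl t φ, fun x => by rw [sem_exEl, ht]; exact congrArg _ (funext fun d => hφ (x, d))⟩
instance (y : X → D) (P : X → D → HProp) [hy : DefT y] [hP : DefP fun p : X × D => P p.1 p.2] :
    DefP fun x => cEnum (y x) (P x) := by
  obtain ⟨t, ht⟩ := hy.ex
  obtain ⟨φ, hφ⟩ := hP.ex
  exact ⟨condEnum t φ, fun x => by
    rw [sem_condEnum, ht]; exact congrArg _ (funext fun d => hφ (x, d))⟩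
instance (E : Fm) (a b : X → D) [ha : DefT a] [hb : DefT b] : DefP fun x => RE E (a x) (b x) := by
  obtain ⟨s, hs⟩ := ha.ex
  obtain ⟨t, ht⟩ := hb.ex
  exact ⟨rel E s t, fun x => by rw [sem_rel, hs, ht]⟩
end

noncomputable def memH (E : Fm) (s y : D) : HProp := eEl y fun d => RE E s d
noncomputable def uPair (E : Fm) (q a b : D) : HProp :=
  HProp.and (HProp.and (memH E a q) (memH E b q)) (aEl q fun d => HProp.or (RE E d a) (RE E d b))
noncomputable def oPair (E : Fm) (p a b : D) : HProp :=
  HProp.and (HProp.and (eEl p fun d => uPair E d a a) (eEl p fun d => uPair E d a b))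
    (aEl p fun d => HProp.or (uPair E d a a) (uPair E d a b))
noncomputable def relH (E : Fm) (r a b : D) : HProp := eEl r fun d => oPair E d a b
noncomputable def condsH (y τ : D) : HProp :=
  HProp.all fun n => HProp.ex fun m => iffH (atA τ m Ts) (atA y n fun d => Ts (Rt d))
noncomputable def untrueH (τ : D) : HProp := HProp.ex fun n => notH (atA τ n Ts)

section
variable (E : Fm) (s t r : Tm) (ρ : ℕ → D)
@[simp] theorem sem_mem : (mem E s t).sem ρ = memH E (s.eval ρ) (t.eval ρ) := by
  simp [mem, memH]
@[simp] theorem sem_isUPair :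
    (isUPair E r s t).sem ρ = uPair E (r.eval ρ) (s.eval ρ) (t.eval ρ) := by
  simp [isUPair, uPair, Fm.sem]
@[simp] theorem sem_isOPair :
    (isOPair E r s t).sem ρ = oPair E (r.eval ρ) (s.eval ρ) (t.eval ρ) := by
  simp [isOPair, oPair, Fm.sem]
@[simp] theorem sem_related :
    (related E r s t).sem ρ = relH E (r.eval ρ) (s.eval ρ) (t.eval ρ) := by
  simp [related, relH]
@[simp] theorem sem_meaningfulSeq : (meaningfulSeq t).sem ρ = MSeq (t.eval ρ) := by
  simp [meaningfulSeq, MSeq, Fm.sem]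
@[simp] theorem sem_hasUntrue : (hasUntrue t).sem ρ = untrueH (t.eval ρ) := by
  simp [hasUntrue, untrueH, Fm.sem]
@[simp] theorem sem_condsIn : (condsIn s t).sem ρ = condsH (s.eval ρ) (t.eval ρ) := by
  simp [condsIn, condsH, Fm.sem]
end

section
variable {X : Type} [Env X] (E : Fm) (a b c : X → D) [DefT a] [DefT b] [DefT c]
instance : DefP fun x => memH E (a x) (b x) := by unfold memH; infer_instance
instance : DefP fun x => uPair E (a x) (b x) (c x) := by unfold uPair; infer_instance
instance : DefP fun x => oPair E (a x) (b x) (c x) := by unfold oPair; infer_instance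
instance : DefP fun x => relH E (a x) (b x) (c x) := by unfold relH; infer_instance
end

/-! ### Rules for bounded quantifiers and for v-sets -/

section
variable {x y a n : D} {P : D → HProp} {R : HProp}

theorem aElI [hP : Def1 P] (h : ∀ n a ⦃u⦄ [Le w u], u ⊩ App y n a → u ⊩ Ts (Rt a) → u ⊩ P (Lf a)) :
    w ⊩ aEl y P := fun n o =>
  forces_imp.2 fun u _ hk => forces_imp.2 fun u1 _ ht => h n (Rt o) (app_of_KT hk.w) ht
theorem Forces.aElE [hP : Def1 P] (h : w ⊩ aEl y P) (ha : w ⊩ App y n a) (ht : w ⊩ Ts (Rt a)) :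
    w ⊩ P (Lf a) :=
  Forces.exE ha fun o u _ ho => by
    have h1 : u ⊩ eqH (Rt (Rt o)) (Rt a) := ho.2.congr1 .right
    have h2 : u ⊩ eqH (Lf (Rt o)) (Lf a) := ho.2.congr1 .left
    exact Forces.eqSubst (P := P) h2
      ((((h.w.sp n).sp o).mp ho.1).mp (Forces.eqSubst (P := Ts) h1.symm ht.w))
theorem eElI [hP : Def1 P] (ha : w ⊩ App y n a) (ht : w ⊩ Ts (Rt a)) (h : w ⊩ P (Lf a)) :
    w ⊩ eEl y P := by
  have := DefP.comp_snd (X := Unit) (fun _ d => P d) Lf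
  exact .exI n (ha.atI ⟨ht, h⟩)
theorem Forces.eElE (h : w ⊩ eEl y P)
    (hR : ∀ n a ⦃u⦄ [Le w u], u ⊩ App y n a → u ⊩ Ts (Rt a) → u ⊩ P (Lf a) → u ⊩ R) : w ⊩ R :=
  Forces.exE h fun n u _ hn => hn.atE fun a u1 _ ha h => hR n a ha h.1 h.2
theorem Forces.aElMono {Q : D → HProp} (h : w ⊩ aEl y P)
    (hPQ : ∀ d ⦃u⦄ [Le w u], u ⊩ P d → u ⊩ Q d) : w ⊩ aEl y Q := fun n o =>
  forces_imp.2 fun u _ hk => forces_imp.2 fun u1 _ ht =>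
    hPQ _ ((((h.w.sp n).sp o).mp hk.w).mp ht)
theorem Forces.eElMono {Q : D → HProp} (h : w ⊩ eEl y P)
    (hPQ : ∀ d ⦃u⦄ [Le w u], u ⊩ P d → u ⊩ Q d) : w ⊩ eEl y Q :=
  Forces.exE h fun n u _ hn => .exI n (forces_ex hn fun o u1 _ ho => ⟨ho.1, ho.2.1, hPQ _ ho.2.2⟩)

theorem cEnumI (h : ∀ n, w ⊩ HProp.ex fun a => HProp.and (App x n a) (HProp.and (Ms (Rt a))
      (HProp.imp (Ts (Rt a)) (P (Lf a))))) [hP : Def1 P] : w ⊩ cEnum x P := by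
  have := DefP.comp_snd (X := Unit) (fun _ d => P d) Lf
  exact fun n => (h n).exE fun a u _ ha => ha.1.atI ha.2
theorem Forces.cEnumE (h : w ⊩ cEnum x P) (n : D)
    (hR : ∀ a ⦃u⦄ [Le w u], u ⊩ App x n a → u ⊩ Ms (Rt a) → u ⊩ HProp.imp (Ts (Rt a)) (P (Lf a)) →
      u ⊩ R) : w ⊩ R :=
  (h.sp n).atE fun a u _ ha h => hR a ha h.1 h.2
theorem Forces.cEnumMono {Q : D → HProp} (h : w ⊩ cEnum x P)
    (hPQ : ∀ d ⦃u⦄ [Le w u], u ⊩ P d → u ⊩ Q d) : w ⊩ cEnum x Q := fun n =>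
  forces_ex (h.sp n) fun o u _ ho => ⟨ho.1, ho.2.1, forces_imp.2 fun u1 _ ht =>
    hPQ _ (ho.2.2.w.mp ht)⟩

/-- The axiom (V1) gives only the converse. Induction on v-sets with the strengthened predicate "is
a v-set and has v-sets as elements" inverts it. -/
theorem v_inv (h : w ⊩ Vs x) : w ⊩ cEnum x Vs := by
  have : w ⊩ HProp.and (Vs x) (cEnum x Vs) :=
    v_ind (w := w) (P := fun x => HProp.and (Vs x) (cEnum x Vs)) (fun x u _ h => by
      have h1 : u ⊩ cEnum x Vs := h.cEnumMono fun d u1 _ hd => hd.1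
      exact ⟨v_intro h1, h1⟩) h
  exact this.2

theorem Forces.aElV (h : w ⊩ cEnum x P) [hP : Def1 P] : w ⊩ aEl x P :=
  aElI fun n a u _ ha ht => by
    have := DefP.comp_snd (X := Unit) (fun _ d => P d) Lf
    exact (Forces.atD (h.w.sp n) ha).2.mp ht
end

/-! ### Extensional equality -/

/-- The formula `E` satisfies the clause of extensional equality. -/
class ExtEq (E : Fm) : Prop where
  out : IsExtEq E

section
variable {E : Fm} [hE : ExtEq E] {x y z : D}

theorem RE_iff (hx : w ⊩ Vs x) (hy : w ⊩ Vs y) : (w ⊩ RE E x y) ↔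
    (w ⊩ aEl x fun a => eEl y fun b => RE E a b) ∧ w ⊩ aEl y fun b => eEl x fun a => RE E b a := by
  have h := (der_iff_sem _).1 hE.out
  simp only [extEqClause, Fm.sem, sem_iff, sem_allEl, sem_exEl, sem_rel, eval_var, scons_zero,
    scons_one, scons_succ] at h
  have l : Le [] w := ⟨List.nil_subset _⟩
  have h1 := ((h.sp x).sp y).w (w' := w)
  have h2 := h1.mp ⟨hx, hy⟩
  exact ⟨fun h => h2.1.mp h, fun h => h2.2.mp h⟩

theorem RE_symm (hx : w ⊩ Vs x) (hy : w ⊩ Vs y) (h : w ⊩ RE E x y) : w ⊩ RE E y x :=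
  let h' := (RE_iff hx hy).1 h
  (RE_iff hy hx).2 ⟨h'.2, h'.1⟩

theorem RE_refl (hx : w ⊩ Vs x) : w ⊩ RE E x x := by
  have : w ⊩ HProp.and (Vs x) (RE E x x) :=
    v_ind (w := w) (P := fun x => HProp.and (Vs x) (RE E x x)) (fun x u _ h => by
      have h1 : u ⊩ Vs x := v_intro (h.cEnumMono fun d u1 _ hd => hd.1)
      have h2 : u ⊩ aEl x fun a => RE E a a :=
        Forces.aElV (h.cEnumMono fun d u1 _ hd => hd.2)
      have h3 : u ⊩ aEl x fun a => eEl x fun b => RE E a b :=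
        aElI fun n a u1 _ ha ht => eElI ha ht (h2.w.aElE ha ht)
      exact ⟨h1, (RE_iff h1 h1).2 ⟨h3, h3⟩⟩) hx
  exact this.2
end

/-! ### The elements of the sets built from `τ` -/

section
variable {τ n p : D} {P : D → HProp} {R : HProp}

theorem app_St {a : D} (h : w ⊩ App (Lf (ch τ n p)) (Rt (ch τ n p)) a) :
    w ⊩ App (St τ n) p (pr (St τ (nx p)) a) := by
  refine app_self setG (e := prd (cn (self (fixB setG) (pr τ (nx p))))
    (cmp (Lf (ch τ n p)) (cn (Rt (ch τ n p))))) (j := Z) ?_ ?_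
  · simp [setG]
  · exact app_pair (app_cn _ _) (app_comp (app_cn _ _) h)

theorem app_Vt : w ⊩ App (Vt τ) n (pr (St τ n) (OmD (F τ rootC n))) :=
  app_lam (F := fun τ n => pr (St τ n) (OmD (F τ rootC n))) τ n

theorem St_elI [Def1 P] (hc : w ⊩ CT (ch τ n p)) (h : w ⊩ P (St τ (nx p))) : w ⊩ eEl (St τ n) P :=
  hc.atE fun a u _ ha ht =>
    eElI (app_St ha) (by rw [Rt_pr]; exact ht) (by rw [Lf_pr]; exact h.w)

theorem St_app (hM : w ⊩ MSeq τ) {a : D} (h : w ⊩ App (St τ n) p a) :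
    (w ⊩ eqH (Lf a) (St τ (nx p))) ∧ ((w ⊩ Ts (Rt a)) ↔ w ⊩ CT (ch τ n p)) := by
  have key : w ⊩ HProp.and (eqH (Lf a) (St τ (nx p))) (iffH (Ts (Rt a)) (CT (ch τ n p))) := by
    refine (good_ch hM n p).atE fun b u _ hb hm => ?_
    have h1 := h.w.unique (app_St hb)
    have h2 : u ⊩ eqH (Lf a) (St τ (nx p)) := by simpa using h1.congr1 .left
    have h3 : u ⊩ eqH (Rt a) b := by simpa using h1.congr1 .right
    refine ⟨h2, forces_imp.2 fun u1 _ ht => hb.w.atI (Forces.eqSubst (P := Ts) h3.w ht),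
      forces_imp.2 fun u1 _ ht => Forces.eqSubst (P := Ts) h3.symm.w (Forces.atD ht hb.w)⟩
  exact ⟨key.1, fun h => key.2.1.mp h, fun h => key.2.2.mp h⟩

theorem St_aElI [Def1 P] (hM : w ⊩ MSeq τ)
    (h : ∀ p ⦃u⦄ [Le w u], u ⊩ CT (ch τ n p) → u ⊩ P (St τ (nx p))) : w ⊩ aEl (St τ n) P :=
  aElI fun p a u _ ha ht =>
    Forces.eqSubst (P := P) (St_app hM.w ha).1.symm (h p ((St_app hM.w ha).2.1 ht))

theorem Vt_elI [Def1 P] (hA : w ⊩ A τ n) (h : w ⊩ P (St τ n)) : w ⊩ eEl (Vt τ) P :=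
  eElI app_Vt (by rw [Rt_pr]; exact hA) (by rw [Lf_pr]; exact h)

theorem Vt_app {a : D} (h : w ⊩ App (Vt τ) n a) :
    (w ⊩ eqH (Lf a) (St τ n)) ∧ (w ⊩ eqH (Rt a) (OmD (F τ rootC n))) := by
  have h1 := h.unique app_Vt
  exact ⟨by simpa using h1.congr1 .left, by simpa using h1.congr1 .right⟩

theorem Vt_aElI [Def1 P] (h : ∀ n ⦃u⦄ [Le w u], u ⊩ A τ n → u ⊩ P (St τ n)) : w ⊩ aEl (Vt τ) P :=
  aElI fun n a u _ ha ht => Forces.eqSubst (P := P) (Vt_app ha).1.symm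
    (h n (Forces.eqSubst (P := Ts) (Vt_app ha).2 ht))

theorem Forces.Vt_elE [Def1 P] (h : w ⊩ eEl (Vt τ) P)
    (hR : ∀ n ⦃u⦄ [Le w u], u ⊩ A τ n → u ⊩ P (St τ n) → u ⊩ R) : w ⊩ R :=
  h.eElE fun n a u _ ha ht hP => hR n (Forces.eqSubst (P := Ts) (Vt_app ha).2 ht)
    (Forces.eqSubst (P := P) (Vt_app ha).1 hP)

theorem vs_St (hM : w ⊩ MSeq τ) (hA : w ⊩ A τ n) : w ⊩ Vs (St τ n) :=
  A_ind (P := fun n => Vs (St τ n)) hM (fun n u _ ih => v_intro (cEnumI fun p =>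
    (good_ch hM.w n p).atE fun a u1 _ ha hm => .exI _ ⟨app_St ha, by rw [Rt_pr]; exact hm, by
      rw [Rt_pr, Lf_pr]
      exact forces_imp.2 fun u2 _ ht => ih p (ha.w.atI ht)⟩)) hA

theorem vs_Vt (hM : w ⊩ MSeq τ) : w ⊩ Vs (Vt τ) :=
  v_intro (cEnumI fun n => .exI _ ⟨app_Vt, by rw [Rt_pr]; exact F_ms hM good_root n, by
    rw [Rt_pr, Lf_pr]
    exact forces_imp.2 fun u2 _ ht => vs_St hM.w ht⟩)

/-- The condition of a genuine branch is some `τ m` by construction. All others are `BB`, which is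
equivalent to an untrue condition of `τ`; this is where untrueness of some condition in `τ` is
needed. Well-foundedness of `n` plays no part. -/
theorem condsH_St (hM : w ⊩ MSeq τ) (hU : w ⊩ untrueH τ) (n : D) : w ⊩ condsH (St τ n) τ := by
  intro p
  have h1 : ∀ ⦃u1⦄ [Le w u1], (u1 ⊩ atA (St τ n) p fun d => Ts (Rt d)) ↔ u1 ⊩ CT (ch τ n p) := by
    intro u1 _
    refine ⟨fun h => h.atE fun a u2 _ ha ht => (St_app hM.w ha).2.1 ht, fun h =>
      h.atE fun a u2 _ ha ht => (app_St ha).atI (by rw [Rt_pr]; exact ht)⟩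
  refine (KT_or n p).orE ?_ ?_
  · intro u1 _ hk
    refine .exI (Rt (out' p)) ⟨forces_imp.2 fun u2 _ ht => (h1 (u1 := u2)).2 ((CT_ch hk.w).2 ht),
      forces_imp.2 fun u2 _ ht => (CT_ch hk.w).1 ((h1 (u1 := u2)).1 ht)⟩
  · intro u1 _ hd
    refine hd.exE fun d u2 _ hd => Forces.exE hU.w fun j u3 _ hj => .exI j
      ⟨forces_imp.2 fun u4 _ ht => (hj.w.mp ht).elim _, forces_imp.2 fun u4 _ ht => ?_⟩
    have := (h1 (u1 := u4)).1 ht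
    exact ((CT_of_eq (ch_of_succ hd.w)).1 this).atE fun a u5 _ ha ht =>
      not_BB (Forces.eqSubst (P := Ts) (ha.unique (app_cn _ _)) ht)

/-- Induction along the tree reaches `St τ n` after all its elements. Well-foundedness is carried
along in the induction predicate, since the building rule `h` applies only to v-sets. -/
theorem built (P : D → HProp) [Def1 P] (hM : w ⊩ MSeq τ) (hU : w ⊩ untrueH τ)
    (h : ∀ y ⦃u⦄ [Le w u], u ⊩ Vs y → u ⊩ condsH y τ → u ⊩ aEl y P → u ⊩ P y) :
    w ⊩ aEl (Vt τ) P := by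
  have := DefP.comp_snd (X := Unit) (fun _ d => P d) (St τ)
  refine Vt_aElI fun n u _ hA => ?_
  have : u ⊩ HProp.and (A τ n) (P (St τ n)) :=
    A_ind (P := fun n => HProp.and (A τ n) (P (St τ n))) hM (fun n u _ ih => ?_) hA
  · exact this.2
  have hA : u ⊩ A τ n := A_intro hM.w fun p u1 _ hp => (ih p hp).1
  exact ⟨hA, h _ (vs_St hM.w hA) (condsH_St hM.w hU.w n)
    (St_aElI hM.w fun p u1 _ hp => (ih p hp).2)⟩
end

/-! ### Collection -/

theorem DefP.of2 {X : Type} [Env X] [hX : HasConst X] (P : D → D → HProp) (f g : X → D) [h : Def2 P]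
    [hf : DefT f] [hg : DefT g] : DefP fun x => P (f x) (g x) := by
  obtain ⟨φ, hφ⟩ := h.ex
  obtain ⟨s, hs⟩ := hf.ex
  obtain ⟨t, ht⟩ := hg.ex
  choose c hc using fun n => hX.ex (vars n)
  refine ⟨φ.subst (scons t (scons s c)), fun x => ?_⟩
  rw [sem_subst, ← hs, ← ht, ← hφ (((), s.eval (Env.enc x)), t.eval (Env.enc x)), enc_pair2]
  congr 1; funext n; rcases n with _ | _ | n
  · rfl
  · rfl
  · exact hc n x

/-- A tree whose branches are given by a choice `e` of subtrees and a choice `μ` of conditions. -/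
noncomputable def treeK (y i : D) : D :=
  ifz (ktd (Lf y) (Lf i)) (pr (out' (Lf i)) (Rt i)) (pr Z (Rt y))
instance {X : Type} [Env X] (f g : X → D) [DefT f] [DefT g] : DefT fun x => treeK (f x) (g x) := by
  unfold treeK; infer_instance
-- An input is a pair `q = ⟨k, o⟩`. If `o` is a computation of `e` on `k`, the output is `⟨e k, μ
-- k⟩`; otherwise it is `⟨0, j⟩`, which is switched off when `τ j` is not True. Thus `e` itself is
-- never run, and the program is total as soon as `μ` is.
noncomputable def tree (e μ j : D) : D :=
  cmp (lam treeK (pr e j)) (prd (pr (nm 0) Z) (cmp μ (pr (nm 3) Z)))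

section
variable {e μ j q m : D}
theorem app_tree (h : w ⊩ App μ (Lf q) m) : w ⊩ App (tree e μ j) q (treeK (pr e j) (pr q m)) :=
  app_comp (app_pair app_id (app_comp app_left h)) (app_lam _ _)
theorem tree_yes (h : w ⊩ App μ (Lf q) m) (hk : w ⊩ KT e (Lf q) (Rt q)) :
    w ⊩ App (tree e μ j) q (pr (out' q) m) := by
  refine (app_tree h).appCongr (forces_rfl _) (forces_rfl _) ?_
  simp only [treeK, Lf_pr, Rt_pr]
  exact ifz_of_zero (ktd_of_KT hk)
theorem tree_no (h : w ⊩ App μ (Lf q) m) {d : D} (hk : w ⊩ eqH (ktd e q) (S d)) :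
    w ⊩ App (tree e μ j) q (pr Z j) := by
  refine (app_tree h).appCongr (forces_rfl _) (forces_rfl _) ?_
  simp only [treeK, Lf_pr, Rt_pr]
  exact ifz_of_succ hk
end

/-- The `k`th condition of `y` is True. -/
noncomputable def condT (y k : D) : HProp := atA y k fun d => Ts (Rt d)
instance {X : Type} [Env X] (f g : X → D) [DefT f] [DefT g] : DefP fun x => condT (f x) (g x) := by
  unfold condT; infer_instance

/-- Church's Thesis requires an almost-negative premise, which `condT y k` is not as it stands: it
is an existential statement about Truth. The values of a v-set are defined, so it is equivalent to
the statement that every computation of `y k` has a True condition. -/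
theorem choice_of_conds {y : D} (Q : D → D → HProp) [Def2 Q] (hy : w ⊩ Vs y)
    (h : ∀ k ⦃u⦄ [Le w u], u ⊩ condT y k → u ⊩ HProp.ex (Q k)) :
    w ⊩ HProp.ex fun e => HProp.all fun k => HProp.imp (condT y k) (atA e k (Q k)) := by
  have h1 := ect (w := w) (P := fun k => HProp.all fun o => HProp.imp (KT y k o) (Ts (Rt (Rt o))))
    (Q := Q) fun k u _ hk => by
      refine (v_inv hy.w).cEnumE k fun a u1 _ ha _ _ => Forces.exE ha fun o u2 _ ho => ?_
      exact h k ((app_of_KT ho.1).atI (P := fun d => Ts (Rt d)) ((hk.w.sp o).mp ho.1))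
  refine h1.exE fun e u _ he => .exI e fun k => forces_imp.2 fun u1 _ hk => (he.w.sp k).mp ?_
  refine fun o => forces_imp.2 fun u2 _ ho => ?_
  exact hk.w.atD (P := fun d => Ts (Rt d)) (app_of_KT ho)

section
variable {τ y e μ j : D} (Φ : D → D → HProp) [hΦ : Def2 Φ]

/-- `n` is a well-founded tree, and its set is `Φ`-related to the `k`th element of `y`. -/
noncomputable def Choice (τ y k n : D) : HProp :=
  HProp.and (A τ n) (atA y k fun d => Φ (Lf d) (St τ n))

theorem def_choice : Def2 (Choice Φ τ y) := by
  have := DefP.of2 (X := ((Unit × D) × D) × D) Φ (fun x => Lf x.2) (fun x => St τ x.1.2)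
  unfold Choice; infer_instance

theorem exists_choice (hy : w ⊩ Vs y) (h : w ⊩ aEl y fun a => eEl (Vt τ) fun b => Φ a b) :
    w ⊩ HProp.ex fun e => HProp.all fun k => HProp.imp (condT y k) (atA e k (Choice Φ τ y k)) := by
  have := def_choice Φ (τ := τ) (y := y)
  have d1 := DefP.of2 (X := (Unit × D) × D) Φ (fun x => x.1.2) (fun x => x.2)
  refine choice_of_conds (Choice Φ τ y) hy fun k u _ hk => hk.atE fun a u1 _ ha ht => ?_
  have d2 := DefP.of2 (X := Unit × D) Φ (fun _ => Lf a) (fun x => x.2)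
  exact (h.w.aElE ha ht).Vt_elE fun n u2 _ hA hn => .exI n ⟨hA, by
    have := DefP.of2 (X := Unit × D) Φ (fun x => Lf x.2) (fun _ => St τ n)
    exact ha.w.atI (P := fun d => Φ (Lf d) (St τ n)) hn⟩

/-- The premise of Church's Thesis is trivially true here, so `μ` is total. -/
theorem exists_conds (hc : w ⊩ condsH y τ) : w ⊩ HProp.ex fun μ => HProp.all fun k =>
    atA μ k fun m => iffH (atA τ m Ts) (condT y k) := by
  have h1 := ect (w := w) (P := fun k => HProp.imp HProp.bot HProp.bot)
    (Q := fun k m => iffH (atA τ m Ts) (condT y k)) fun k u _ _ => hc.w.sp k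
  exact h1.exE fun μ u _ h => .exI μ fun k => (h.sp k).mp (forces_imp.2 fun _ _ h => h)

/-- A True branch cannot carry `τ j`, so its input contains a computation of `e` on some `k`. Its
condition `τ (μ k)` is equivalent to the `k`th condition of `y`, which is then True, and so the
value `e k` is a correct choice. -/
theorem tree_branch (hj : w ⊩ notH (atA τ j Ts))
    (he : w ⊩ HProp.all fun k => HProp.imp (condT y k) (atA e k (Choice Φ τ y k)))
    (hμ : w ⊩ HProp.all fun k => atA μ k fun m => iffH (atA τ m Ts) (condT y k))
    {p : D} (h : w ⊩ CT (ch τ (tree e μ j) p)) :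
    w ⊩ HProp.ex fun k => HProp.and (condT y k) (Choice Φ τ y k (nx p)) := by
  have := def_choice Φ (τ := τ) (y := y)
  refine h.chE fun u _ hk ht => ?_
  have hn := app_of_KT hk
  refine (hμ.w.sp (Lf (Lf p))).atE fun m u1 _ hm hi => (KT_or e (Lf p)).orE ?_ ?_
  · intro u2 _ hke
    have h1 : u2 ⊩ eqH (out' p) (pr (out' (Lf p)) m) := hn.w.unique (tree_yes hm.w hke)
    have h2 : u2 ⊩ eqH (Rt (out' p)) m := by simpa using h1.congr1 .right
    have h3 : u2 ⊩ eqH (nx p) (out' (Lf p)) := by simpa [nx] using h1.congr1 .left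
    have h4 : u2 ⊩ condT y (Lf (Lf p)) :=
      hi.1.w.mp (Forces.eqSubst (P := fun m => atA τ m Ts) h2 ht.w)
    have d1 := DefP.of2 (X := Unit × D) (Choice Φ τ y) (fun _ => Lf (Lf p)) (fun x => x.2)
    have h5 : u2 ⊩ Choice Φ τ y (Lf (Lf p)) (out' (Lf p)) :=
      ((he.w.sp _).mp h4).atD (app_of_KT hke)
    exact .exI _ ⟨h4, Forces.eqSubst (P := fun n => Choice Φ τ y (Lf (Lf p)) n) h3.symm h5⟩
  · intro u2 _ hd
    refine hd.exE fun d u3 _ hd => ?_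
    have h1 : u3 ⊩ eqH (out' p) (pr Z j) := hn.w.unique (tree_no hm.w hd)
    have h2 : u3 ⊩ eqH (Rt (out' p)) j := by simpa using h1.congr1 .right
    exact (hj.w.mp (Forces.eqSubst (P := fun m => atA τ m Ts) h2 ht.w)).elim _

theorem A_tree (hM : w ⊩ MSeq τ) (hj : w ⊩ notH (atA τ j Ts))
    (he : w ⊩ HProp.all fun k => HProp.imp (condT y k) (atA e k (Choice Φ τ y k)))
    (hμ : w ⊩ HProp.all fun k => atA μ k fun m => iffH (atA τ m Ts) (condT y k)) :
    w ⊩ A τ (tree e μ j) :=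
  A_intro hM fun p u _ hp => (tree_branch Φ hj.w he.w hμ.w hp).exE fun k u1 _ hk => hk.2.1

theorem tree_covers (he : w ⊩ HProp.all fun k => HProp.imp (condT y k) (atA e k (Choice Φ τ y k)))
    (hμ : w ⊩ HProp.all fun k => atA μ k fun m => iffH (atA τ m Ts) (condT y k)) :
    w ⊩ aEl y fun a => eEl (St τ (tree e μ j)) fun b => Φ a b := by
  have := def_choice Φ (τ := τ) (y := y)
  have d1 := DefP.of2 (X := (Unit × D) × D) Φ (fun x => x.1.2) (fun x => x.2)
  refine aElI fun k a u _ ha ht => ?_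
  have d2 := DefP.of2 (X := Unit × D) Φ (fun _ => Lf a) (fun x => x.2)
  have hk : u ⊩ condT y k := ha.atI (P := fun d => Ts (Rt d)) ht
  refine ((he.w.sp k).mp hk).exE fun o u1 _ ho => (hμ.w.sp k).atE fun m u2 _ hm hi => ?_
  -- The `k`th element of `y` is met by the branch `⟨⟨k, o⟩, r⟩`, where `o` is the computation of
  -- `e` on `k` and `r` is that of the new tree on `⟨k, o⟩`.
  have h1 : u2 ⊩ App (tree e μ j) (pr k o) (pr (out' (pr k o)) m) :=
    tree_yes (by rw [Lf_pr]; exact hm) (by rw [Lf_pr, Rt_pr]; exact ho.1.w)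
  refine Forces.exE h1 fun r u3 _ hr => ?_
  have h2 : u3 ⊩ eqH (out' (pr (pr k o) r)) (pr (out' (pr k o)) m) := by
    simp only [out', Rt_pr]; simpa [out'] using hr.2
  have h3 : u3 ⊩ eqH (Rt (out' (pr (pr k o) r))) m := by simpa using h2.congr1 .right
  have h4 : u3 ⊩ eqH (nx (pr (pr k o) r)) (Rt o) := by simpa [nx, out'] using h2.congr1 .left
  have h5 : u3 ⊩ CT (ch τ (tree e μ j) (pr (pr k o) r)) :=
    (CT_ch (by rw [Lf_pr, Rt_pr]; exact hr.1)).2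
      (Forces.eqSubst (P := fun m => atA τ m Ts) h3.symm (hi.2.w.mp hk.w))
  refine St_elI h5 ?_
  have d4 := DefP.of2 (X := Unit × D) Φ (fun x => Lf x.2) (fun _ => St τ (Rt o))
  have d5 := DefP.of2 (X := Unit × D) Φ (fun _ => Lf a) (fun x => St τ x.2)
  exact Forces.eqSubst (P := fun n => Φ (Lf a) (St τ n)) h4.symm
    (ho.2.2.w.atD (P := fun d => Φ (Lf d) (St τ (Rt o))) ha.w)

theorem tree_covered (hM : w ⊩ MSeq τ) (hj : w ⊩ notH (atA τ j Ts))
    (he : w ⊩ HProp.all fun k => HProp.imp (condT y k) (atA e k (Choice Φ τ y k)))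
    (hμ : w ⊩ HProp.all fun k => atA μ k fun m => iffH (atA τ m Ts) (condT y k)) :
    w ⊩ aEl (St τ (tree e μ j)) fun b => eEl y fun a => Φ a b := by
  have d1 := DefP.of2 (X := (Unit × D) × D) Φ (fun x => x.2) (fun x => x.1.2)
  refine St_aElI hM fun p u _ hp => ?_
  refine (tree_branch Φ hj.w he.w hμ.w hp).exE fun k u1 _ hk => hk.1.atE fun a u2 _ ha ht => ?_
  have d2 := DefP.of2 (X := Unit × D) Φ (fun x => x.2) (fun _ => St τ (nx p))
  have d3 := DefP.of2 (X := Unit × D) Φ (fun x => Lf x.2) (fun _ => St τ (nx p))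
  exact eElI ha ht (hk.2.2.w.atD (P := fun d => Φ (Lf d) (St τ (nx p))) ha)

end

/-- The set of all sets built from `τ` is closed under collection from sets with conditions
in `τ`. -/
theorem collection {τ y : D} (Φ : D → D → HProp) [Def2 Φ] (hM : w ⊩ MSeq τ) (hU : w ⊩ untrueH τ)
    (hy : w ⊩ Vs y) (hc : w ⊩ condsH y τ) (h : w ⊩ aEl y fun a => eEl (Vt τ) fun b => Φ a b) :
    w ⊩ eEl (Vt τ) fun z => HProp.and (aEl z fun b => eEl y fun a => Φ a b)
      (aEl y fun a => eEl z fun b => Φ a b) := by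
  have d1 := DefP.of2 (X := ((Unit × D) × D) × D) Φ (fun x => x.1.2) (fun x => x.2)
  have d2 := DefP.of2 (X := ((Unit × D) × D) × D) Φ (fun x => x.2) (fun x => x.1.2)
  refine (exists_choice Φ hy h).exE fun e u _ he => (exists_conds hc.w).exE fun μ u1 _ hμ =>
    Forces.exE hU.w fun j u2 _ hj => ?_
  exact Vt_elI (A_tree Φ hM.w hj he.w hμ.w)
    ⟨tree_covered Φ hM.w hj he.w hμ.w, tree_covers Φ he.w hμ.w⟩

/-! ### The set of all sets built from `τ` is regular -/

section
variable {τ : D} (E : Fm)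

noncomputable def closedH (τ B : D) : HProp :=
  HProp.all fun y => HProp.imp (Vs y) (HProp.imp (HProp.and (condsH y τ) (aEl y fun a => memH E a B))
    (memH E y B))
noncomputable def transH (B : D) : HProp := aEl B fun a => aEl a fun b => memH E b B
noncomputable def collH (B : D) : HProp :=
  aEl B fun a => HProp.all fun r => HProp.imp (Vs r) (HProp.imp
    (aEl a fun u => eEl B fun z => relH E r u z)
    (eEl B fun b => HProp.and (aEl b fun z => eEl a fun u => relH E r u z)
      (aEl a fun u => eEl b fun z => relH E r u z)))
noncomputable def regH (B : D) : HProp :=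
  HProp.and (eEl B fun _ => HProp.imp HProp.bot HProp.bot) (HProp.and (transH E B) (collH E B))

@[simp] theorem sem_closed (s t : Tm) (ρ : ℕ → D) :
    (closedUnderBuilding E s t).sem ρ = closedH E (s.eval ρ) (t.eval ρ) := by
  simp [closedUnderBuilding, allV, closedH, Fm.sem]
@[simp] theorem sem_regular (t : Tm) (ρ : ℕ → D) : (regular E t).sem ρ = regH E (t.eval ρ) := by
  simp [regular, inhabited, transitive, strongCollection, regH, transH, collH, allV, top, Fm.sem]

variable [hE : ExtEq E]

/-- Collection for the relation of extensional equality produces a set in `Vt τ` with the same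
elements as `y`, up to `≃`. -/
theorem closed_Vt (hM : w ⊩ MSeq τ) (hU : w ⊩ untrueH τ) : w ⊩ closedH E τ (Vt τ) := by
  intro y
  refine forces_imp.2 fun u _ hy => forces_imp.2 fun u1 _ h => ?_
  -- The relation also records that both sides are v-sets, because symmetry of `≃` is available for
  -- v-sets only.
  have h1 := collection (fun a b => HProp.and (HProp.and (Vs a) (Vs b)) (RE E a b)) hM.w hU.w hy.w
    h.1 (aElI fun k a u2 _ ha ht => (h.2.w.aElE ha ht).Vt_elE fun n u3 _ hA hn =>
      Vt_elI hA ⟨⟨((v_inv hy.w).aElV.aElE ha.w ht.w), vs_St hM.w hA⟩, hn⟩)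
  refine h1.Vt_elE fun n u2 _ hA hn => Vt_elI hA ((RE_iff hy.w (vs_St hM.w hA)).2 ⟨?_, ?_⟩)
  · exact hn.2.aElMono fun a u3 _ ha => ha.eElMono fun b u4 _ hb => hb.2
  · exact hn.1.aElMono fun a u3 _ ha => ha.eElMono fun b u4 _ hb => RE_symm hb.1.1 hb.1.2 hb.2

theorem regular_Vt (hM : w ⊩ MSeq τ) (hU : w ⊩ untrueH τ) : w ⊩ regH E (Vt τ) := by
  refine ⟨?_, ?_, ?_⟩
  · refine Forces.exE hU fun j u _ hj => ?_
    -- The constant program with the output `⟨0, j⟩` has no True branches, so it is well-founded and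
    -- represents the empty set.
    have hA : u ⊩ A τ (cn (pr Z j)) := A_intro hM.w fun p u1 _ hp => hp.chE fun u2 _ hk ht => by
      have h1 : u2 ⊩ eqH (out' p) (pr Z j) := (app_of_KT hk).unique (app_cn _ _)
      have h2 : u2 ⊩ eqH (Rt (out' p)) j := by simpa using h1.congr1 .right
      exact (hj.w.mp (Forces.eqSubst (P := fun m => atA τ m Ts) h2 ht)).elim _
    exact Vt_elI hA (forces_imp.2 fun _ _ h => h)
  · exact Vt_aElI fun n u _ hA => St_aElI hM.w fun p u1 _ hp =>
      Vt_elI (A_elim hM.w hA.w hp) (RE_refl (vs_St hM.w (A_elim hM.w hA.w hp)))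
  · refine Vt_aElI fun n u _ hA r => forces_imp.2 fun u1 _ _ => forces_imp.2 fun u2 _ h => ?_
    exact collection (fun u z => relH E r u z) hM.w hU.w (vs_St hM.w hA.w) (condsH_St hM.w hU.w n) h

end

/-! ### The sequence of the conditions of a v-set -/

/-- Here `y = ⟨t, ⟨x, s⟩⟩` and `i` is a value of `x`. The index `s = 0` yields `BB`, `s = ⟨n, 0⟩ +
1` the `n`th condition of `x`, and `s = ⟨n, s'⟩ + 1` with `s' > 0` the conjunction of that condition
with entry `s'` in the sequence of the `n`th element. -/
noncomputable def condK (y i : D) : D :=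
  ifz (Rt (Rt y)) BB (ifz (Rt (pd (Rt (Rt y)))) (Rt i)
    (XiD (cn (Rt i)) (cmp (self (Lf y) (Lf i)) (cn (Rt (pd (Rt (Rt y))))))))

section
variable {X : Type} [Env X] (a b c : X → D) [DefT a] [DefT b] [DefT c]
instance : DefT fun x => condK (a x) (b x) := by unfold condK; infer_instance
end

noncomputable def condG (t x s : D) : D := pr (cmp (lam condK (pr t (pr x s))) x) (Lf (pd s))

instance {X : Type} [Env X] (a b c : X → D) [DefT a] [DefT b] [DefT c] :
    DefT fun x => condG (a x) (b x) (c x) := by unfold condG; infer_instance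

/-- The sequence of the conditions of `x`, of its elements, and so on. -/
noncomputable def Cs (x : D) : D := self (fixB condG) x

instance {X : Type} [Env X] (a : X → D) [DefT a] : DefT fun x => Cs (a x) := by
  unfold Cs; infer_instance

section
variable {x y d s c g : D} {P : D → HProp}

theorem app_Cs (h : w ⊩ App x (Lf (pd s)) y) :
    w ⊩ App (Cs x) s (condK (pr (fixB condG) (pr x s)) y) :=
  app_self condG (e := cmp (lam condK (pr (fixB condG) (pr x s))) x) (j := Lf (pd s)) rfl
    (app_comp h (app_lam _ _))

/-- The program runs `x` even at the index `0`, where the value is discarded; so the enumeration `x`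
has to be defined. -/
theorem Cs_zero (h : w ⊩ cEnum x P) : w ⊩ App (Cs x) Z BB :=
  h.cEnumE (Lf (pd Z)) fun y u _ hy _ _ => by
    have := app_Cs (s := Z) hy
    simpa only [condK, Lf_pr, Rt_pr, ifz_Z] using this

theorem Cs_one (h : w ⊩ App x (Lf d) y) (hd : w ⊩ eqH (Rt d) Z) : w ⊩ App (Cs x) (S d) (Rt y) := by
  refine (app_Cs (s := S d) (by rw [pd_S]; exact h)).appCongr (forces_rfl _) (forces_rfl _) ?_
  simp only [condK, Lf_pr, Rt_pr, ifz_S, pd_S]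
  exact ifz_of_zero hd

/-- The condition that `c` and the value of `g` at `s` are True. -/
noncomputable def both (c g s : D) : D := XiD (cn c) (cmp g (cn s))

theorem Cs_succ (h : w ⊩ App x (Lf d) y) (hd : w ⊩ eqH (Rt d) (S s)) :
    w ⊩ App (Cs x) (S d) (both (Rt y) (Cs (Lf y)) (Rt d)) := by
  refine (app_Cs (s := S d) (by rw [pd_S]; exact h)).appCongr (forces_rfl _) (forces_rfl _) ?_
  simp only [condK, Lf_pr, Rt_pr, ifz_S, pd_S]
  exact ifz_of_succ hd

/-- (Ξ2) asks for Meaning of the second condition only if the first is True. This dependent form of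
conjunction is essential: without Truth of `c`, nothing is known about the element that defines `g`.
-/
theorem ms_both (hc : w ⊩ Ms c) (hg : w ⊩ HProp.imp (Ts c) (atA g s Ms)) : w ⊩ Ms (both c g s) :=
  xi_meaning (fun _ _ _ _ => (app_cn _ _).atI hc.w) fun n u _ _ _ ht =>
    (hg.w.mp (ht.atD (app_cn _ _))).atE fun a u1 _ ha hm => (app_comp (app_cn _ _) ha).atI hm

theorem ts_both (hc : w ⊩ Ms c) (ht : w ⊩ Ts c) (hg : w ⊩ atA g s Ms) :
    (w ⊩ Ts (both c g s)) ↔ w ⊩ atA g s Ts := by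
  rw [both, xi_truth (ms_both hc (forces_imp.2 fun _ _ _ => hg.w))]
  refine ⟨fun h => ?_, fun h n u _ _ => h.w.atE fun a u1 _ ha hm => (app_comp (app_cn _ _) ha).atI hm⟩
  exact hg.atE fun a u _ ha _ =>
    ha.atI ((h Z ((app_cn _ _).atI ht)).w.atD (app_comp (app_cn _ _) ha))

theorem mseq_Cs (hx : w ⊩ Vs x) : w ⊩ MSeq (Cs x) := by
  refine v_ind (w := w) (P := fun x => MSeq (Cs x)) (fun x u _ h s => ?_) hx
  refine (zero_or_succ s).orE ?_ ?_
  · intro u1 _ hs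
    exact Forces.eqSubst (P := fun s => atA (Cs x) s Ms) hs.symm ((Cs_zero h.w).atI ms_BB)
  · intro u1 _ hs
    refine hs.exE fun d u2 _ hd => h.w.cEnumE (Lf d) fun y u3 _ hy hm ht => ?_
    refine Forces.eqSubst (P := fun s => atA (Cs x) s Ms) hd.symm.w ?_
    refine (zero_or_succ (Rt d)).orE ?_ ?_
    · intro u4 _ h0
      exact (Cs_one hy.w h0).atI hm.w
    · intro u4 _ h1
      exact h1.exE fun s' u5 _ hs' => (Cs_succ hy.w hs').atI
        (ms_both hm.w (forces_imp.2 fun u6 _ htr => (ht.w.mp htr).sp (Rt d)))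

theorem untrue_Cs (hx : w ⊩ Vs x) : w ⊩ untrueH (Cs x) :=
  .exI Z (forces_imp.2 fun u _ h => not_BB (h.atD (Cs_zero (v_inv hx.w))))

theorem Forces.atIff {P Q : D → HProp} {e e' i i' a a' : D} [Def1 P] [Def1 Q] (h : w ⊩ App e i a)
    (h' : w ⊩ App e' i' a') (hPQ : ∀ ⦃u⦄ [Le w u], (u ⊩ P a) ↔ u ⊩ Q a') :
    w ⊩ iffH (atA e i P) (atA e' i' Q) :=
  ⟨forces_imp.2 fun u _ ha => h'.w.atI (hPQ.1 (ha.atD h.w)),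
    forces_imp.2 fun u _ ha => h.w.atI (hPQ.2 (ha.atD h'.w))⟩

theorem Forces.iffTrans {P Q R : HProp} (h : w ⊩ iffH P Q) (h' : w ⊩ iffH Q R) : w ⊩ iffH P R :=
  ⟨forces_imp.2 fun u _ ha => h'.1.w.mp (h.1.w.mp ha), forces_imp.2 fun u _ ha => h.2.w.mp (h'.2.w.mp ha)⟩

theorem Cs_conds (h : w ⊩ cEnum x P) (n : D) :
    w ⊩ iffH (atA (Cs x) (S (pr n Z)) Ts) (atA x n fun d => Ts (Rt d)) :=
  h.cEnumE n fun y u _ hy _ _ =>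
    (Cs_one (d := pr n Z) (by rw [Lf_pr]; exact hy) (by rw [Rt_pr]; exact forces_rfl _)).atIff hy
      fun u _ => Iff.rfl

theorem conds_Cs (hx : w ⊩ Vs x) : w ⊩ condsH x (Cs x) := fun n =>
  .exI (S (pr n Z)) (Cs_conds (v_inv hx) n)

/-! ### Membership in the set of built sets -/

/-- The conditions in `Cs x` are in `τ`. -/
noncomputable def allCs (x τ : D) : HProp :=
  HProp.all fun s => HProp.ex fun m => iffH (atA τ m Ts) (atA (Cs x) s Ts)

instance {X : Type} [Env X] (a b : X → D) [DefT a] [DefT b] : DefP fun x => allCs (a x) (b x) := by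
  unfold allCs; infer_instance

/-- A positive entry `s` in the sequence of the element occurs at `⟨n, s⟩ + 1` in that of `x`, in
conjunction with the `n`th condition, which is True here and may be dropped. At `0` both sequences
have the same entry `BB`. -/
theorem allCs_el {τ n : D} (hx : w ⊩ Vs x) (h : w ⊩ allCs x τ) (hy : w ⊩ App x n y)
    (ht : w ⊩ Ts (Rt y)) : w ⊩ allCs (Lf y) τ := by
  intro s
  have hv := (v_inv hx).aElV.aElE hy ht
  have hm : w ⊩ Ms (Rt y) := ((v_inv hx).sp n).atD (P := fun y => HProp.and (Ms (Rt y))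
    (HProp.imp (Ts (Rt y)) (Vs (Lf y)))) hy |>.1
  refine (zero_or_succ s).orE ?_ ?_
  · intro u _ hs
    refine Forces.eqSubst (P := fun s => HProp.ex fun m => iffH (atA τ m Ts) (atA (Cs (Lf y)) s Ts))
      hs.symm ?_
    exact (h.w.sp Z).exE fun m u1 _ hm => .exI m (hm.iffTrans
      ((Cs_zero (v_inv hx.w)).atIff (Cs_zero (v_inv hv.w)) fun _ _ => Iff.rfl))
  · intro u _ hs
    refine hs.exE fun d u1 _ hd => (h.w.sp (S (pr n s))).exE fun m u2 _ hmm => .exI m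
      (hmm.iffTrans ?_)
    have h1 : u2 ⊩ App (Cs x) (S (pr n s)) (both (Rt y) (Cs (Lf y)) s) := by
      have := Cs_succ (w := u2) (x := x) (y := y) (d := pr n s) (s := d) (by rw [Lf_pr]; exact hy.w)
        (by rw [Rt_pr]; exact hd.w)
      rwa [Rt_pr] at this
    have h2 := (mseq_Cs hv.w (w := u2)).sp s
    exact ⟨forces_imp.2 fun u3 _ h => (ts_both hm.w ht.w h2.w).1 (h.atD h1.w),
      forces_imp.2 fun u3 _ h => h1.w.atI ((ts_both hm.w ht.w h2.w).2 h)⟩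

/-- Induction on v-sets: `allCs` is inherited by the elements, which are therefore in `Vt τ`, and it
covers the conditions of `x` itself, so `closed_Vt` applies. -/
theorem mem_Vt (E : Fm) [ExtEq E] {τ : D} (hx : w ⊩ Vs x) (hM : w ⊩ MSeq τ) (hU : w ⊩ untrueH τ)
    (hc : w ⊩ allCs x τ) : w ⊩ memH E x (Vt τ) := by
  have key : w ⊩ HProp.and (Vs x) (HProp.imp (allCs x τ) (memH E x (Vt τ))) :=
    v_ind (w := w) (P := fun x => HProp.and (Vs x) (HProp.imp (allCs x τ) (memH E x (Vt τ))))
      (fun x u _ h => by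
        have hx : u ⊩ Vs x := v_intro (h.cEnumMono fun d u1 _ hd => hd.1)
        refine ⟨hx, forces_imp.2 fun u1 _ hc => ?_⟩
        refine (((closed_Vt E hM.w hU.w).sp x).mp hx.w).mp ⟨fun n => ?_, aElI fun n y u2 _ hy ht => ?_⟩
        · exact forces_ex (hc.sp _) fun m u2 _ hm => hm.iffTrans (Cs_conds (v_inv hx.w) n)
        · have := (h.w (w' := u2)).aElV.aElE hy ht
          exact this.2.mp (allCs_el hx.w hc.w hy ht)) hx
  exact key.2.mp hc

theorem mem_Vt_Cs (E : Fm) [ExtEq E] (hx : w ⊩ Vs x) : w ⊩ memH E x (Vt (Cs x)) :=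
  mem_Vt E hx (mseq_Cs hx) (untrue_Cs hx) fun s =>
    .exI s ⟨forces_imp.2 fun _ _ h => h, forces_imp.2 fun _ _ h => h⟩

end

/-! ### The existence of extensional equality -/

/-- `(k, l) ↦ l` without its first `k` entries. -/
def PR.drop : PR 2 := .prec (.proj 0) (.c1 .right (.proj 1))
noncomputable abbrev drop (k l : D) : D := ap2 PR.drop k l

theorem drop_Z (l : D) : drop Z l = l := by rw [drop, PR.drop, prec2_zero, proj1_0]
theorem drop_S (k l : D) : drop (S k) l = Rt (drop k l) := by
  rw [drop, PR.drop, prec2_succ, ap3_c1, proj3_1]; rfl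
theorem drop_pr (k a l : D) : drop (S k) (pr a l) = drop k l :=
  rec_unique (fun k => drop (S k) (pr a l)) (fun k => drop k l) (fun _ x => Rt x)
    (by rw [drop_S, drop_Z, drop_Z, Rt_pr]) (fun _ => drop_S _ _) (fun _ => drop_S _ _) k
theorem drop_nil (k : D) : drop k Z = Z :=
  rec_unique (fun k => drop k Z) (fun _ => Z) (fun _ x => Rt x) (drop_Z _) (fun _ => drop_S _ _)
    (fun _ => Rt_Z.symm) k

/-- All conditions on the list `l` are True. -/
noncomputable def AllT (l : D) : HProp :=
  HProp.all fun k => HProp.all fun c => HProp.imp (eqH (Lf (drop k l)) (S c)) (Ts c)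
instance {X : Type} [Env X] (f : X → D) [DefT f] : DefP fun x => AllT (f x) := by
  unfold AllT; infer_instance

theorem allT_nil : w ⊩ AllT Z := fun k c => forces_imp.2 fun u _ h => by
  rw [drop_nil, Lf_Z] at h; exact succ_ne _ h.symm _

/-- A condition `c` is stored as `c + 1`, which distinguishes entries from the zeros that follow the
end of a list. -/
theorem allT_cons {c l : D} : (w ⊩ AllT (pr (S c) l)) ↔ (w ⊩ Ts c) ∧ (w ⊩ AllT l) := by
  refine ⟨fun h => ⟨?_, fun k c' => ?_⟩, fun h k c' => forces_imp.2 fun u _ hk => ?_⟩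
  · exact ((h.sp Z).sp c).mp (by rw [drop_Z, Lf_pr]; exact forces_rfl _)
  · have := (h.sp (S k)).sp c'
    rwa [drop_pr] at this
  · refine (zero_or_succ k).orE ?_ ?_
    · intro u1 _ h0
      have h1 : u1 ⊩ eqH (Lf (drop k (pr (S c) l))) (Lf (drop Z (pr (S c) l))) :=
        Forces.congr1 _ (Forces.congr2 _ h0 (forces_rfl _))
      rw [drop_Z, Lf_pr] at h1
      exact Forces.eqSubst (P := Ts) (succ_inj (h1.symm.trans hk.w)) h.1.w
    · intro u1 _ h1
      refine h1.exE fun k' u2 _ hk' => ((h.2.w.sp k').sp c').mp ?_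
      have h1 : u2 ⊩ eqH (Lf (drop k (pr (S c) l))) (Lf (drop (S k') (pr (S c) l))) :=
        Forces.congr1 _ (Forces.congr2 _ hk' (forces_rfl _))
      rw [drop_pr] at h1
      exact h1.symm.trans hk.w

/-- The relation that `r` enumerates: pairs together with lists of conditions. -/
noncomputable def Rel (r a b : D) : HProp :=
  HProp.ex fun i => atA r i fun v => HProp.and (eqH (Lf v) (pr a b)) (AllT (Rt v))
instance {X : Type} [Env X] (f g h : X → D) [DefT f] [DefT g] [DefT h] :
    DefP fun x => Rel (f x) (g x) (h x) := by
  unfold Rel; infer_instance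

/-- The clause of extensional equality for the relation `R`. -/
noncomputable def clause (R : D → D → HProp) (x y : D) : HProp :=
  HProp.and (aEl x fun a => eEl y fun b => R a b) (aEl y fun b => eEl x fun a => R b a)

theorem clause_mono {R Q : D → D → HProp} {x y : D} (h : w ⊩ clause R x y)
    (hRQ : ∀ a b ⦃u⦄ [Le w u], u ⊩ R a b → u ⊩ Q a b) : w ⊩ clause Q x y :=
  ⟨h.1.aElMono fun a u _ ha => ha.eElMono fun b u1 _ hb => hRQ a b hb,
    h.2.aElMono fun a u _ ha => ha.eElMono fun b u1 _ hb => hRQ a b hb⟩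

/-- `r` enumerates a bisimulation. -/
noncomputable def Bis (r : D) : HProp :=
  HProp.all fun a => HProp.all fun b => HProp.imp (Rel r a b) (clause (Rel r) a b)
instance {X : Type} [Env X] (f : X → D) [DefT f] : DefP fun x => Bis (f x) := by
  unfold Bis clause; infer_instance

/-- The v-sets `a` and `b` are bisimilar. -/
noncomputable def Bisim (a b : D) : HProp := HProp.ex fun r => HProp.and (Bis r) (Rel r a b)
instance {X : Type} [Env X] (f g : X → D) [DefT f] [DefT g] :
    DefP fun x => Bisim (f x) (g x) := by
  unfold Bisim; infer_instance

/-- `r` is total. -/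
noncomputable def Tot (r : D) : HProp := HProp.all fun i => HProp.ex fun v => App r i v

/-! #### Unions of relations -/

/-- A value with an untrue condition on its list, which contributes no pair. In `unionK`, `z`
consists of an index `⟨⟨n, o⟩, ⟨j, o'⟩⟩` and the value `x n`; `o` computes `e n`, and `o'` computes
entry `j` of the relation `e n`. The `n`th condition of `x` is put on the list, since `e n` is
trusted only if it is True. -/
noncomputable def dead : D := pr Z (pr (S BB) Z)
noncomputable def unionK (e z : D) : D :=
  ifz (ktd e (Lf (Lf z))) (ifz (ktd (out' (Lf (Lf z))) (Rt (Lf z)))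
    (pr (Lf (out' (Rt (Lf z)))) (pr (S (Rt (Rt z))) (Rt (out' (Rt (Lf z)))))) dead) dead
instance {X : Type} [Env X] (f g : X → D) [DefT f] [DefT g] : DefT fun x => unionK (f x) (g x) := by
  unfold unionK dead; infer_instance
/-- The union of the relations `e n`, for `n` such that the `n`th condition of `x` is True. -/
noncomputable def union (e x : D) : D :=
  cmp (lam unionK e) (prd (pr (nm 0) Z) (cmp x (cmp (pr (nm 3) Z) (pr (nm 3) Z))))

section
variable {e x y i a b n : D} {P : D → HProp}

theorem app_union (h : w ⊩ App x (Lf (Lf i)) y) : w ⊩ App (union e x) i (unionK e (pr i y)) :=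
  app_comp (app_pair app_id (app_comp (app_comp app_left app_left) h)) (app_lam _ _)

theorem tot_union (h : w ⊩ cEnum x P) : w ⊩ Tot (union e x) := fun i =>
  h.cEnumE (Lf (Lf i)) fun y u _ hy _ _ => .exI _ (app_union hy)

theorem rel_unionI (h : w ⊩ condT x n) (h' : w ⊩ atA e n fun s => Rel s a b) :
    w ⊩ Rel (union e x) a b :=
  h.atE fun y u _ hy ht => Forces.exE h'.w fun o u1 _ ho => Forces.exE ho.2 fun j u2 _ hj =>
    Forces.exE hj fun o' u3 _ ho' => by
      have h1 : u3 ⊩ App (union e x) (pr (pr n o) (pr j o')) _ :=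
        app_union (y := y) (by simp only [Lf_pr]; exact hy.w)
      have h2 : u3 ⊩ eqH (unionK e (pr (pr (pr n o) (pr j o')) y))
          (pr (Lf (Rt o')) (pr (S (Rt y)) (Rt (Rt o')))) := by
        simp only [unionK, Lf_pr, Rt_pr]
        refine (ifz_of_zero (ktd_of_KT (by simp only [Lf_pr, Rt_pr]; exact ho.1.w))).trans ?_
        simp only [out', Rt_pr]
        exact ifz_of_zero (ktd_of_KT (by simp only [Lf_pr, Rt_pr]; exact ho'.1))
      have h3 := h1.appCongr (forces_rfl _) (forces_rfl _) h2
      refine .exI _ (h3.atI ⟨?_, ?_⟩)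
      · rw [Lf_pr]; exact ho'.2.1
      · rw [Rt_pr]; exact allT_cons.2 ⟨ht.w, ho'.2.2⟩

theorem not_dead {v : D} {R : HProp} (h : w ⊩ eqH v dead) (h' : w ⊩ AllT (Rt v)) : w ⊩ R := by
  have h1 : w ⊩ AllT (Rt dead) := Forces.eqSubst (P := fun v => AllT (Rt v)) h h'
  rw [dead, Rt_pr] at h1
  exact not_BB (allT_cons.1 h1).1

theorem rel_unionE (hx : w ⊩ cEnum x P) (h : w ⊩ Rel (union e x) a b) :
    w ⊩ HProp.ex fun n => HProp.and (condT x n) (atA e n fun s => Rel s a b) :=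
  Forces.exE h fun i u _ hi => hi.atE fun v u1 _ hv hr =>
    hx.w.cEnumE (Lf (Lf i)) fun y u2 _ hy _ _ => by
      have h1 : u2 ⊩ eqH v (unionK e (pr i y)) := hv.w.unique (app_union hy)
      simp only [unionK, Lf_pr, Rt_pr] at h1
      refine (KT_or e (Lf i)).orE ?_ ?_
      · intro u3 _ hk
        have h2 := (h1.w (w' := u3)).trans (ifz_of_zero (ktd_of_KT hk))
        refine (KT_or (out' (Lf i)) (Rt i)).orE ?_ ?_
        · intro u4 _ hk'
          have h3 := (h2.w (w' := u4)).trans (ifz_of_zero (ktd_of_KT hk'))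
          have h4 := Forces.eqSubst (P := fun v => AllT (Rt v)) h3 hr.2.w
          simp only [Rt_pr] at h4
          have h5 : u4 ⊩ eqH (Lf v) (Lf (out' (Rt i))) := by
            simpa using h3.congr1 .left
          refine .exI (Lf (Lf i)) ⟨?_, ?_⟩
          · exact hy.w.atI (P := fun d => Ts (Rt d)) (allT_cons.1 h4).1
          · refine (app_of_KT hk.w).atI ?_
            exact .exI (Lf (Rt i)) ((app_of_KT hk').atI ⟨h5.symm.trans hr.1.w, (allT_cons.1 h4).2⟩)
        · intro u4 _ hd
          exact hd.exE fun d u5 _ hd => not_dead (h2.w.trans (ifz_of_succ hd)) hr.2.w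
      · intro u3 _ hd
        exact hd.exE fun d u4 _ hd => not_dead (h1.w.trans (ifz_of_succ hd)) hr.2.w
end

/-- The left component of the index selects: `0` for the new pair, `1` for `r`, anything larger for
`s`. Both `r` and `s` are run in every case, hence the assumptions of totality below. -/
noncomputable def joinK (p z : D) : D :=
  ifz (Lf (Lf z)) (pr (pr (Lf p) (Rt p)) Z) (ifz (pd (Lf (Lf z))) (Lf (Rt z)) (Rt (Rt z)))
instance {X : Type} [Env X] (f g : X → D) [DefT f] [DefT g] : DefT fun x => joinK (f x) (g x) := by
  unfold joinK; infer_instance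
/-- The union of the relations `r`, `s` and the pair `⟨x, y⟩`. -/
noncomputable def join (x y r s : D) : D :=
  cmp (lam joinK (pr x y)) (prd (pr (nm 0) Z) (prd (cmp r (pr (nm 4) Z)) (cmp s (pr (nm 4) Z))))

section
variable {x y r s i a b c d : D}

theorem app_join (h : w ⊩ App r (Rt i) c) (h' : w ⊩ App s (Rt i) d) :
    w ⊩ App (join x y r s) i (joinK (pr x y) (pr i (pr c d))) :=
  app_comp (app_pair app_id (app_pair (app_comp app_right h) (app_comp app_right h'))) (app_lam _ _)

theorem Forces.totE {i : D} {R : HProp} (h : w ⊩ Tot r)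
    (hR : ∀ a ⦃u⦄ [Le w u], u ⊩ App r i a → u ⊩ R) : w ⊩ R :=
  (h.sp i).exE hR

theorem rel_join_base (hr : w ⊩ Tot r) (hs : w ⊩ Tot s) : w ⊩ Rel (join x y r s) x y :=
  hr.totE (i := Z) fun c u _ hc => (hs.w (w' := u)).totE (i := Z) fun d u1 _ hd => by
    have h1 := app_join (w := u1) (x := x) (y := y) (i := Z) (by rw [Rt_Z]; exact hc.w) (by rw [Rt_Z]; exact hd)
    simp only [joinK, Lf_pr, Rt_pr, Lf_Z, ifz_Z] at h1
    exact .exI Z (h1.atI ⟨by rw [Lf_pr]; exact forces_rfl _, by rw [Rt_pr]; exact allT_nil⟩)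

theorem rel_join_left (hs : w ⊩ Tot s) (h : w ⊩ Rel r a b) : w ⊩ Rel (join x y r s) a b :=
  Forces.exE h fun i u _ hi => hi.atE fun c u1 _ hc hv => (hs.w (w' := u1)).totE (i := i) fun d u2 _ hd => by
    have h1 := app_join (w := u2) (x := x) (y := y) (i := pr (S Z) i) (by rw [Rt_pr]; exact hc.w)
      (by rw [Rt_pr]; exact hd)
    simp only [joinK, Lf_pr, Rt_pr, ifz_S, pd_S, ifz_Z] at h1
    exact .exI _ (h1.atI (P := fun v => HProp.and (eqH (Lf v) (pr a b)) (AllT (Rt v))) hv.w)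

theorem rel_join_right (hr : w ⊩ Tot r) (h : w ⊩ Rel s a b) : w ⊩ Rel (join x y r s) a b :=
  Forces.exE h fun i u _ hi => hi.atE fun d u1 _ hd hv => (hr.w (w' := u1)).totE (i := i) fun c u2 _ hc => by
    have h1 := app_join (w := u2) (x := x) (y := y) (i := pr (S (S Z)) i) (by rw [Rt_pr]; exact hc)
      (by rw [Rt_pr]; exact hd.w)
    simp only [joinK, Lf_pr, Rt_pr, ifz_S, pd_S, ifz_Z] at h1
    exact .exI _ (h1.atI (P := fun v => HProp.and (eqH (Lf v) (pr a b)) (AllT (Rt v))) hv.w)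

theorem Forces.relJoinE (h : w ⊩ Rel (join x y r s) a b) (hr : w ⊩ Tot r) (hs : w ⊩ Tot s) {R : HProp}
    (h0 : ∀ ⦃u⦄ [Le w u], u ⊩ eqH x a → u ⊩ eqH y b → u ⊩ R)
    (h1 : ∀ ⦃u⦄ [Le w u], u ⊩ Rel r a b → u ⊩ R)
    (h2 : ∀ ⦃u⦄ [Le w u], u ⊩ Rel s a b → u ⊩ R) : w ⊩ R :=
  Forces.exE h fun i u _ hi => hi.atE fun v u1 _ hv hp => (hr.w (w' := u1)).totE (i := Rt i) fun c u2 _ hc =>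
    (hs.w (w' := u2)).totE (i := Rt i) fun d u3 _ hd => by
      have e : u3 ⊩ eqH v (joinK (pr x y) (pr i (pr c d))) := hv.w.unique (app_join hc.w hd)
      simp only [joinK, Lf_pr, Rt_pr] at e
      refine (zero_or_succ (Lf i)).orE ?_ ?_
      · intro u4 _ hz
        have e1 : u4 ⊩ eqH (Lf v) (pr x y) := by
          simpa using ((e.w (w' := u4)).trans (ifz_of_zero hz)).congr1 .left
        have e2 := e1.symm.trans hp.1.w
        exact h0 (by simpa using e2.congr1 .left) (by simpa using e2.congr1 .right)
      · intro u4 _ hk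
        refine hk.exE fun k u5 _ hk => ?_
        have e1 := (e.w (w' := u5)).trans (ifz_of_succ hk)
        refine (zero_or_succ (pd (Lf i))).orE ?_ ?_
        · intro u6 _ hz
          have e2 := (e1.w (w' := u6)).trans (ifz_of_zero hz)
          exact h1 (.exI _ (hc.w.atI (Forces.eqSubst
            (P := fun v => HProp.and (eqH (Lf v) (pr a b)) (AllT (Rt v))) e2 hp.w)))
        · intro u6 _ hk
          refine hk.exE fun k u7 _ hk => ?_
          have e2 := (e1.w (w' := u7)).trans (ifz_of_succ hk)
          exact h2 (.exI _ (hd.w.atI (Forces.eqSubst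
            (P := fun v => HProp.and (eqH (Lf v) (pr a b)) (AllT (Rt v))) e2 hp.w)))
end

/-! #### Bisimilarity satisfies the clause of extensional equality -/

section
variable {x y e : D}

/-- A pair in the union comes from a piece whose condition is True. That piece is a bisimulation
contained in the union, and the clause is monotone in the relation. -/
theorem bis_union {P : D → HProp} (hx : w ⊩ cEnum x P)
    (h : ∀ n ⦃u⦄ [Le w u], u ⊩ condT x n → u ⊩ atA e n Bis) : w ⊩ Bis (union e x) := fun a b =>
  forces_imp.2 fun u _ hab => (rel_unionE hx.w hab).exE fun n u1 _ hn =>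
    (h n hn.1).atE fun s u2 _ hs hb =>
      clause_mono (((hb.sp a).sp b).mp (hn.2.w.atD (P := fun s => Rel s a b) hs))
        fun a' b' u3 _ h' => rel_unionI hn.1.w (hs.w.atI (P := fun s => Rel s a' b') h')

theorem clause_of_bisim (h : w ⊩ Bisim x y) : w ⊩ clause Bisim x y :=
  h.exE fun r u _ hr => clause_mono (((hr.1.sp x).sp y).mp hr.2) fun a b u1 _ hab =>
    .exI r ⟨hr.1.w, hab⟩

/-- Relations that relate the elements of `x` to elements of `y`. -/
theorem exists_bis (hx : w ⊩ Vs x) (h : w ⊩ aEl x fun a => eEl y fun b => Bisim a b) :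
    w ⊩ HProp.ex fun r => HProp.and (Tot r) (HProp.and (Bis r)
      (aEl x fun a => eEl y fun b => Rel r a b)) := by
  -- One bisimulation is chosen for every element present in `x`. Merely having one for each is not
  -- enough, because a single program must enumerate the union.
  have h1 := choice_of_conds (fun n s => HProp.and (Bis s) (atA x n fun d => eEl y fun b =>
      Rel s (Lf d) b)) hx fun n u _ hn => hn.atE fun d u1 _ hd ht =>
    (h.w.aElE hd ht).eElE fun m c u2 _ hc hct hb => hb.exE fun s u3 _ hs => .exI s
      ⟨hs.1, hd.w.atI (P := fun d => eEl y fun b => Rel s (Lf d) b) (eElI hc.w hct.w hs.2)⟩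
  refine h1.exE fun e u _ he => .exI (union e x) ⟨tot_union (v_inv hx.w), ?_, ?_⟩
  · exact bis_union (v_inv hx.w) fun n u1 _ hn => ((he.w.sp n).mp hn).atE fun s u2 _ hs hb =>
      hs.atI hb.1
  · refine aElI fun n d u1 _ hd ht => ?_
    have hn : u1 ⊩ condT x n := hd.atI (P := fun d => Ts (Rt d)) ht
    refine ((he.w.sp n).mp hn).atE fun s u2 _ hs hb => ?_
    exact (hb.2.atD (P := fun d => eEl y fun b => Rel s (Lf d) b) hd.w).eElMono fun b u3 _ hb =>
      rel_unionI hn.w (hs.w.atI (P := fun s => Rel s (Lf d) b) hb)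

/-- The witness joins the pair `⟨x, y⟩` to bisimulations for the elements of `x` and for those of
`y`. The new pair satisfies the clause because of these two, and the old pairs by monotonicity. -/
theorem bisim_of_clause (hx : w ⊩ Vs x) (hy : w ⊩ Vs y) (h : w ⊩ clause Bisim x y) :
    w ⊩ Bisim x y := by
  refine (exists_bis hx h.1).exE fun r u _ hr => (exists_bis hy.w h.2.w).exE fun s u1 _ hs => ?_
  have hr' := hr.w (w' := u1)
  have hj : u1 ⊩ clause (Rel (join x y r s)) x y :=
    ⟨hr'.2.2.aElMono fun a u2 _ ha => ha.eElMono fun b u3 _ hb => rel_join_left hs.1.w hb,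
      hs.2.2.aElMono fun a u2 _ ha => ha.eElMono fun b u3 _ hb => rel_join_right hr'.1.w hb⟩
  refine .exI (join x y r s) ⟨fun a b => forces_imp.2 fun u2 _ hab => ?_, rel_join_base hr'.1 hs.1⟩
  refine hab.relJoinE hr'.1.w hs.1.w ?_ ?_ ?_
  · intro u3 _ h1 h2
    refine Forces.eqSubst (P := fun a => clause (Rel (join x y r s)) a b) h1
      (hP := by unfold clause; infer_instance) ?_
    exact Forces.eqSubst (P := fun b => clause (Rel (join x y r s)) x b) h2
      (hP := by unfold clause; infer_instance) hj.w
  · intro u3 _ h1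
    exact clause_mono (((hr'.2.1.w.sp a).sp b).mp h1) fun a' b' u4 _ h' =>
      rel_join_left hs.1.w h'
  · intro u3 _ h1
    exact clause_mono (((hs.2.1.w.sp a).sp b).mp h1) fun a' b' u4 _ h' =>
      rel_join_right hr'.1.w h'
end

theorem exists_extEq : ∃ E : Fm, IsExtEq E := by
  -- The context `Nil` excludes parameters and sets all further variables to zero, as `rel` does;
  -- the first argument of the relation is the variable of index `0`.
  obtain ⟨E, hE⟩ := (inferInstance : DefP fun p : (Nil × D) × D => Bisim p.2 p.1.2).ex
  have hE' : ∀ a b, RE E a b = Bisim a b := fun a b => hE ((.mk, b), a)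
  refine ⟨E, (der_iff_sem _).2 ?_⟩
  simp only [extEqClause, Fm.sem, sem_iff, sem_allEl, sem_exEl, sem_rel, eval_var, scons_zero,
    scons_one, scons_succ, hE']
  intro x y
  exact forces_imp.2 fun u _ h => ⟨forces_imp.2 fun u1 _ h' => clause_of_bisim h',
    forces_imp.2 fun u1 _ h' => bisim_of_clause h.1.w h.2.w h'⟩

/-! ### The theorem on regular extensions -/

theorem provable_of_forces {φ : Fm} (h : [] ⊩ φ.sem vars) : Provable φ := (der_iff_sem φ).2 h

theorem provable_regularExtension (E : Fm) [ExtEq E] : Provable (regularExtension E) := by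
  refine provable_of_forces ?_
  simp only [regularExtension, allV, exV, Fm.sem, sem_mem, sem_regular, eval_var, scons_zero,
    scons_one]
  intro x
  refine forces_imp.2 fun u _ hx => .exI (Vt (Cs x)) ⟨vs_Vt (mseq_Cs hx), mem_Vt_Cs E hx,
    regular_Vt E (mseq_Cs hx) (untrue_Cs hx)⟩

theorem exists_functions : ∃ h V : PR 1,
    Provable (allV ((meaningfulSeq (.fn h ![v 0])).and
      ((hasUntrue (.fn h ![v 0])).and (condsIn (v 0) (.fn h ![v 0]))))) ∧
    (∀ E : Fm, IsExtEq E → Provable (allV (mem E (v 0) (.fn V ![.fn h ![v 0]])))) ∧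
    (∀ E : Fm, IsExtEq E → Provable (.all (((meaningfulSeq (v 0)).and (hasUntrue (v 0))).imp
      ((Fm.isV (.fn V ![v 0])).and ((closedUnderBuilding E (v 0) (.fn V ![v 0])).and
        (regular E (.fn V ![v 0]))))))) ∧
    (∀ φ : Fm, Provable (.all (((meaningfulSeq (v 0)).and (hasUntrue (v 0))).imp
      (inductivelyBuilt φ (v 0) (.fn V ![v 0]))))) := by
  obtain ⟨h, hh⟩ := exists_PR1 Cs
  obtain ⟨V, hV⟩ := exists_PR1 Vt
  refine ⟨h, V, ?_, fun E hE => ?_, fun E hE => ?_, fun φ => ?_⟩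
  · refine provable_of_forces ?_
    simp only [allV, Fm.sem, sem_meaningfulSeq, sem_hasUntrue, sem_condsIn, eval_fn1, eval_var,
      scons_zero, hh]
    intro x
    exact forces_imp.2 fun u _ hx => ⟨mseq_Cs hx, untrue_Cs hx, conds_Cs hx⟩
  · have : ExtEq E := ⟨hE⟩
    refine provable_of_forces ?_
    simp only [allV, Fm.sem, sem_mem, eval_fn1, eval_var, scons_zero, hh, hV]
    intro x
    exact forces_imp.2 fun u _ hx => mem_Vt_Cs E hx
  · have : ExtEq E := ⟨hE⟩
    refine provable_of_forces ?_
    simp only [Fm.sem, sem_meaningfulSeq, sem_hasUntrue, sem_closed, sem_regular, eval_fn1, eval_var,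
      scons_zero, hV]
    intro τ
    exact forces_imp.2 fun u _ hτ => ⟨vs_Vt hτ.1, closed_Vt E hτ.1 hτ.2, regular_Vt E hτ.1 hτ.2⟩
  · refine provable_of_forces ?_
    simp only [inductivelyBuilt, allV, Fm.sem, sem_meaningfulSeq, sem_hasUntrue, sem_condsIn,
      sem_allEl, sem_inst, eval_lift, eval_fn1, eval_var, scons_zero, scons_succ, hV]
    intro τ
    refine forces_imp.2 fun u _ hτ => forces_imp.2 fun u1 _ h => ?_
    -- The formula may mention `τ`; with `τ` as a fixed parameter it is a definable predicate of `y`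
    -- alone.
    have := def_sem φ (scons τ vars)
    exact built (fun y => φ.sem (scons y (scons τ vars))) hτ.1.w hτ.2.w fun y u2 _ hy hc ha =>
      ((h.w.sp y).mp hy).mp ⟨hc, ha⟩

end VSets

/-- The theory defines extensional equality of v-sets, and proves that every v-set is contained in
a regular v-set. The regular v-set is `V(τ)`, the v-set of all v-sets that can be built from a
sequence `τ = h(x)` of Meaningful conditions that contains the conditions of `x`. -/
theorem mainTheorem8 :
    (∃ E : VSets.Fm, VSets.IsExtEq E) ∧
    (∀ E : VSets.Fm, VSets.IsExtEq E → VSets.Provable (VSets.regularExtension E)) ∧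
    ∃ h V : VSets.PR 1,
      -- `h(x)` is a sequence of Meaningful conditions that contains the conditions of `x`
      VSets.Provable (VSets.allV
        ((VSets.meaningfulSeq (.fn h ![VSets.v 0])).and
          ((VSets.hasUntrue (.fn h ![VSets.v 0])).and
            (VSets.condsIn (VSets.v 0) (.fn h ![VSets.v 0]))))) ∧
      -- `x` is an element of `V(h(x))`
      (∀ E : VSets.Fm, VSets.IsExtEq E → VSets.Provable (VSets.allV
        (VSets.mem E (VSets.v 0) (.fn V ![.fn h ![VSets.v 0]])))) ∧
      -- `V(τ)` is a regular v-set and contains all v-sets that can be built from `τ`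
      (∀ E : VSets.Fm, VSets.IsExtEq E → VSets.Provable (.all
        (((VSets.meaningfulSeq (VSets.v 0)).and (VSets.hasUntrue (VSets.v 0))).imp
          ((VSets.Fm.isV (.fn V ![VSets.v 0])).and
            ((VSets.closedUnderBuilding E (VSets.v 0) (.fn V ![VSets.v 0])).and
              (VSets.regular E (.fn V ![VSets.v 0]))))))) ∧
      -- `V(τ)` contains only v-sets that can be built from `τ`
      (∀ φ : VSets.Fm, VSets.Provable (.all
        (((VSets.meaningfulSeq (VSets.v 0)).and (VSets.hasUntrue (VSets.v 0))).imp
          (VSets.inductivelyBuilt φ (VSets.v 0) (.fn V ![VSets.v 0])))))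
  :=
  ⟨VSets.exists_extEq, fun E hE =>
    have : VSets.ExtEq E := ⟨hE⟩
    VSets.provable_regularExtension E, VSets.exists_functions⟩
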